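/- Let $n\ge 2$ and let $(M,g)$ be a smooth $n$-dimensional Riemannian manifold with (possibly empty) boundary $\partial M$ and outward unit normal $\eta$. Let $0<\alpha<\frac{4}{n-1}$ and let $u$ be a positive $C^2$ function on $M$. For a piecewise $C^1$ curve $c$ put $L_u^\alpha(c)=\int_c u^\alpha\,ds$. For $x\in M$ put $\mathrm{Ric}(x)=\inf\{\mathrm{Ric}(v,v): v\in T_xM,\ g(v,v)=1\}$, and let $H_{\partial M}$ be the trace over $T\partial M$ of $h(X,Y)=g(\nabla_X\eta,Y)$. Let $\gamma:I\to M$ be a $C^1$ curve parametrized by arc length which is complete, that is, $I\subset\mathbb R$ is a closed nondegenerate interval and $\gamma$ maps every endpoint of $I$ (if there is any) to $\partial M$. Assume that $\gamma$ is $L_u^\alpha$-minimizing in the free boundary sense, that is, for all $s_1\le s_2$ in $I$: 1. $L_u^\alpha(\tilde\gamma)\ge L_u^\alpha(\gamma|_{[s_1,s_2]})$ for every piecewise $C^1$ curve $\tilde\gamma$ in $M$ that connects $\gamma(s_1)$ and $\gamma(s_2)$; 2. $L_u^\alpha(\tilde\gamma_1)+L_u^\alpha(\tilde\gamma_2)\ge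 L_u^\alpha(\gamma|_{[s_1,s_2]})$ for all piecewise $C^1$ curves $\tilde\gamma_1,\tilde\gamma_2$ in $M$ such that $\tilde\gamma_i$ connects $\gamma(s_i)$ to $\partial M$ $(i=1,2)$. Suppose that $$\mathrm{Ric}-\alpha u^{-1}\Delta u\ge 0\quad\text{on } M,\qquad H_{\partial M}-\alpha u^{-1}u_s\ge 0\quad\text{on }\partial M,$$ where $u_s=-\partial u/\partial\eta$ denotes the derivative of $u$ in the direction of the inward unit normal. Then $|\nabla u|=0$ and $\mathrm{Ric}-\alpha u^{-1}\Delta u=0$ at every point of $\gamma(I)$. -/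

import Mathlib

open Set MeasureTheory
open scoped Manifold ContDiff

noncomputable section

namespace WeightedCurves

/-! ### Riemannian manifolds with boundary

A smooth `n`-dimensional manifold with (possibly empty) boundary is modelled on the Euclidean half
space `{y | 0 ≤ y 0}` through `𝓡∂ n`.  The tensors below are written in the coordinates of the
preferred chart at a point `p`; all partial derivatives are taken within the half space, hence are
one-sided at boundary points. -/

/-- A smooth Riemannian metric on a manifold with boundary. -/
abbrev Metric (n : ℕ) [NeZero n] (M : Type*) [TopologicalSpace M]
    [ChartedSpace (EuclideanHalfSpace n) M] [IsManifold (𝓡∂ n) ∞ M] :=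
  Bundle.ContMDiffRiemannianMetric (𝓡∂ n) ∞ (EuclideanSpace ℝ (Fin n))
    (fun x : M => TangentSpace (𝓡∂ n) x)

/-- The partial derivative `∂ᵢ f` at a point of the half space. -/
def partialDeriv {n : ℕ} [NeZero n] (i : Fin n) (f : EuclideanSpace ℝ (Fin n) → ℝ)
    (y : EuclideanSpace ℝ (Fin n)) : ℝ :=
  fderivWithin ℝ f (range (𝓡∂ n)) y (EuclideanSpace.single i 1)

section Curvature

variable {n : ℕ} [NeZero n] {M : Type*} [TopologicalSpace M]
  [ChartedSpace (EuclideanHalfSpace n) M]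

/-- The coordinate vector field `∂ᵢ` of the chart at `p`, at the point with coordinates `y`. -/
def coordVector (p : M) (y : EuclideanSpace ℝ (Fin n)) (i : Fin n) :
    TangentSpace (𝓡∂ n) ((extChartAt (𝓡∂ n) p).symm y) :=
  mfderivWithin 𝓘(ℝ, EuclideanSpace ℝ (Fin n)) (𝓡∂ n) (extChartAt (𝓡∂ n) p).symm
    (range (𝓡∂ n)) y (EuclideanSpace.single i (1 : ℝ) : EuclideanSpace ℝ (Fin n))

/-- The components of a tangent vector at `p` in the chart at `p`. -/
def components (p : M) (v : TangentSpace (𝓡∂ n) p) : EuclideanSpace ℝ (Fin n) :=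
  mfderiv (𝓡∂ n) 𝓘(ℝ, EuclideanSpace ℝ (Fin n)) (extChartAt (𝓡∂ n) p) p v

/-- The coordinate expression of a function in the chart at `p`. -/
def coordFun (p : M) (f : M → ℝ) (y : EuclideanSpace ℝ (Fin n)) : ℝ :=
  f ((extChartAt (𝓡∂ n) p).symm y)

variable [IsManifold (𝓡∂ n) ∞ M] (g : Metric n M)

/-- The matrix `(gᵢⱼ)` in the chart at `p`, at the point with coordinates `y`. -/
def gramMatrix (p : M) (y : EuclideanSpace ℝ (Fin n)) : Matrix (Fin n) (Fin n) ℝ :=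
  Matrix.of fun i j =>
    g.inner ((extChartAt (𝓡∂ n) p).symm y) (coordVector p y i) (coordVector p y j)

/-- The inverse matrix `(gⁱʲ)`. -/
def gramInv (p : M) (y : EuclideanSpace ℝ (Fin n)) : Matrix (Fin n) (Fin n) ℝ :=
  (gramMatrix g p y)⁻¹

/-- The Christoffel symbol `Γᵏᵢⱼ` of the Levi-Civita connection. -/
def christoffel (p : M) (k i j : Fin n) (y : EuclideanSpace ℝ (Fin n)) : ℝ :=
  (1 / 2) * ∑ l, gramInv g p y k l *
    (partialDeriv i (fun z => gramMatrix g p z j l) y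
      + partialDeriv j (fun z => gramMatrix g p z i l) y
      - partialDeriv l (fun z => gramMatrix g p z i j) y)

/-- The component `Ricⱼₖ` of the Ricci tensor. -/
def ricciCoord (p : M) (j k : Fin n) (y : EuclideanSpace ℝ (Fin n)) : ℝ :=
  ∑ i, (partialDeriv i (christoffel g p i j k) y - partialDeriv j (christoffel g p i i k) y
    + ∑ l, (christoffel g p i i l y * christoffel g p l j k y
      - christoffel g p i j l y * christoffel g p l i k y))

/-- `Ric(v, v)` for a tangent vector `v` at `x`. -/
def ricci (x : M) (v : TangentSpace (𝓡∂ n) x) : ℝ :=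
  ∑ j, ∑ k, ricciCoord g x j k (extChartAt (𝓡∂ n) x x) * components x v j * components x v k

/-- The lowest Ricci curvature at `x`: the infimum of `Ric(v, v)` over unit vectors `v` at `x`. -/
def ricciMin (x : M) : ℝ :=
  sInf {r : ℝ | ∃ v : TangentSpace (𝓡∂ n) x, g.inner x v v = 1 ∧ r = ricci g x v}

/-- The Laplace-Beltrami operator `Δu = gⁱʲ (∂ᵢ∂ⱼ u - Γᵏᵢⱼ ∂ₖ u)`. -/
def laplacian (u : M → ℝ) (x : M) : ℝ :=
  ∑ i, ∑ j, gramInv g x (extChartAt (𝓡∂ n) x x) i j *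
    (partialDeriv i (partialDeriv j (coordFun x u)) (extChartAt (𝓡∂ n) x x)
      - ∑ k, christoffel g x k i j (extChartAt (𝓡∂ n) x x)
          * partialDeriv k (coordFun x u) (extChartAt (𝓡∂ n) x x))

/-- The norm of the gradient, `|∇u| = (gⁱʲ ∂ᵢu ∂ⱼu)^(1/2)`. -/
def gradNorm (u : M → ℝ) (x : M) : ℝ :=
  Real.sqrt (∑ i, ∑ j, gramInv g x (extChartAt (𝓡∂ n) x x) i j *
    partialDeriv i (coordFun x u) (extChartAt (𝓡∂ n) x x) *
    partialDeriv j (coordFun x u) (extChartAt (𝓡∂ n) x x))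

/-- The components of `η = -∇y₀ / |∇y₀|`, where `y₀` is the first coordinate of the chart at `p`.
As `M` is `{y₀ ≥ 0}` and `∂M` is `{y₀ = 0}` in this chart, `η` is the outward unit normal of `∂M`
at the boundary points of the chart, and a unit vector field that extends it elsewhere. -/
def outwardNormal (p : M) (i : Fin n) (y : EuclideanSpace ℝ (Fin n)) : ℝ :=
  -(gramInv g p y i 0) / Real.sqrt (gramInv g p y 0 0)

/-- `h(∂ᵢ, ∂ⱼ) = g(∇_{∂ᵢ} η, ∂ⱼ)`; the second fundamental form of `∂M` is the restriction of `h`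
to vectors tangent to `∂M`. -/
def normalShape (p : M) (i j : Fin n) (y : EuclideanSpace ℝ (Fin n)) : ℝ :=
  ∑ k, gramMatrix g p y j k *
    (partialDeriv i (outwardNormal g p k) y
      + ∑ l, christoffel g p k i l y * outwardNormal g p l y)

/-- The mean curvature `H` of `∂M` at a boundary point `x` with respect to the outward normal: the
trace of the second fundamental form over `T_x ∂M`, whose inverse metric is `gⁱʲ - ηⁱηʲ`. -/
def meanCurvature (x : M) : ℝ :=
  ∑ i, ∑ j, (gramInv g x (extChartAt (𝓡∂ n) x x) i j
      - outwardNormal g x i (extChartAt (𝓡∂ n) x x)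
        * outwardNormal g x j (extChartAt (𝓡∂ n) x x))
    * normalShape g x i j (extChartAt (𝓡∂ n) x x)

/-- The derivative of `u` at a boundary point in the direction of the inward unit normal `-η`. -/
def inwardNormalDeriv (u : M → ℝ) (x : M) : ℝ :=
  -∑ i, outwardNormal g x i (extChartAt (𝓡∂ n) x x)
    * partialDeriv i (coordFun x u) (extChartAt (𝓡∂ n) x x)

end Curvature

section Curves

variable {n : ℕ} [NeZero n] {M : Type*} [TopologicalSpace M]
  [ChartedSpace (EuclideanHalfSpace n) M]

variable (n) in
/-- `c` is a piecewise `C¹` curve on `[a, b]`: continuous, and `C¹` on each closed subinterval with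
no corner time in its interior, where there are finitely many corner times. -/
def IsPiecewiseC1 (c : ℝ → M) (a b : ℝ) : Prop :=
  ContinuousOn c (Icc a b) ∧ ∃ S : Finset ℝ, ∀ s t : ℝ, a ≤ s → s ≤ t → t ≤ b →
    (∀ r ∈ S, r ∉ Ioo s t) → ContMDiffOn 𝓘(ℝ, ℝ) (𝓡∂ n) 1 c (Icc s t)

variable [IsManifold (𝓡∂ n) ∞ M] (g : Metric n M)

/-- The weighted length `∫ u^α ds` of `c` on `[a, b]`.  The velocity of a piecewise `C¹` curve
exists at all but finitely many times. -/
def weightedLength (u : M → ℝ) (α : ℝ) (c : ℝ → M) (a b : ℝ) : ℝ :=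
  ∫ s in a..b, u (c s) ^ α *
    Real.sqrt (g.inner (c s) (mfderiv 𝓘(ℝ, ℝ) (𝓡∂ n) c s (1 : ℝ))
      (mfderiv 𝓘(ℝ, ℝ) (𝓡∂ n) c s (1 : ℝ)))

/-- `γ` is a `C¹` curve on `J`, parametrized by arc length. -/
def IsArclengthCurve (γ : ℝ → M) (J : Set ℝ) : Prop :=
  ContMDiffOn 𝓘(ℝ, ℝ) (𝓡∂ n) 1 γ J ∧
    ∀ s ∈ J, g.inner (γ s) (mfderivWithin 𝓘(ℝ, ℝ) (𝓡∂ n) γ J s (1 : ℝ))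
      (mfderivWithin 𝓘(ℝ, ℝ) (𝓡∂ n) γ J s (1 : ℝ)) = 1

variable (n) in
/-- A curve parametrized by arc length on `J` is complete if `J` is a closed nondegenerate interval
and each endpoint of `J`, if there is any, is mapped to the boundary of the manifold. -/
def IsCompleteCurve (γ : ℝ → M) (J : Set ℝ) : Prop :=
  J.OrdConnected ∧ J.Nontrivial ∧ IsClosed J ∧ ∀ s ∈ frontier J, γ s ∈ (𝓡∂ n).boundary M

/-- `γ` minimizes the weighted length in the free boundary sense on `J`: no segment of `γ` is longer
than a curve with the same endpoints, or than two curves together that connect the endpoints of the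
segment to the boundary. -/
def IsFreeBoundaryMinimizing (u : M → ℝ) (α : ℝ) (γ : ℝ → M) (J : Set ℝ) : Prop :=
  ∀ s₁ ∈ J, ∀ s₂ ∈ J, s₁ ≤ s₂ →
    (∀ (c : ℝ → M) (a b : ℝ), a ≤ b → IsPiecewiseC1 n c a b → c a = γ s₁ → c b = γ s₂ →
      weightedLength g u α γ s₁ s₂ ≤ weightedLength g u α c a b) ∧
    (∀ (c₁ c₂ : ℝ → M) (a₁ b₁ a₂ b₂ : ℝ), a₁ ≤ b₁ → a₂ ≤ b₂ →
      IsPiecewiseC1 n c₁ a₁ b₁ → IsPiecewiseC1 n c₂ a₂ b₂ →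
      c₁ a₁ = γ s₁ → c₁ b₁ ∈ (𝓡∂ n).boundary M →
      c₂ a₂ = γ s₂ → c₂ b₂ ∈ (𝓡∂ n).boundary M →
      weightedLength g u α γ s₁ s₂ ≤
        weightedLength g u α c₁ a₁ b₁ + weightedLength g u α c₂ a₂ b₂)

end Curves

end WeightedCurves

end

set_option linter.unusedSectionVars false
set_option maxSynthPendingDepth 3

open Set MeasureTheory
open scoped Manifold ContDiff

noncomputable section

namespace WeightedCurves

/-! Put W = u^α and l = d log W. The curve is a geodesic of the conformal metric W²g, and the
classical route is the second variation of ∫ W ds. For an orthonormal frame scaled by φ = ψ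
W^(-1/2), summing over the frame and completing a square bounds the second variation density by C
ψ'² - D ψ², where D is `deficit` and C is `cutoffConst n α` (`sum_second_variation`,
`second_variation_le`). Expanding Δ(u^α) and using |du(v)| ≤ |∇u| gives D ≥ (Ric - α u⁻¹ Δu) +
(1/2)(1/α - (n-1)/4)(α|∇u|/u)² (`le_deficit`). The condition α < 4/(n-1) says precisely that the
last coefficient is positive. Both terms on the right are then nonnegative, so D ≤ 0 at a point of
the curve forces both conclusions there (`MinCurve.rigidity`). It remains to exclude D > 0.

A segment with both ends on the boundary would have length at most zero, by comparison with two
constant curves. So a complete minimizing curve is a line, or a ray that starts or ends on ∂M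
(`IsCompleteCurve.eq_univ_or_ray`). Reversing time if necessary, every case is reduced to curves on
(-∞, T]. Such a curve lies in the interior before T and can meet ∂M at T only transversally: after a
tangential contact, dropping to the boundary slightly earlier would be cheaper
(`FreeCurve.vel_zero_ne_zero`).

The second variation is organized as a Riccati comparison, so that only one chart is needed at a
time. `AdmIn` with parameter κ says that the weighted distance from β(t₀) has, near β(s), an upper
barrier with gradient the momentum W g(β', ·), up to an arbitrarily small multiple of the squared
distance, and with covariant Hessian of trace at most κ W. This notion does not depend on the chart
(`MinCurve.admIn_chartChange`). Appending a short piece of varied curve moves the barrier forward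
and increases ψ²κ by at most the integral of C ψ'² - D ψ² plus an arbitrarily small error
(`MinCurve.startIn_step`, `MinCurve.admIn_step`, `MinCurve.riccatiAt_propagate`). Since the curve
extends infinitely far back, a cutoff rising linearly from 0 to 1 over a long interval yields
arbitrarily small κ > 0 (`MinCurve.exists_admIn_le`). If D > 0 at one time, κ becomes negative at
the end T (`MinCurve.exists_admIn_neg`).

A negative κ contradicts minimality. On a line, the barriers of the two halves add up to a function
with a minimum at the common point, so κ + κ' ≥ 0 (`AdmIn.add_nonneg`). On a ray, the free boundary
condition makes the curve orthogonal to ∂M and the barrier Hessian nonnegative on T∂M. Minimality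
along the curve itself bounds the Hessian from below in the normal direction, and together with H -
α u⁻¹ u_s ≥ 0 this gives κ ≥ 0 (`MinCurve.nonneg_of_boundary`). -/

open Filter Topology Asymptotics

/-! ### The metric as a field of bilinear forms in a chart, and chart changes. -/

section MetricForm

variable {n : ℕ} [NeZero n] {M : Type*} [TopologicalSpace M]
  [ChartedSpace (EuclideanHalfSpace n) M]

/-- The derivative of the inverse of the chart at `p`. -/
def chartInvDeriv (p : M) (y : EuclideanSpace ℝ (Fin n)) :
    EuclideanSpace ℝ (Fin n) →L[ℝ] TangentSpace (𝓡∂ n) ((extChartAt (𝓡∂ n) p).symm y) :=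
  mfderivWithin 𝓘(ℝ, EuclideanSpace ℝ (Fin n)) (𝓡∂ n) (extChartAt (𝓡∂ n) p).symm
    (range (𝓡∂ n)) y

variable [IsManifold (𝓡∂ n) ∞ M] (g : Metric n M)

/-- The metric in the chart at `p`, as a bilinear form. -/
def metricForm (p : M) (y : EuclideanSpace ℝ (Fin n)) :
    EuclideanSpace ℝ (Fin n) →L[ℝ] EuclideanSpace ℝ (Fin n) →L[ℝ] ℝ :=
  ((chartInvDeriv p y).precomp ℝ).comp
    ((g.inner ((extChartAt (𝓡∂ n) p).symm y)).comp (chartInvDeriv p y))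

theorem metricForm_apply (p : M) (y v w : EuclideanSpace ℝ (Fin n)) :
    metricForm g p y v w =
      g.inner ((extChartAt (𝓡∂ n) p).symm y) (chartInvDeriv p y v) (chartInvDeriv p y w) :=
  rfl

theorem metricForm_symm (p : M) (y v w : EuclideanSpace ℝ (Fin n)) :
    metricForm g p y v w = metricForm g p y w v := by
  simp only [metricForm_apply]
  exact g.symm _ _ _

instance instIsManifoldOne : IsManifold (𝓡∂ n) 1 M := IsManifold.of_le (n := ∞) (by simp)

theorem metricForm_pos (p : M) {y : EuclideanSpace ℝ (Fin n)}
    (hy : y ∈ (extChartAt (𝓡∂ n) p).target) {v : EuclideanSpace ℝ (Fin n)} (hv : v ≠ 0) :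
    0 < metricForm g p y v v := by
  rw [metricForm_apply]
  apply g.pos
  intro h
  apply hv
  have hinv : (chartInvDeriv p y).IsInvertible := isInvertible_mfderivWithin_extChartAt_symm hy
  exact hinv.injective (by rw [h, map_zero])

theorem gramMatrix_apply (p : M) (y : EuclideanSpace ℝ (Fin n)) (i j : Fin n) :
    gramMatrix g p y i j =
      metricForm g p y (EuclideanSpace.single i 1) (EuclideanSpace.single j 1) := rfl

/-- The tangent map of the smooth inverse chart sends constant fields to smooth sections of the
tangent bundle; the metric pairs two such sections smoothly. -/
theorem contDiffOn_metricForm (p : M) :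
    ContDiffOn ℝ ∞ (metricForm g p) (extChartAt (𝓡∂ n) p).target := by
  have key : ∀ v : EuclideanSpace ℝ (Fin n),
      ContMDiffOn 𝓘(ℝ, EuclideanSpace ℝ (Fin n)) ((𝓡∂ n).prod 𝓘(ℝ, EuclideanSpace ℝ (Fin n))) ∞
        (fun y => (⟨(extChartAt (𝓡∂ n) p).symm y, chartInvDeriv p y v⟩ :
          TangentBundle (𝓡∂ n) M)) (extChartAt (𝓡∂ n) p).target := by
    intro v y hy
    have h1 : ContMDiffOn 𝓘(ℝ, EuclideanSpace ℝ (Fin n)) (𝓡∂ n) ∞ (extChartAt (𝓡∂ n) p).symm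
      (extChartAt (𝓡∂ n) p).target := contMDiffOn_extChartAt_symm p
    have hu : UniqueMDiffOn 𝓘(ℝ, EuclideanSpace ℝ (Fin n)) (extChartAt (𝓡∂ n) p).target :=
      (uniqueDiffOn_extChartAt_target p).uniqueMDiffOn
    have h2 := h1.contMDiffOn_tangentMapWithin (m := ∞) (by simp) hu
    have h3 : ContMDiffOn 𝓘(ℝ, EuclideanSpace ℝ (Fin n)) (𝓘(ℝ, EuclideanSpace ℝ (Fin n)).tangent) ∞
        (fun y => (⟨y, v⟩ : TangentBundle 𝓘(ℝ, EuclideanSpace ℝ (Fin n))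
          (EuclideanSpace ℝ (Fin n)))) (extChartAt (𝓡∂ n) p).target := by
      rw [contMDiffOn_vectorSpace_iff_contDiffOn (V := fun _ => v)]
      exact contDiffOn_const
    have h4 := h2.comp h3 (fun z hz => hz)
    refine (h4 y hy).congr_of_eventuallyEq ?_ ?_
    · filter_upwards [self_mem_nhdsWithin] with z hz
      simp only [Function.comp, tangentMapWithin, chartInvDeriv]
      congr 2
      exact ((MDifferentiableWithinAt.mfderivWithin_mono
        (mdifferentiableWithinAt_extChartAt_symm hz) (hu z hz)
        (extChartAt_target_subset_range p))).symm
    · simp only [Function.comp, tangentMapWithin, chartInvDeriv]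
      congr 2
      exact ((MDifferentiableWithinAt.mfderivWithin_mono
        (mdifferentiableWithinAt_extChartAt_symm hy) (hu y hy)
        (extChartAt_target_subset_range p))).symm
  rw [contDiffOn_clm_apply]
  intro v
  rw [contDiffOn_clm_apply]
  intro w
  rw [← contMDiffOn_iff_contDiffOn]
  intro y hy
  have hb : ContMDiffWithinAt 𝓘(ℝ, EuclideanSpace ℝ (Fin n))
      ((𝓡∂ n).prod 𝓘(ℝ, ℝ)) ∞
      (fun m ↦ Bundle.TotalSpace.mk' ℝ (E := Bundle.Trivial M ℝ) ((extChartAt (𝓡∂ n) p).symm m)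
        (g.inner ((extChartAt (𝓡∂ n) p).symm m) (chartInvDeriv p m v) (chartInvDeriv p m w)))
      (extChartAt (𝓡∂ n) p).target y := by
    apply ContMDiffWithinAt.clm_bundle_apply₂ (F₁ := EuclideanSpace ℝ (Fin n))
      (F₂ := EuclideanSpace ℝ (Fin n))
    · exact ContMDiffAt.comp_contMDiffWithinAt y g.contMDiff.contMDiffAt
        (contMDiffOn_extChartAt_symm p y hy)
    · exact key v y hy
    · exact key w y hy
  simp only [Bundle.contMDiffWithinAt_totalSpace] at hb
  exact hb.2


/-- All tangent spaces are the model space by definition, so the base point can be rewritten while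
the vectors stay fixed. This avoids dependent rewriting whenever a chart is followed by its inverse.
-/
theorem inner_eq_of_eq {x y : M} (h : x = y) (v w : EuclideanSpace ℝ (Fin n)) :
    g.inner x v w = g.inner y v w := by
  subst h; rfl

/-- The coordinate change from the chart at `q` to the chart at `p`. -/
def chartChange (n : ℕ) [NeZero n] {M : Type*} [TopologicalSpace M]
    [ChartedSpace (EuclideanHalfSpace n) M] (q p : M) (y : EuclideanSpace ℝ (Fin n)) :
    EuclideanSpace ℝ (Fin n) :=
  extChartAt (𝓡∂ n) p ((extChartAt (𝓡∂ n) q).symm y)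

theorem contDiffWithinAt_chartChange {p q : M} {y : EuclideanSpace ℝ (Fin n)}
    (hy : y ∈ (extChartAt (𝓡∂ n) q).target)
    (hp : (extChartAt (𝓡∂ n) q).symm y ∈ (extChartAt (𝓡∂ n) p).source) :
    ContDiffWithinAt ℝ ∞ (chartChange n q p) (range (𝓡∂ n)) y :=
  contDiffWithinAt_ext_coord_change (I := 𝓡∂ n) (n := ∞) p q (by
    rw [PartialEquiv.trans_source, PartialEquiv.symm_source]
    exact ⟨hy, hp⟩)

theorem eventually_mem_chart {p q : M} {y : EuclideanSpace ℝ (Fin n)}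
    (hy : y ∈ (extChartAt (𝓡∂ n) q).target)
    (hp : (extChartAt (𝓡∂ n) q).symm y ∈ (extChartAt (𝓡∂ n) p).source) :
    ∀ᶠ z in 𝓝[range (𝓡∂ n)] y, z ∈ (extChartAt (𝓡∂ n) q).target ∧
      (extChartAt (𝓡∂ n) q).symm z ∈ (extChartAt (𝓡∂ n) p).source := by
  have h1 := extChartAt_target_mem_nhdsWithin_of_mem hy
  have h2 : ContinuousWithinAt (extChartAt (𝓡∂ n) q).symm (range (𝓡∂ n)) y :=
    ((continuousOn_extChartAt_symm q y hy).mono_of_mem_nhdsWithin h1)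
  exact (Filter.eventually_mem_set.2 h1).and
    (h2.eventually ((isOpen_extChartAt_source p).mem_nhds hp))

/-- Chain rule for inverse chart = other inverse chart ∘ coordinate change, with all derivatives
taken within the half space so that boundary points are included. -/
theorem chartInvDeriv_chartChange {p q : M} {y : EuclideanSpace ℝ (Fin n)}
    (hy : y ∈ (extChartAt (𝓡∂ n) q).target)
    (hp : (extChartAt (𝓡∂ n) q).symm y ∈ (extChartAt (𝓡∂ n) p).source)
    (v : EuclideanSpace ℝ (Fin n)) :
    (chartInvDeriv q y v : EuclideanSpace ℝ (Fin n)) =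
      chartInvDeriv p (chartChange n q p y)
        (fderivWithin ℝ (chartChange n q p) (range (𝓡∂ n)) y v) := by
  have hu : UniqueMDiffWithinAt 𝓘(ℝ, EuclideanSpace ℝ (Fin n)) (range (𝓡∂ n)) y :=
    ((𝓡∂ n).uniqueDiffOn y (extChartAt_target_subset_range q hy)).uniqueMDiffWithinAt
  have hψ : chartChange n q p y ∈ (extChartAt (𝓡∂ n) p).target :=
    (extChartAt (𝓡∂ n) p).map_source hp
  have h1 := mdifferentiableWithinAt_extChartAt_symm (I := 𝓡∂ n) (x := p) hψ
  have h2 : MDifferentiableWithinAt 𝓘(ℝ, EuclideanSpace ℝ (Fin n))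
      𝓘(ℝ, EuclideanSpace ℝ (Fin n)) (chartChange n q p) (range (𝓡∂ n)) y :=
    ((contDiffWithinAt_chartChange hy hp).differentiableWithinAt (by simp)).mdifferentiableWithinAt
  have hmaps : MapsTo (chartChange n q p) (range (𝓡∂ n)) (range (𝓡∂ n)) := by
    intro z _
    exact mem_range_self _
  have h3 := mfderivWithin_comp y h1 h2 hmaps hu
  rw [mfderivWithin_eq_fderivWithin] at h3
  have h4 : mfderivWithin 𝓘(ℝ, EuclideanSpace ℝ (Fin n)) (𝓡∂ n)
      ((extChartAt (𝓡∂ n) p).symm ∘ chartChange n q p) (range (𝓡∂ n)) y =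
      mfderivWithin 𝓘(ℝ, EuclideanSpace ℝ (Fin n)) (𝓡∂ n)
      ((extChartAt (𝓡∂ n) q).symm) (range (𝓡∂ n)) y := by
    apply Filter.EventuallyEq.mfderivWithin_eq
    · filter_upwards [eventually_mem_chart hy hp] with z hz
      exact (extChartAt (𝓡∂ n) p).left_inv hz.2
    · exact (extChartAt (𝓡∂ n) p).left_inv hp
  exact DFunLike.congr_fun (h4.symm.trans h3) v

theorem metricForm_chartChange {p q : M} {y : EuclideanSpace ℝ (Fin n)}
    (hy : y ∈ (extChartAt (𝓡∂ n) q).target)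
    (hp : (extChartAt (𝓡∂ n) q).symm y ∈ (extChartAt (𝓡∂ n) p).source)
    (v w : EuclideanSpace ℝ (Fin n)) :
    metricForm g q y v w = metricForm g p (chartChange n q p y)
        (fderivWithin ℝ (chartChange n q p) (range (𝓡∂ n)) y v)
        (fderivWithin ℝ (chartChange n q p) (range (𝓡∂ n)) y w) := by
  rw [metricForm_apply, metricForm_apply]
  have h1 := chartInvDeriv_chartChange hy hp v
  have h2 := chartInvDeriv_chartChange hy hp w
  have h3 : (extChartAt (𝓡∂ n) p).symm (chartChange n q p y) = (extChartAt (𝓡∂ n) q).symm y :=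
    (extChartAt (𝓡∂ n) p).left_inv hp
  refine Eq.trans ?_ (inner_eq_of_eq g h3 _ _).symm
  rw [← h1, ← h2]

/-- The speed of a curve in coordinates. -/
theorem inner_mfderivWithin (p : M) {c : ℝ → M} {s : Set ℝ} {t : ℝ}
    (hc : MDifferentiableWithinAt 𝓘(ℝ, ℝ) (𝓡∂ n) c s t) (hs : UniqueDiffWithinAt ℝ s t)
    (hp : c t ∈ (extChartAt (𝓡∂ n) p).source) :
    g.inner (c t) (mfderivWithin 𝓘(ℝ, ℝ) (𝓡∂ n) c s t (1 : ℝ))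
      (mfderivWithin 𝓘(ℝ, ℝ) (𝓡∂ n) c s t (1 : ℝ)) =
    metricForm g p (extChartAt (𝓡∂ n) p (c t)) (derivWithin (fun r => extChartAt (𝓡∂ n) p (c r)) s t)
      (derivWithin (fun r => extChartAt (𝓡∂ n) p (c r)) s t) := by
  have hp' : c t ∈ (chartAt (EuclideanHalfSpace n) p).source := by
    rwa [extChartAt_source] at hp
  have h1 := mfderiv_comp_mfderivWithin t (mdifferentiableAt_extChartAt (I := 𝓡∂ n) hp') hc
    hs.uniqueMDiffWithinAt
  have h2 : derivWithin (fun r => extChartAt (𝓡∂ n) p (c r)) s t =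
      mfderiv (𝓡∂ n) 𝓘(ℝ, EuclideanSpace ℝ (Fin n)) (extChartAt (𝓡∂ n) p) (c t)
        (mfderivWithin 𝓘(ℝ, ℝ) (𝓡∂ n) c s t (1 : ℝ)) := by
    have := DFunLike.congr_fun h1 (1 : ℝ)
    rw [mfderivWithin_eq_fderivWithin] at this
    exact this
  have h3 := mfderivWithin_extChartAt_symm_comp_mfderiv_extChartAt' (I := 𝓡∂ n) hp
  have h4 : chartInvDeriv p (extChartAt (𝓡∂ n) p (c t))
      (derivWithin (fun r => extChartAt (𝓡∂ n) p (c r)) s t) =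
      (mfderivWithin 𝓘(ℝ, ℝ) (𝓡∂ n) c s t (1 : ℝ) : EuclideanSpace ℝ (Fin n)) := by
    rw [h2]
    exact DFunLike.congr_fun h3 _
  rw [metricForm_apply]
  refine Eq.trans ?_ (inner_eq_of_eq g ((extChartAt (𝓡∂ n) p).left_inv hp) _ _).symm
  rw [h4]

end MetricForm

/-! ### Christoffel symbols as a bilinear map: Koszul formula, symmetry, metric compatibility,
smoothness. -/

section Christoffel

variable {n : ℕ} [NeZero n] {M : Type*} [TopologicalSpace M]
  [ChartedSpace (EuclideanHalfSpace n) M] [IsManifold (𝓡∂ n) ∞ M] (g : Metric n M)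

theorem eq_sum_single (v : EuclideanSpace ℝ (Fin n)) :
    v = ∑ i, v i • EuclideanSpace.single i (1 : ℝ) := by
  ext j
  simp [Pi.single_apply]

theorem bilin_eq_sum (B : EuclideanSpace ℝ (Fin n) →ₗ[ℝ] EuclideanSpace ℝ (Fin n) →ₗ[ℝ] ℝ)
    (v w : EuclideanSpace ℝ (Fin n)) :
    B v w = ∑ i, ∑ j, B (EuclideanSpace.single i 1) (EuclideanSpace.single j 1) * v i * w j := by
  conv_lhs => rw [eq_sum_single v, eq_sum_single w]
  simp only [map_sum, map_smul, LinearMap.sum_apply, LinearMap.smul_apply, smul_eq_mul]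
  simp only [Finset.mul_sum]
  rw [Finset.sum_comm]
  refine Finset.sum_congr rfl fun i _ => Finset.sum_congr rfl fun j _ => by ring

theorem metricForm_eq_sum (p : M) (y v w : EuclideanSpace ℝ (Fin n)) :
    metricForm g p y v w = ∑ i, ∑ j, gramMatrix g p y i j * v i * w j :=
  bilin_eq_sum ((metricForm g p y).toLinearMap₁₂) v w

theorem uniqueDiffOn_range : UniqueDiffOn ℝ (range (𝓡∂ n)) := (𝓡∂ n).uniqueDiffOn

theorem contDiffWithinAt_metricForm (p : M) {y : EuclideanSpace ℝ (Fin n)}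
    (hy : y ∈ (extChartAt (𝓡∂ n) p).target) :
    ContDiffWithinAt ℝ ∞ (metricForm g p) (range (𝓡∂ n)) y :=
  (contDiffOn_metricForm g p y hy).mono_of_mem_nhdsWithin (extChartAt_target_mem_nhdsWithin_of_mem hy)

theorem differentiableWithinAt_metricForm (p : M) {y : EuclideanSpace ℝ (Fin n)}
    (hy : y ∈ (extChartAt (𝓡∂ n) p).target) :
    DifferentiableWithinAt ℝ (metricForm g p) (range (𝓡∂ n)) y :=
  (contDiffWithinAt_metricForm g p hy).differentiableWithinAt (by simp)

theorem fderivWithin_metricForm_apply (p : M) {y : EuclideanSpace ℝ (Fin n)}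
    (hy : y ∈ (extChartAt (𝓡∂ n) p).target) (v w z : EuclideanSpace ℝ (Fin n)) :
    fderivWithin ℝ (fun x => metricForm g p x v w) (range (𝓡∂ n)) y z =
      fderivWithin ℝ (metricForm g p) (range (𝓡∂ n)) y z v w := by
  have h := (differentiableWithinAt_metricForm g p hy).hasFDerivWithinAt
  have h2 := (h.clm_apply (hasFDerivWithinAt_const v y _)).clm_apply
    (hasFDerivWithinAt_const w y _)
  rw [h2.fderivWithin (uniqueDiffOn_range y (extChartAt_target_subset_range p hy))]
  simp

theorem fderivWithin_metricForm_symm (p : M) {y : EuclideanSpace ℝ (Fin n)}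
    (hy : y ∈ (extChartAt (𝓡∂ n) p).target) (v w z : EuclideanSpace ℝ (Fin n)) :
    fderivWithin ℝ (metricForm g p) (range (𝓡∂ n)) y z v w =
      fderivWithin ℝ (metricForm g p) (range (𝓡∂ n)) y z w v := by
  rw [← fderivWithin_metricForm_apply g p hy, ← fderivWithin_metricForm_apply g p hy]
  simp_rw [metricForm_symm g p _ v w]

theorem isSymm_gramMatrix (p : M) (y : EuclideanSpace ℝ (Fin n)) :
    (gramMatrix g p y).transpose = gramMatrix g p y := by
  ext i j
  simp only [Matrix.transpose_apply, gramMatrix_apply]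
  exact metricForm_symm g p _ _ _

theorem posDef_gramMatrix (p : M) {y : EuclideanSpace ℝ (Fin n)}
    (hy : y ∈ (extChartAt (𝓡∂ n) p).target) : (gramMatrix g p y).PosDef := by
  refine Matrix.PosDef.of_dotProduct_mulVec_pos ?_ fun v hv => ?_
  · rw [Matrix.IsHermitian, Matrix.conjTranspose_eq_transpose_of_trivial, isSymm_gramMatrix]
  · have h := metricForm_pos g p hy (v := WithLp.toLp 2 v) (by simpa using hv)
    rw [metricForm_eq_sum] at h
    refine h.trans_eq ?_
    simp only [dotProduct, Matrix.mulVec, Pi.star_apply, star_trivial, Finset.mul_sum]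
    refine Finset.sum_congr rfl fun i _ => Finset.sum_congr rfl fun j _ => by ring

theorem isUnit_det_gramMatrix (p : M) {y : EuclideanSpace ℝ (Fin n)}
    (hy : y ∈ (extChartAt (𝓡∂ n) p).target) : IsUnit (gramMatrix g p y).det :=
  (posDef_gramMatrix g p hy).det_pos.ne'.isUnit

/-- The Christoffel symbols in the chart at `p`, as a bilinear map. -/
def christoffelMap (p : M) (y : EuclideanSpace ℝ (Fin n)) :
    EuclideanSpace ℝ (Fin n) →L[ℝ] EuclideanSpace ℝ (Fin n) →L[ℝ] EuclideanSpace ℝ (Fin n) :=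
  ∑ k, ∑ i, ∑ j, christoffel g p k i j y •
    (EuclideanSpace.proj i : EuclideanSpace ℝ (Fin n) →L[ℝ] ℝ).smulRight
      ((EuclideanSpace.proj j : EuclideanSpace ℝ (Fin n) →L[ℝ] ℝ).smulRight
        (EuclideanSpace.single k (1 : ℝ)))

theorem christoffelMap_apply (p : M) (y v w : EuclideanSpace ℝ (Fin n)) (k : Fin n) :
    christoffelMap g p y v w k = ∑ i, ∑ j, christoffel g p k i j y * v i * w j := by
  simp only [christoffelMap, sum_apply, smul_apply,
    ContinuousLinearMap.smulRight_apply, PiLp.proj_apply, WithLp.ofLp_sum, WithLp.ofLp_smul,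
    Finset.sum_apply, Pi.smul_apply, smul_eq_mul]
  rw [Finset.sum_eq_single k]
  · refine Finset.sum_congr rfl fun i _ => Finset.sum_congr rfl fun j _ => ?_
    simp
    ring
  · intro b _ hb
    refine Finset.sum_eq_zero fun i _ => Finset.sum_eq_zero fun j _ => ?_
    simp [hb.symm]
  · simp

theorem christoffelMap_single (p : M) (y : EuclideanSpace ℝ (Fin n)) (k i j : Fin n) :
    christoffelMap g p y (EuclideanSpace.single i 1) (EuclideanSpace.single j 1) k =
      christoffel g p k i j y := by
  rw [christoffelMap_apply, Finset.sum_eq_single i, Finset.sum_eq_single j]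
  · simp
  · intro b _ hb; simp [hb]
  · simp
  · intro b _ hb; simp [hb]
  · simp

theorem partialDeriv_gramMatrix (p : M) {y : EuclideanSpace ℝ (Fin n)}
    (hy : y ∈ (extChartAt (𝓡∂ n) p).target) (i j l : Fin n) :
    partialDeriv i (fun z => gramMatrix g p z j l) y =
      fderivWithin ℝ (metricForm g p) (range (𝓡∂ n)) y (EuclideanSpace.single i 1)
        (EuclideanSpace.single j 1) (EuclideanSpace.single l 1) :=
  fderivWithin_metricForm_apply g p hy _ _ _

theorem trilin_ext {T T' : EuclideanSpace ℝ (Fin n) →ₗ[ℝ] EuclideanSpace ℝ (Fin n) →ₗ[ℝ]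
      EuclideanSpace ℝ (Fin n) →ₗ[ℝ] ℝ}
    (h : ∀ i j k, T (EuclideanSpace.single i 1) (EuclideanSpace.single j 1)
      (EuclideanSpace.single k 1) = T' (EuclideanSpace.single i 1) (EuclideanSpace.single j 1)
      (EuclideanSpace.single k 1)) : T = T' := by
  ext u v w
  conv_lhs => rw [eq_sum_single u, eq_sum_single v, eq_sum_single w]
  conv_rhs => rw [eq_sum_single u, eq_sum_single v, eq_sum_single w]
  simp only [map_sum, map_smul, LinearMap.sum_apply, LinearMap.smul_apply, h]

/-- The Koszul formula. -/
theorem metricForm_christoffelMap (p : M) {y : EuclideanSpace ℝ (Fin n)}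
    (hy : y ∈ (extChartAt (𝓡∂ n) p).target) (u v w : EuclideanSpace ℝ (Fin n)) :
    metricForm g p y (christoffelMap g p y u v) w =
      (1 / 2) * (fderivWithin ℝ (metricForm g p) (range (𝓡∂ n)) y u v w
        + fderivWithin ℝ (metricForm g p) (range (𝓡∂ n)) y v u w
        - fderivWithin ℝ (metricForm g p) (range (𝓡∂ n)) y w u v) := by
  set D := fderivWithin ℝ (metricForm g p) (range (𝓡∂ n)) y with hD
  let T : EuclideanSpace ℝ (Fin n) →ₗ[ℝ] EuclideanSpace ℝ (Fin n) →ₗ[ℝ]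
      EuclideanSpace ℝ (Fin n) →ₗ[ℝ] ℝ :=
    LinearMap.mk₂ ℝ (fun u v => (metricForm g p y (christoffelMap g p y u v)).toLinearMap)
      (fun _ _ _ => by ext; simp) (fun _ _ _ => by ext; simp) (fun _ _ _ => by ext; simp)
      (fun _ _ _ => by ext; simp)
  let T' : EuclideanSpace ℝ (Fin n) →ₗ[ℝ] EuclideanSpace ℝ (Fin n) →ₗ[ℝ]
      EuclideanSpace ℝ (Fin n) →ₗ[ℝ] ℝ :=
    LinearMap.mk₂ ℝ (fun u v => (1 / 2 : ℝ) • ((D u v).toLinearMap + (D v u).toLinearMap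
      - ((D.flip u).flip v).toLinearMap))
      (fun _ _ _ => by ext; simp; ring) (fun _ _ _ => by ext; simp; ring)
      (fun _ _ _ => by ext; simp; ring) (fun _ _ _ => by ext; simp; ring)
  have hT : T = T' := by
    apply trilin_ext
    intro i j m
    change metricForm g p y (christoffelMap g p y _ _) _ = (1 / 2 : ℝ) * (D _ _ _ + D _ _ _ - D _ _ _)
    rw [metricForm_symm, metricForm_eq_sum]
    simp only [christoffelMap_single, hD]
    rw [Finset.sum_eq_single m]
    · simp only [christoffel, ← partialDeriv_gramMatrix g p hy, gramInv]
      simp only [PiLp.single_apply, ↓reduceIte, mul_one]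
      have hinv := Matrix.mul_nonsing_inv _ (isUnit_det_gramMatrix g p hy)
      set X : Fin n → ℝ := fun l => partialDeriv i (fun z => gramMatrix g p z j l) y +
        partialDeriv j (fun z => gramMatrix g p z i l) y -
          partialDeriv l (fun z => gramMatrix g p z i j) y with hX
      have h1 : ∀ l, ∑ k, gramMatrix g p y m k * (gramMatrix g p y)⁻¹ k l = (1 : Matrix _ _ ℝ) m l :=
        fun l => by rw [← hinv, Matrix.mul_apply]
      calc ∑ k, gramMatrix g p y m k * ((1 / 2) * ∑ l, (gramMatrix g p y)⁻¹ k l * X l)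
          = (1 / 2) * ∑ l, (∑ k, gramMatrix g p y m k * (gramMatrix g p y)⁻¹ k l) * X l := by
            simp only [Finset.mul_sum, Finset.sum_mul]
            rw [Finset.sum_comm]
            refine Finset.sum_congr rfl fun i _ => Finset.sum_congr rfl fun j _ => by ring
        _ = (1 / 2) * X m := by simp [h1, Matrix.one_apply]
    · intro b _ hb
      simp [hb]
    · simp
  exact DFunLike.congr_fun (DFunLike.congr_fun (DFunLike.congr_fun hT u) v) w

/-- The right side of the Koszul formula is symmetric in the first two slots, so the difference of
the two sides pairs to zero with every vector, in particular with itself. -/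
theorem christoffelMap_symm (p : M) {y : EuclideanSpace ℝ (Fin n)}
    (hy : y ∈ (extChartAt (𝓡∂ n) p).target) (u v : EuclideanSpace ℝ (Fin n)) :
    christoffelMap g p y u v = christoffelMap g p y v u := by
  rw [← sub_eq_zero]
  by_contra h
  have h1 := metricForm_pos g p hy h
  have h2 : ∀ a b z, metricForm g p y (a - b) z = metricForm g p y a z - metricForm g p y b z := by
    simp
  rw [h2, metricForm_christoffelMap g p hy, metricForm_christoffelMap g p hy, fderivWithin_metricForm_symm g p hy u v] at h1
  linarith

/-- Metric compatibility of the Levi-Civita connection: in the sum of two Koszul formulas all but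
one derivative of the metric cancel. -/
theorem fderivWithin_metricForm_eq (p : M) {y : EuclideanSpace ℝ (Fin n)}
    (hy : y ∈ (extChartAt (𝓡∂ n) p).target) (u v w : EuclideanSpace ℝ (Fin n)) :
    fderivWithin ℝ (metricForm g p) (range (𝓡∂ n)) y u v w =
      metricForm g p y (christoffelMap g p y u v) w
        + metricForm g p y v (christoffelMap g p y u w) := by
  rw [metricForm_symm g p y v, metricForm_christoffelMap g p hy, metricForm_christoffelMap g p hy,
    fderivWithin_metricForm_symm g p hy w v, fderivWithin_metricForm_symm g p hy v w,
    fderivWithin_metricForm_symm g p hy u w]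
  ring

theorem contDiffWithinAt_gramMatrix (p : M) {y : EuclideanSpace ℝ (Fin n)}
    (hy : y ∈ (extChartAt (𝓡∂ n) p).target) (i j : Fin n) :
    ContDiffWithinAt ℝ ∞ (fun z => gramMatrix g p z i j) (range (𝓡∂ n)) y :=
  ((contDiffWithinAt_metricForm g p hy).clm_apply contDiffWithinAt_const).clm_apply
    contDiffWithinAt_const

theorem contDiffWithinAt_det {m : ℕ} {F : Type*} [NormedAddCommGroup F] [NormedSpace ℝ F]
    {A : F → Matrix (Fin m) (Fin m) ℝ} {s : Set F} {y : F}
    (hA : ∀ i j, ContDiffWithinAt ℝ ∞ (fun z => A z i j) s y) :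
    ContDiffWithinAt ℝ ∞ (fun z => (A z).det) s y := by
  simp only [Matrix.det_apply']
  exact ContDiffWithinAt.sum fun σ _ => contDiffWithinAt_const.mul
    (contDiffWithinAt_prod fun i _ => hA _ _)

/-- Cramer's rule: the entries are cofactors divided by a positive determinant. -/
theorem contDiffWithinAt_gramInv (p : M) {y : EuclideanSpace ℝ (Fin n)}
    (hy : y ∈ (extChartAt (𝓡∂ n) p).target) (i j : Fin n) :
    ContDiffWithinAt ℝ ∞ (fun z => gramInv g p z i j) (range (𝓡∂ n)) y := by
  have hdet := contDiffWithinAt_det (contDiffWithinAt_gramMatrix g p hy)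
  simp only [gramInv, Matrix.inv_def, Matrix.smul_apply, Ring.inverse_eq_inv', smul_eq_mul,
    Matrix.adjugate_apply]
  refine (hdet.inv (posDef_gramMatrix g p hy).det_pos.ne').mul (contDiffWithinAt_det fun k l => ?_)
  by_cases hk : k = j
  · subst hk
    simpa [Matrix.updateRow_self] using contDiffWithinAt_const
  · simpa [Matrix.updateRow_ne hk] using contDiffWithinAt_gramMatrix g p hy k l

theorem contDiffWithinAt_partialDeriv {f : EuclideanSpace ℝ (Fin n) → ℝ} {m k : ℕ∞ω}
    {y : EuclideanSpace ℝ (Fin n)} (hy : y ∈ range (𝓡∂ n))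
    (hf : ContDiffWithinAt ℝ k f (range (𝓡∂ n)) y) (hk : m + 1 ≤ k) (i : Fin n) :
    ContDiffWithinAt ℝ m (partialDeriv i f) (range (𝓡∂ n)) y :=
  (hf.fderivWithin_right uniqueDiffOn_range hk hy).clm_apply contDiffWithinAt_const

theorem contDiffWithinAt_christoffel (p : M) {y : EuclideanSpace ℝ (Fin n)}
    (hy : y ∈ (extChartAt (𝓡∂ n) p).target) (k i j : Fin n) :
    ContDiffWithinAt ℝ ∞ (christoffel g p k i j) (range (𝓡∂ n)) y := by
  have hy' := extChartAt_target_subset_range p hy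
  have h : ∀ a b c, ContDiffWithinAt ℝ ∞ (partialDeriv a (fun z => gramMatrix g p z b c))
      (range (𝓡∂ n)) y := fun a b c =>
    contDiffWithinAt_partialDeriv hy' (contDiffWithinAt_gramMatrix g p hy b c) (by simp) a
  exact contDiffWithinAt_const.mul (ContDiffWithinAt.sum fun l _ =>
    (contDiffWithinAt_gramInv g p hy k l).mul (((h _ _ _).add (h _ _ _)).sub (h _ _ _)))

theorem contDiffWithinAt_christoffelMap (p : M) {y : EuclideanSpace ℝ (Fin n)}
    (hy : y ∈ (extChartAt (𝓡∂ n) p).target) :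
    ContDiffWithinAt ℝ ∞ (christoffelMap g p) (range (𝓡∂ n)) y := by
  have h : christoffelMap g p = fun y => ∑ k, ∑ i, ∑ j, christoffel g p k i j y •
    (EuclideanSpace.proj i : EuclideanSpace ℝ (Fin n) →L[ℝ] ℝ).smulRight
      ((EuclideanSpace.proj j : EuclideanSpace ℝ (Fin n) →L[ℝ] ℝ).smulRight
        (EuclideanSpace.single k (1 : ℝ))) := rfl
  rw [h]
  exact ContDiffWithinAt.sum fun k _ => ContDiffWithinAt.sum fun i _ => ContDiffWithinAt.sum
    fun j _ => (contDiffWithinAt_christoffel g p hy k i j).smul contDiffWithinAt_const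

end Christoffel

/-! ### Transformation law of the connection, curvature and its trace. -/

section Curv

variable {n : ℕ} [NeZero n] {M : Type*} [TopologicalSpace M]
  [ChartedSpace (EuclideanHalfSpace n) M] [IsManifold (𝓡∂ n) ∞ M] (g : Metric n M)

theorem range_subset_closure_interior :
    range (𝓡∂ n) ⊆ closure (interior (range (𝓡∂ n))) := (𝓡∂ n).range_subset_closure_interior

/-- Symmetry of second derivatives extends to the boundary of the half space because every point is
a limit of interior points. -/
theorem isSymmSndFDerivWithinAt_range {F : Type*} [NormedAddCommGroup F] [NormedSpace ℝ F]
    {f : EuclideanSpace ℝ (Fin n) → F} {y : EuclideanSpace ℝ (Fin n)}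
    (hf : ContDiffWithinAt ℝ 2 f (range (𝓡∂ n)) y) (hy : y ∈ range (𝓡∂ n)) :
    IsSymmSndFDerivWithinAt ℝ f (range (𝓡∂ n)) y :=
  hf.isSymmSndFDerivWithinAt (by simp) uniqueDiffOn_range
    (range_subset_closure_interior hy) hy

/-- A coordinate change is an isometry between the coordinate metrics, so its derivative cannot kill
a vector of positive length. -/
theorem injective_fderivWithin_chartChange {p q : M} {y : EuclideanSpace ℝ (Fin n)}
    (hy : y ∈ (extChartAt (𝓡∂ n) q).target)
    (hp : (extChartAt (𝓡∂ n) q).symm y ∈ (extChartAt (𝓡∂ n) p).source)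
    (g : Metric n M) :
    Function.Injective (fderivWithin ℝ (chartChange n q p) (range (𝓡∂ n)) y) := by
  rw [injective_iff_map_eq_zero]
  intro v hv
  by_contra h
  have h1 := metricForm_pos g q hy h
  rw [metricForm_chartChange g hy hp, hv] at h1
  simp at h1

/-- Differentiating the pullback relation between the two coordinate metrics expresses the
derivatives of one through those of the other plus the Hessian of the coordinate change. Inserted
into the Koszul formula, this shows that the two sides have the same inner product with every vector
in the image of the derivative, which is everything. -/
theorem christoffelMap_chartChange {p q : M} {y : EuclideanSpace ℝ (Fin n)}
    (hy : y ∈ (extChartAt (𝓡∂ n) q).target)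
    (hp : (extChartAt (𝓡∂ n) q).symm y ∈ (extChartAt (𝓡∂ n) p).source)
    (u v : EuclideanSpace ℝ (Fin n)) :
    fderivWithin ℝ (chartChange n q p) (range (𝓡∂ n)) y (christoffelMap g q y u v) =
      christoffelMap g p (chartChange n q p y)
        (fderivWithin ℝ (chartChange n q p) (range (𝓡∂ n)) y u)
        (fderivWithin ℝ (chartChange n q p) (range (𝓡∂ n)) y v)
      + fderivWithin ℝ (fderivWithin ℝ (chartChange n q p) (range (𝓡∂ n))) (range (𝓡∂ n)) y u v := by
  have hyS : y ∈ (range (𝓡∂ n)) := extChartAt_target_subset_range q hy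
  set ψ := chartChange n q p with hψdef
  have hψ := contDiffWithinAt_chartChange hy hp
  have hψy : ψ y ∈ (extChartAt (𝓡∂ n) p).target := (extChartAt (𝓡∂ n) p).map_source hp
  set L := fderivWithin ℝ ψ (range (𝓡∂ n)) y with hL
  set H := fderivWithin ℝ (fderivWithin ℝ ψ (range (𝓡∂ n))) (range (𝓡∂ n)) y with hH
  have hψ1 : HasFDerivWithinAt ψ L (range (𝓡∂ n)) y :=
    (hψ.differentiableWithinAt (by simp)).hasFDerivWithinAt
  have hψ2 : HasFDerivWithinAt (fderivWithin ℝ ψ (range (𝓡∂ n))) H (range (𝓡∂ n)) y :=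
    ((hψ.fderivWithin_right (m := ∞) uniqueDiffOn_range (by simp) hyS).differentiableWithinAt
      (by simp)).hasFDerivWithinAt
  have hsymm : ∀ a b, H a b = H b a := fun a b =>
    (isSymmSndFDerivWithinAt_range (hψ.of_le ENat.LEInfty.out) hyS).eq a b
  have hmaps : MapsTo ψ (range (𝓡∂ n)) (range (𝓡∂ n)) := fun z _ => mem_range_self _
  set DG := fderivWithin ℝ (metricForm g p) (range (𝓡∂ n)) (ψ y) with hDG
  have hG : HasFDerivWithinAt (fun z => metricForm g p (ψ z)) (DG ∘L L) (range (𝓡∂ n)) y :=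
    ((differentiableWithinAt_metricForm g p hψy).hasFDerivWithinAt).comp y hψ1 hmaps
  have key : ∀ a b c, fderivWithin ℝ (metricForm g q) (range (𝓡∂ n)) y a b c =
      DG (L a) (L b) (L c) + metricForm g p (ψ y) (H a b) (L c)
        + metricForm g p (ψ y) (L b) (H a c) := by
    intro a b c
    rw [← fderivWithin_metricForm_apply g q hy]
    have h1 := (hG.clm_apply (hψ2.clm_apply (hasFDerivWithinAt_const b y (range (𝓡∂ n))))).clm_apply
      (hψ2.clm_apply (hasFDerivWithinAt_const c y (range (𝓡∂ n))))
    have h2 : HasFDerivWithinAt (fun z => metricForm g q z b c) _ (range (𝓡∂ n)) y :=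
      h1.congr_of_eventuallyEq (by
        filter_upwards [eventually_mem_chart hy hp] with z hz
        exact metricForm_chartChange g hz.1 hz.2 b c) (metricForm_chartChange g hy hp b c)
    rw [h2.fderivWithin (uniqueDiffOn_range y hyS)]
    simp only [add_apply, ContinuousLinearMap.comp_apply, ContinuousLinearMap.flip_apply,
      zero_apply, map_zero, zero_add]
    rw [← hL]
    ring
  have hsurj : Function.Surjective L :=
    LinearMap.injective_iff_surjective (f := L.toLinearMap).1
      (injective_fderivWithin_chartChange hy hp g)
  rw [← sub_eq_zero]
  by_contra h
  have hpos := metricForm_pos g p hψy h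
  obtain ⟨c, hc⟩ := hsurj (L (christoffelMap g q y u v) -
    (christoffelMap g p (ψ y) (L u) (L v) + H u v))
  rw [← hc] at hpos
  have e1 : metricForm g p (ψ y) (L (christoffelMap g q y u v)) (L c) =
      metricForm g q y (christoffelMap g q y u v) c := (metricForm_chartChange g hy hp _ _).symm
  have e2 : metricForm g p (ψ y) (L c) (L c) = metricForm g p (ψ y)
      (L (christoffelMap g q y u v)) (L c) - (metricForm g p (ψ y)
      (christoffelMap g p (ψ y) (L u) (L v)) (L c) + metricForm g p (ψ y) (H u v) (L c)) := by
    nth_rewrite 1 [hc]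
    simp only [map_sub, map_add, sub_apply, add_apply]
  rw [e2, e1, metricForm_christoffelMap g q hy, metricForm_christoffelMap g p hψy, ← hDG, key, key, key,
    hsymm v u, hsymm c u, hsymm c v, metricForm_symm g p (ψ y) (L v) (H u c),
    metricForm_symm g p (ψ y) (L u) (H v c)] at hpos
  ring_nf at hpos
  exact lt_irrefl _ hpos

/-- The second derivative of the metric in coordinates. -/
theorem fderivWithin_fderivWithin_metricForm (p : M) {y : EuclideanSpace ℝ (Fin n)}
    (hy : y ∈ (extChartAt (𝓡∂ n) p).target) (a b c d : EuclideanSpace ℝ (Fin n)) :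
    fderivWithin ℝ (fderivWithin ℝ (metricForm g p) (range (𝓡∂ n))) (range (𝓡∂ n)) y a b c d =
      fderivWithin ℝ (metricForm g p) (range (𝓡∂ n)) y a (christoffelMap g p y b c) d
      + metricForm g p y
        (fderivWithin ℝ (christoffelMap g p) (range (𝓡∂ n)) y a b c) d
      + fderivWithin ℝ (metricForm g p) (range (𝓡∂ n)) y a c (christoffelMap g p y b d)
      + metricForm g p y c
        (fderivWithin ℝ (christoffelMap g p) (range (𝓡∂ n)) y a b d) := by
  set S := range (𝓡∂ n) with hS
  have hyS : y ∈ S := extChartAt_target_subset_range p hy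
  have hG := (differentiableWithinAt_metricForm g p hy).hasFDerivWithinAt
  have hΓ := ((contDiffWithinAt_christoffelMap g p hy).differentiableWithinAt
    (by simp)).hasFDerivWithinAt
  have hDG := (((contDiffWithinAt_metricForm g p hy).fderivWithin_right (m := ∞)
    uniqueDiffOn_range (by simp) hyS).differentiableWithinAt (by simp)).hasFDerivWithinAt
  have h1 := ((hDG.clm_apply (hasFDerivWithinAt_const b y S)).clm_apply
    (hasFDerivWithinAt_const c y S)).clm_apply (hasFDerivWithinAt_const d y S)
  have hb := hΓ.clm_apply (hasFDerivWithinAt_const b y S)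
  have h2 := ((hG.clm_apply (hb.clm_apply (hasFDerivWithinAt_const c y S))).clm_apply
    (hasFDerivWithinAt_const d y S)).add
    ((hG.clm_apply (hasFDerivWithinAt_const c y S)).clm_apply
      (hb.clm_apply (hasFDerivWithinAt_const d y S)))
  have h3 := h2.congr_of_eventuallyEq (f₁ := fun z => fderivWithin ℝ (metricForm g p) S z b c d)
    (by
      filter_upwards [extChartAt_target_mem_nhdsWithin_of_mem hy] with z hz
      exact fderivWithin_metricForm_eq g p hz b c d) (fderivWithin_metricForm_eq g p hy b c d)
  have h4 := DFunLike.congr_fun ((uniqueDiffOn_range y hyS).eq h1 h3) a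
  simp only [add_apply, ContinuousLinearMap.comp_apply, ContinuousLinearMap.flip_apply, zero_apply,
    map_zero, zero_add] at h4
  rw [h4]
  ring

/-- The curvature operator in coordinates. -/
def curvature (p : M) (y a b c : EuclideanSpace ℝ (Fin n)) : EuclideanSpace ℝ (Fin n) :=
  fderivWithin ℝ (christoffelMap g p) (range (𝓡∂ n)) y a b c
  - fderivWithin ℝ (christoffelMap g p) (range (𝓡∂ n)) y b a c
  + christoffelMap g p y a (christoffelMap g p y b c)
  - christoffelMap g p y b (christoffelMap g p y a c)

/-- The commutator of two derivatives of the metric vanishes, and metric compatibility turns it into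
the sum of the two curvature terms. -/
theorem metricForm_curvature (p : M) {y : EuclideanSpace ℝ (Fin n)}
    (hy : y ∈ (extChartAt (𝓡∂ n) p).target) (a b c d : EuclideanSpace ℝ (Fin n)) :
    metricForm g p y c (curvature g p y a b d) = - metricForm g p y d (curvature g p y a b c) := by
  have hyS := extChartAt_target_subset_range p hy
  have hs : fderivWithin ℝ (fderivWithin ℝ (metricForm g p) (range (𝓡∂ n))) (range (𝓡∂ n)) y a b =
      fderivWithin ℝ (fderivWithin ℝ (metricForm g p) (range (𝓡∂ n))) (range (𝓡∂ n)) y b a :=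
    (isSymmSndFDerivWithinAt_range ((contDiffWithinAt_metricForm g p hy).of_le
      ENat.LEInfty.out) hyS).eq
      a b
  have h : ∀ c d, fderivWithin ℝ (fderivWithin ℝ (metricForm g p) (range (𝓡∂ n))) (range (𝓡∂ n)) y
    a b c d = fderivWithin ℝ (fderivWithin ℝ (metricForm g p) (range (𝓡∂ n))) (range (𝓡∂ n)) y
    b a c d := fun c d => by rw [hs]
  have h1 := h c d
  simp only [fderivWithin_fderivWithin_metricForm g p hy, fderivWithin_metricForm_eq g p hy] at h1
  simp only [curvature, map_add, map_sub]
  have s := metricForm_symm g p y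
  rw [s (christoffelMap g p y a (christoffelMap g p y b c)) d,
    s (fderivWithin ℝ (christoffelMap g p) (range (𝓡∂ n)) y a b c) d,
    s (christoffelMap g p y b (christoffelMap g p y a c)) d,
    s (fderivWithin ℝ (christoffelMap g p) (range (𝓡∂ n)) y b a c) d] at h1
  linarith

theorem partialDeriv_christoffel (p : M) {y : EuclideanSpace ℝ (Fin n)}
    (hy : y ∈ (extChartAt (𝓡∂ n) p).target) (i j k l : Fin n) :
    partialDeriv l (christoffel g p k i j) y =
      fderivWithin ℝ (christoffelMap g p) (range (𝓡∂ n)) y (EuclideanSpace.single l 1)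
        (EuclideanSpace.single i 1) (EuclideanSpace.single j 1) k := by
  have hyS := extChartAt_target_subset_range p hy
  have hΓ := ((contDiffWithinAt_christoffelMap g p hy).differentiableWithinAt
    (by simp)).hasFDerivWithinAt
  have h1 := (EuclideanSpace.proj k : EuclideanSpace ℝ (Fin n) →L[ℝ] ℝ).hasFDerivAt.comp_hasFDerivWithinAt y
    ((hΓ.clm_apply (hasFDerivWithinAt_const (EuclideanSpace.single i (1 : ℝ)) y _)).clm_apply
      (hasFDerivWithinAt_const (EuclideanSpace.single j (1 : ℝ)) y _))
  have h2 : christoffel g p k i j = fun z => (EuclideanSpace.proj k :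
      EuclideanSpace ℝ (Fin n) →L[ℝ] ℝ) (christoffelMap g p z (EuclideanSpace.single i 1)
        (EuclideanSpace.single j 1)) := by
    ext z
    exact (christoffelMap_single g p z k i j).symm
  rw [partialDeriv, h2]
  erw [h1.fderivWithin (uniqueDiffOn_range y hyS)]
  simp

/-- The Ricci tensor is the trace of the curvature. -/
theorem sum_ricciCoord (p : M) {y : EuclideanSpace ℝ (Fin n)}
    (hy : y ∈ (extChartAt (𝓡∂ n) p).target) (v : EuclideanSpace ℝ (Fin n)) :
    ∑ j, ∑ k, ricciCoord g p j k y * v j * v k =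
      ∑ i, curvature g p y (EuclideanSpace.single i 1) v v i := by
  set e : Fin n → EuclideanSpace ℝ (Fin n) := fun i => EuclideanSpace.single i 1
  have hco : ∀ j k, ricciCoord g p j k y = ∑ i, curvature g p y (e i) (e j) (e k) i := by
    intro j k
    simp only [ricciCoord, curvature, partialDeriv_christoffel g p hy]
    refine Finset.sum_congr rfl fun i _ => ?_
    simp only [PiLp.add_apply, PiLp.sub_apply]
    have h1 : ∀ a b c : Fin n, christoffelMap g p y (e a) (christoffelMap g p y (e b) (e c)) i =
        ∑ l, christoffel g p i a l y * christoffel g p l b c y := by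
      intro a b c
      rw [christoffelMap_apply, Finset.sum_eq_single a]
      · refine Finset.sum_congr rfl fun l _ => ?_
        rw [christoffelMap_single]
        simp [e]
      · intro b _ hb; simp [e, hb]
      · simp
    rw [h1, h1, Finset.sum_sub_distrib]
    ring
  let B : Fin n → EuclideanSpace ℝ (Fin n) →ₗ[ℝ] EuclideanSpace ℝ (Fin n) →ₗ[ℝ] ℝ := fun i =>
    LinearMap.mk₂ ℝ (fun b c => curvature g p y (e i) b c i)
      (fun _ _ _ => by simp [curvature]; ring) (fun _ _ _ => by simp [curvature]; ring)
      (fun _ _ _ => by simp [curvature]; ring) (fun _ _ _ => by simp [curvature]; ring)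
  have hB : ∀ i, curvature g p y (e i) v v i =
      ∑ j, ∑ k, curvature g p y (e i) (e j) (e k) i * v j * v k := fun i => bilin_eq_sum (B i) v v
  simp only [hco, Finset.sum_mul]
  rw [Finset.sum_congr rfl fun i _ => hB i]
  conv_rhs => rw [Finset.sum_comm]
  refine Finset.sum_congr rfl fun j _ => ?_
  conv_rhs => rw [Finset.sum_comm]

end Curv

/-! ### Concatenation, reversal and chart arcs for competitors of controlled weighted length. -/

section Reach

variable {n : ℕ} [NeZero n] {M : Type*} [TopologicalSpace M]
  [ChartedSpace (EuclideanHalfSpace n) M] [IsManifold (𝓡∂ n) ∞ M] (g : Metric n M)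

/-- The integrand of the weighted length. -/
def lengthDensity (u : M → ℝ) (α : ℝ) (c : ℝ → M) (s : ℝ) : ℝ :=
  u (c s) ^ α * Real.sqrt (g.inner (c s) (mfderiv 𝓘(ℝ, ℝ) (𝓡∂ n) c s (1 : ℝ))
      (mfderiv 𝓘(ℝ, ℝ) (𝓡∂ n) c s (1 : ℝ)))

theorem lengthDensity_congr {u : M → ℝ} {α : ℝ} {c c' : ℝ → M} {s : ℝ} (h : c =ᶠ[𝓝 s] c') :
    lengthDensity g u α c s = lengthDensity g u α c' s := by
  have h1 := h.mfderiv_eq (I := 𝓘(ℝ, ℝ)) (I' := 𝓡∂ n)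
  have h2 := h.eq_of_nhds
  unfold lengthDensity
  rw [h1, h2]

theorem mdifferentiableAt_comp_affine {c : ℝ → M} {σ r s : ℝ}
    (h : MDifferentiableAt 𝓘(ℝ, ℝ) (𝓡∂ n) c (σ * s + r)) :
    MDifferentiableAt 𝓘(ℝ, ℝ) (𝓡∂ n) (fun t => c (σ * t + r)) s :=
  MDifferentiableAt.comp (f := fun t : ℝ => σ * t + r) s h
    (DifferentiableAt.mdifferentiableAt (by fun_prop))

/-- Covers shifts and reversals. No differentiability is assumed: for σ² = 1 the affine map is
invertible, so both curves fail to be differentiable at corresponding times, and there both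
densities take the default value 0. -/
theorem lengthDensity_comp_affine (u : M → ℝ) (α : ℝ) (c : ℝ → M) {σ : ℝ} (hσ : σ * σ = 1)
    (r s : ℝ) :
    lengthDensity g u α (fun t => c (σ * t + r)) s = lengthDensity g u α c (σ * s + r) := by
  by_cases h : MDifferentiableAt 𝓘(ℝ, ℝ) (𝓡∂ n) c (σ * s + r)
  · have h1 := mfderiv_comp (f := fun t : ℝ => σ * t + r) (I' := 𝓘(ℝ, ℝ)) s h
      (DifferentiableAt.mdifferentiableAt (by fun_prop))
    have h2 : mfderiv 𝓘(ℝ, ℝ) 𝓘(ℝ, ℝ) (fun t : ℝ => σ * t + r) s (1 : ℝ) = σ := by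
      rw [mfderiv_eq_fderiv]
      have : HasDerivAt (fun t : ℝ => σ * t + r) (σ * 1) s :=
        ((hasDerivAt_id s).const_mul σ).add_const r
      have h3 := this.hasFDerivAt.fderiv
      rw [h3]
      change (1 : ℝ) • (σ * 1) = σ
      simp
    have h3 : mfderiv 𝓘(ℝ, ℝ) (𝓡∂ n) (fun t => c (σ * t + r)) s (1 : ℝ) =
        σ • mfderiv 𝓘(ℝ, ℝ) (𝓡∂ n) c (σ * s + r) (1 : ℝ) := by
      have h4 := DFunLike.congr_fun h1 (1 : ℝ)
      have h5 : mfderiv 𝓘(ℝ, ℝ) (𝓡∂ n) c (σ * s + r) σ =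
        σ • mfderiv 𝓘(ℝ, ℝ) (𝓡∂ n) c (σ * s + r) (1 : ℝ) := by
        have := (mfderiv 𝓘(ℝ, ℝ) (𝓡∂ n) c (σ * s + r)).map_smul σ (1 : ℝ)
        rw [← this]
        exact congrArg _ (mul_one σ).symm
      exact h4.trans ((congrArg _ h2).trans h5)
    unfold lengthDensity
    rw [h3]
    simp only [map_smul, smul_apply, smul_eq_mul]
    rw [← mul_assoc, hσ, one_mul]
  · have h' : ¬ MDifferentiableAt 𝓘(ℝ, ℝ) (𝓡∂ n) (fun t => c (σ * t + r)) s := by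
      intro h1
      apply h
      have e : s = σ * (σ * s + r) + (-(σ * r)) := by linear_combination (-s) * hσ
      rw [e] at h1
      have h2 := mdifferentiableAt_comp_affine h1
      have e2 : (fun t => c (σ * (σ * t + -(σ * r)) + r)) = c := by
        ext t
        congr 1
        linear_combination (t - r) * hσ
      rwa [e2] at h2
    unfold lengthDensity
    rw [mfderiv_zero_of_not_mdifferentiableAt h, mfderiv_zero_of_not_mdifferentiableAt h']
    rfl

/-- There is a piecewise `C¹` curve from `x` to `y` of weighted length at most `l`. -/
def Reach (u : M → ℝ) (α : ℝ) (x y : M) (l : ℝ) : Prop :=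
  ∃ (c : ℝ → M) (a b : ℝ), a ≤ b ∧ IsPiecewiseC1 n c a b ∧ c a = x ∧ c b = y ∧
    IntervalIntegrable (lengthDensity g u α c) volume a b ∧ weightedLength g u α c a b ≤ l

variable {g} {u : M → ℝ} {α : ℝ}

theorem Reach.mono {x y : M} {l l' : ℝ} (h : Reach g u α x y l) (hl : l ≤ l') :
    Reach g u α x y l' := by
  obtain ⟨c, a, b, hab, h1, h2, h3, h4, h5⟩ := h
  exact ⟨c, a, b, hab, h1, h2, h3, h4, h5.trans hl⟩

theorem isPiecewiseC1_const (x : M) (a b : ℝ) : IsPiecewiseC1 n (fun _ => x) a b :=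
  ⟨continuousOn_const, ∅, fun _ _ _ _ _ _ => contMDiffOn_const⟩

theorem Reach.refl (x : M) : Reach g u α x x 0 :=
  ⟨fun _ => x, 0, 0, le_rfl, isPiecewiseC1_const x 0 0, rfl, rfl, by simp, by
    simp [weightedLength]⟩

theorem contMDiff_affine (σ r : ℝ) : ContMDiff 𝓘(ℝ, ℝ) 𝓘(ℝ, ℝ) 1 (fun t : ℝ => σ * t + r) :=
  ContDiff.contMDiff (by fun_prop)

theorem Reach.symm {x y : M} {l : ℝ} (h : Reach g u α x y l) : Reach g u α y x l := by
  obtain ⟨c, a, b, hab, ⟨h1, S, hS⟩, h2, h3, h4, h5⟩ := h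
  have hd : ∀ s, lengthDensity g u α (fun t => c ((-1) * t + 0)) s =
      lengthDensity g u α c (-s) := fun s => by
    rw [lengthDensity_comp_affine g u α c (by norm_num)]; simp
  have hd' : lengthDensity g u α (fun t => c ((-1) * t + 0)) =
      fun s => lengthDensity g u α c (-s) := funext hd
  refine ⟨fun t => c ((-1) * t + 0), -b, -a, by linarith, ⟨?_, S.image (fun t => -t), ?_⟩, by simpa,
    by simpa, ?_, ?_⟩
  · refine h1.comp (by fun_prop) fun t ht => ?_
    constructor <;> linarith [ht.1, ht.2]
  · intro s t hs hst ht hr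
    refine (hS (-t) (-s) (by linarith) (by linarith) (by linarith) fun r hr1 hr2 => ?_).comp
      (contMDiff_affine (-1) 0).contMDiffOn fun t ht => ?_
    · refine hr (-r) (Finset.mem_image_of_mem _ hr1) ?_
      constructor <;> linarith [hr2.1, hr2.2]
    · constructor <;> linarith [ht.1, ht.2]
  · rw [hd']
    have := (h4.comp_sub_left 0)
    simpa using this.symm
  · refine le_trans (le_of_eq ?_) h5
    change ∫ s in (-b)..(-a), lengthDensity g u α (fun t => c ((-1) * t + 0)) s =
      ∫ s in a..b, lengthDensity g u α c s
    rw [hd', intervalIntegral.integral_comp_neg, neg_neg, neg_neg]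

/-- This is why `Reach` records integrability: the interval integral of a non-integrable density is
0 by convention, and lengths would then fail to add. -/
theorem Reach.trans {x y z : M} {l l' : ℝ} (h : Reach g u α x y l) (h' : Reach g u α y z l') :
    Reach g u α x z (l + l') := by
  obtain ⟨c, a, b, hab, ⟨h1, S, hS⟩, h2, h3, h4, h5⟩ := h
  obtain ⟨c', a', b', hab', ⟨h1', S', hS'⟩, h2', h3', h4', h5'⟩ := h'
  set d : ℝ → M := fun t => c' (1 * t + (a' - b)) with hd
  set k : ℝ → M := fun t => if t ≤ b then c t else d t with hk
  have hcd : c b = d b := by simp [hd, h2', h3]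
  have hk1 : EqOn k c (Iic b) := fun t ht => by simp [hk, show t ≤ b from ht]
  have hk2 : EqOn k d (Ici b) := fun t ht => by
    rcases eq_or_lt_of_le (show b ≤ t from ht) with h | h
    · subst h; simp [hk, hcd]
    · simp [hk, not_le.2 h]
  -- The densities are compared on open half lines only; at the joint the two-sided velocity need
  -- not exist, but a single time has measure zero.
  have hdens1 : ∀ t ∈ Iio b, lengthDensity g u α k t = lengthDensity g u α c t := fun t ht =>
    lengthDensity_congr g (hk1.eventuallyEq_of_mem (Iic_mem_nhds ht))
  have hdens2 : ∀ t ∈ Ioi b, lengthDensity g u α k t = lengthDensity g u α c' (t + (a' - b)) :=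
    fun t ht => by
      rw [lengthDensity_congr g (hk2.eventuallyEq_of_mem (Ici_mem_nhds ht)), hd,
        lengthDensity_comp_affine g u α c' (by norm_num), one_mul]
  have hE : ContinuousOn d (Icc b (b + (b' - a'))) := by
    refine h1'.comp (by fun_prop) fun t ht => ?_
    constructor <;> linarith [ht.1, ht.2]
  have hint1 : IntervalIntegrable (lengthDensity g u α k) volume a b := by
    refine h4.congr_ae ?_
    rw [uIoc_of_le hab, ← restrict_Ioo_eq_restrict_Ioc]
    filter_upwards [ae_restrict_mem measurableSet_Ioo] with t ht
    exact (hdens1 t ht.2).symm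
  have hint2' : IntervalIntegrable (fun t => lengthDensity g u α c' (t + (a' - b))) volume b
      (b + (b' - a')) := by
    have := h4'.comp_add_right (a' - b)
    convert this using 1 <;> ring
  have hle : b ≤ b + (b' - a') := by linarith
  have hint2 : IntervalIntegrable (lengthDensity g u α k) volume b (b + (b' - a')) := by
    refine hint2'.congr_ae ?_
    rw [uIoc_of_le hle]
    filter_upwards [ae_restrict_mem measurableSet_Ioc] with t ht
    exact (hdens2 t ht.1).symm
  refine ⟨k, a, b + (b' - a'), by linarith, ⟨?_, insert b (S ∪ S'.image (fun t => t - (a' - b))), ?_⟩,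
    ?_, ?_, hint1.trans hint2, ?_⟩
  · have hu : Icc a (b + (b' - a')) = Icc a b ∪ Icc b (b + (b' - a')) :=
      (Icc_union_Icc_eq_Icc hab hle).symm
    rw [hu]
    refine ContinuousOn.union_of_isClosed (h1.congr (hk1.mono Icc_subset_Iic_self))
      (hE.congr (hk2.mono Icc_subset_Ici_self)) isClosed_Icc isClosed_Icc
  · intro s t hs hst ht hr
    have hb := hr b (Finset.mem_insert_self _ _)
    rcases le_or_gt t b with htb | htb
    · refine (hS s t hs hst htb fun r hr1 => hr r ?_).congr
        fun r hr => hk1 (show r ≤ b from hr.2.trans htb)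
      simp [hr1]
    · have hsb : b ≤ s := by
        by_contra hcon
        exact hb ⟨not_le.1 hcon, htb⟩
      refine ContMDiffOn.congr (f := d) ?_ fun r hr => hk2 (show b ≤ r from hsb.trans hr.1)
      refine (hS' (s + (a' - b)) (t + (a' - b)) (by linarith) (by linarith) (by linarith)
        fun r hr1 hr2 => ?_).comp (contMDiff_affine 1 (a' - b)).contMDiffOn fun r hr => ?_
      · refine hr (r - (a' - b)) ?_ ?_
        · simp only [Finset.mem_insert, Finset.mem_union, Finset.mem_image]
          exact Or.inr (Or.inr ⟨r, hr1, rfl⟩)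
        · constructor <;> linarith [hr2.1, hr2.2]
      · constructor <;> linarith [hr.1, hr.2]
  · rw [hk1 (show a ≤ b from hab), h2]
  · rw [hk2 (show b ≤ b + (b' - a') from hle), ← h3']
    change c' (1 * (b + (b' - a')) + (a' - b)) = c' b'
    rw [show 1 * (b + (b' - a')) + (a' - b) = b' by ring]
  · have e1 : ∫ t in a..b, lengthDensity g u α k t = ∫ t in a..b, lengthDensity g u α c t := by
      rw [intervalIntegral.integral_of_le hab, intervalIntegral.integral_of_le hab,
        ← restrict_Ioo_eq_restrict_Ioc]
      exact setIntegral_congr_fun measurableSet_Ioo fun t ht => hdens1 t ht.2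
    have e2 : ∫ t in b..(b + (b' - a')), lengthDensity g u α k t =
        ∫ t in a'..b', lengthDensity g u α c' t := by
      rw [intervalIntegral.integral_of_le hle, setIntegral_congr_fun measurableSet_Ioc
        (fun t ht => hdens2 t ht.1), ← intervalIntegral.integral_of_le hle,
        intervalIntegral.integral_comp_add_right (fun t => lengthDensity g u α c' t)]
      congr 1 <;> ring
    have e3 : weightedLength g u α k a (b + (b' - a')) =
        (∫ t in a..b, lengthDensity g u α k t) + ∫ t in b..(b + (b' - a')), lengthDensity g u α k t :=
      (intervalIntegral.integral_add_adjacent_intervals hint1 hint2).symm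
    rw [e3, e1, e2]
    exact add_le_add h5 h5'

/-- The weight `u ^ α` in the chart at `p`. -/
def chartWeight (n : ℕ) [NeZero n] {M : Type*} [TopologicalSpace M]
    [ChartedSpace (EuclideanHalfSpace n) M] (u : M → ℝ) (α : ℝ) (p : M)
    (y : EuclideanSpace ℝ (Fin n)) : ℝ :=
  u ((extChartAt (𝓡∂ n) p).symm y) ^ α

theorem contDiffWithinAt_coordFun (hu : ContMDiff (𝓡∂ n) 𝓘(ℝ, ℝ) 2 u) (p : M)
    {y : EuclideanSpace ℝ (Fin n)} (hy : y ∈ (extChartAt (𝓡∂ n) p).target) :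
    ContDiffWithinAt ℝ 2 (coordFun p u) (range (𝓡∂ n)) y := by
  have h1 : ContMDiffOn 𝓘(ℝ, EuclideanSpace ℝ (Fin n)) (𝓡∂ n) 2 (extChartAt (𝓡∂ n) p).symm
      (extChartAt (𝓡∂ n) p).target :=
    (contMDiffOn_extChartAt_symm (n := ∞) p).of_le ENat.LEInfty.out
  exact (contMDiffWithinAt_iff_contDiffWithinAt.1 (hu.contMDiffAt.comp_contMDiffWithinAt y
    (h1 y hy))).mono_of_mem_nhdsWithin (extChartAt_target_mem_nhdsWithin_of_mem hy)

theorem contDiffWithinAt_chartWeight (hu : ContMDiff (𝓡∂ n) 𝓘(ℝ, ℝ) 2 u) (hupos : ∀ x, 0 < u x)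
    (p : M) {y : EuclideanSpace ℝ (Fin n)} (hy : y ∈ (extChartAt (𝓡∂ n) p).target) :
    ContDiffWithinAt ℝ 2 (chartWeight n u α p) (range (𝓡∂ n)) y :=
  (contDiffWithinAt_coordFun hu p hy).rpow_const_of_ne (hupos _).ne'

/-- A `C¹` arc in a chart. -/
theorem Reach.arc (hu : ContMDiff (𝓡∂ n) 𝓘(ℝ, ℝ) 2 u) (hupos : ∀ x, 0 < u x) (p : M)
    {ξ ξ' : ℝ → EuclideanSpace ℝ (Fin n)} {a b : ℝ} (hab : a ≤ b)
    (hξ : ∀ t ∈ Icc a b, HasDerivWithinAt ξ (ξ' t) (Icc a b) t)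
    (hξ' : ContinuousOn ξ' (Icc a b))
    (hmem : ∀ t ∈ Icc a b, ξ t ∈ (extChartAt (𝓡∂ n) p).target) :
    Reach g u α ((extChartAt (𝓡∂ n) p).symm (ξ a)) ((extChartAt (𝓡∂ n) p).symm (ξ b))
      (∫ t in a..b, chartWeight n u α p (ξ t) * Real.sqrt (metricForm g p (ξ t) (ξ' t) (ξ' t))) := by
  rcases eq_or_lt_of_le hab with rfl | hlt
  · simpa using Reach.refl (g := g) (u := u) (α := α) ((extChartAt (𝓡∂ n) p).symm (ξ a))
  set c : ℝ → M := fun t => (extChartAt (𝓡∂ n) p).symm (ξ t) with hc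
  have hud := uniqueDiffOn_Icc hlt
  have hC1 : ContDiffOn ℝ 1 ξ (Icc a b) := by
    rw [show (1 : ℕ∞ω) = 0 + 1 from (zero_add 1).symm, contDiffOn_succ_iff_derivWithin hud]
    refine ⟨fun t ht => (hξ t ht).differentiableWithinAt, by simp, ?_⟩
    rw [contDiffOn_zero]
    exact hξ'.congr fun t ht => (hξ t ht).derivWithin (hud t ht)
  have hcC1 : ContMDiffOn 𝓘(ℝ, ℝ) (𝓡∂ n) 1 c (Icc a b) :=
    ((contMDiffOn_extChartAt_symm (n := ∞) p).of_le (by simp)).comp hC1.contMDiffOn hmem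
  have hcont : ContinuousOn (fun t => chartWeight n u α p (ξ t) *
      Real.sqrt (metricForm g p (ξ t) (ξ' t) (ξ' t))) (Icc a b) := by
    have hr : MapsTo ξ (Icc a b) (range (𝓡∂ n)) := fun t ht =>
      extChartAt_target_subset_range p (hmem t ht)
    have h1 : ContinuousOn (fun t => chartWeight n u α p (ξ t)) (Icc a b) := fun t ht =>
      (contDiffWithinAt_chartWeight hu hupos p (hmem t ht)).continuousWithinAt.comp
        (hC1.continuousOn t ht) hr
    have h2 : ContinuousOn (fun t => metricForm g p (ξ t)) (Icc a b) := fun t ht =>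
      (contDiffWithinAt_metricForm g p (hmem t ht)).continuousWithinAt.comp
        (hC1.continuousOn t ht) hr
    exact h1.mul ((h2.clm_apply hξ').clm_apply hξ').sqrt
  -- At the end times `ξ'` is only a one-sided derivative, whereas the density uses a two-sided one.
  have hdens : ∀ t ∈ Ioo a b, lengthDensity g u α c t = chartWeight n u α p (ξ t) *
      Real.sqrt (metricForm g p (ξ t) (ξ' t) (ξ' t)) := by
    intro t ht
    have hti : t ∈ Icc a b := Ioo_subset_Icc_self ht
    have hnhds : Icc a b ∈ 𝓝 t := Icc_mem_nhds ht.1 ht.2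
    have hs : c t ∈ (extChartAt (𝓡∂ n) p).source := (extChartAt (𝓡∂ n) p).map_target (hmem t hti)
    have h1 := inner_mfderivWithin g p ((hcC1 t hti).mdifferentiableWithinAt (by simp)) (hud t hti) hs
    rw [mfderivWithin_of_mem_nhds hnhds] at h1
    have h2 : derivWithin (fun r => extChartAt (𝓡∂ n) p (c r)) (Icc a b) t = ξ' t := by
      rw [← (hξ t hti).derivWithin (hud t hti)]
      refine derivWithin_congr (fun r hr => ?_) ?_
      · exact (extChartAt (𝓡∂ n) p).right_inv (hmem r hr)
      · exact (extChartAt (𝓡∂ n) p).right_inv (hmem t hti)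
    have h3 : extChartAt (𝓡∂ n) p (c t) = ξ t := (extChartAt (𝓡∂ n) p).right_inv (hmem t hti)
    rw [h2, h3] at h1
    rw [lengthDensity, h1]
    rfl
  refine ⟨c, a, b, hab, ⟨hcC1.continuousOn, ∅, fun s t hs _ ht _ => hcC1.mono (Icc_subset_Icc hs ht)⟩,
    rfl, rfl, ?_, le_of_eq ?_⟩
  · refine (hcont.intervalIntegrable_of_Icc hab).congr_ae ?_
    rw [uIoc_of_le hab, ← restrict_Ioo_eq_restrict_Ioc]
    filter_upwards [ae_restrict_mem measurableSet_Ioo] with t ht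
    exact (hdens t ht).symm
  · change ∫ s in a..b, lengthDensity g u α c s = _
    rw [intervalIntegral.integral_of_le hab, intervalIntegral.integral_of_le hab,
      ← restrict_Ioo_eq_restrict_Ioc]
    exact setIntegral_congr_fun measurableSet_Ioo hdens

end Reach

/-! ### Taylor's formula within a convex set, uniform in the base point. -/

section Taylor

variable {E : Type*} [NormedAddCommGroup E] [NormedSpace ℝ E]
  {F : Type*} [NormedAddCommGroup F] [NormedSpace ℝ F]

/-- Strict differentiability relative to a convex set: the mean value inequality applies to f minus
its linear part, whose derivative is small near the point. -/
theorem isLittleO_sub_fderivWithin {f : E → F} {f' : E →L[ℝ] F} {S : Set E} (hS : Convex ℝ S)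
    {y₀ : E}
    (hd : ∀ᶠ y in 𝓝[S] y₀, DifferentiableWithinAt ℝ f S y)
    (hc : Tendsto (fderivWithin ℝ f S) (𝓝[S] y₀) (𝓝 f')) :
    (fun p : E × E => f p.2 - f p.1 - f' (p.2 - p.1)) =o[𝓝[S] y₀ ×ˢ 𝓝[S] y₀]
      fun p => p.2 - p.1 := by
  rw [isLittleO_iff]
  intro ε hε
  have h1 : ∀ᶠ y in 𝓝[S] y₀, DifferentiableWithinAt ℝ f S y ∧ ‖fderivWithin ℝ f S y - f'‖ ≤ ε := by
    filter_upwards [hd, hc (Metric.closedBall_mem_nhds f' hε)] with y h2 h3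
    exact ⟨h2, by simpa [dist_eq_norm] using h3⟩
  obtain ⟨r, hr, hball⟩ := Metric.mem_nhdsWithin_iff.1 h1
  have hU : Metric.ball y₀ r ∩ S ∈ 𝓝[S] y₀ := by
    rw [inter_comm]
    exact inter_mem_nhdsWithin S (Metric.ball_mem_nhds y₀ hr)
  have hconv : Convex ℝ (Metric.ball y₀ r ∩ S) := (convex_ball y₀ r).inter hS
  filter_upwards [prod_mem_prod hU hU] with p hp
  exact hconv.norm_image_sub_le_of_norm_hasFDerivWithin_le'
    (fun y hy => (hball hy).1.hasFDerivWithinAt.mono inter_subset_right)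
    (fun y hy => (hball hy).2) hp.1 hp.2

/-- Taylor's formula of second order, uniformly in the base point. -/
theorem taylor_two_isLittleO {f : E → F} {S : Set E} (hS : Convex ℝ S) (hu : UniqueDiffOn ℝ S)
    {y₀ : E} (hy₀ : y₀ ∈ S) (hf : ContDiffWithinAt ℝ 2 f S y₀)
    (hsymm : IsSymmSndFDerivWithinAt ℝ f S y₀) :
    (fun p : E × E => f p.2 - f p.1 - fderivWithin ℝ f S p.1 (p.2 - p.1)
      - (1 / 2 : ℝ) • fderivWithin ℝ (fderivWithin ℝ f S) S y₀ (p.2 - p.1) (p.2 - p.1))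
      =o[𝓝[S] y₀ ×ˢ 𝓝[S] y₀] fun p => ‖p.2 - p.1‖ ^ 2 := by
  set H := fderivWithin ℝ (fderivWithin ℝ f S) S y₀ with hH
  have hD : ContDiffWithinAt ℝ 1 (fderivWithin ℝ f S) S y₀ :=
    hf.fderivWithin_right hu (by norm_num) hy₀
  have hins : 𝓝[insert y₀ S] y₀ = 𝓝[S] y₀ := by rw [insert_eq_of_mem hy₀]
  have hDd : ∀ᶠ y in 𝓝[S] y₀, DifferentiableWithinAt ℝ (fderivWithin ℝ f S) S y := by
    have h1 := hD.eventually (by simp)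
    rw [hins] at h1
    exact h1.mono fun y h => h.differentiableWithinAt (by simp)
  have hfd : ∀ᶠ y in 𝓝[S] y₀, DifferentiableWithinAt ℝ f S y := by
    have h1 := hf.eventually (by simp)
    rw [hins] at h1
    exact h1.mono fun y h => h.differentiableWithinAt (by simp)
  have hDc : Tendsto (fderivWithin ℝ (fderivWithin ℝ f S) S) (𝓝[S] y₀) (𝓝 H) :=
    (hD.fderivWithin_right (m := 0) hu (by norm_num) hy₀).continuousWithinAt
  have hlo := isLittleO_sub_fderivWithin hS hDd hDc
  rw [isLittleO_iff] at hlo ⊢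
  intro ε hε
  obtain ⟨P, hP, Q, hQ, hPQ⟩ := (eventually_prod_iff (p := fun p : E × E =>
    ‖fderivWithin ℝ f S p.2 - fderivWithin ℝ f S p.1 - H (p.2 - p.1)‖ ≤ ε * ‖p.2 - p.1‖)).1 (hlo hε)
  obtain ⟨r, hr, hball⟩ := Metric.mem_nhdsWithin_iff.1 ((hP.and hQ).and hfd)
  have hU : Metric.ball y₀ r ∩ S ∈ 𝓝[S] y₀ := by
    rw [inter_comm]
    exact inter_mem_nhdsWithin S (Metric.ball_mem_nhds y₀ hr)
  filter_upwards [prod_mem_prod hU hU] with p hp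
  obtain ⟨y, y'⟩ := p
  -- The extra ball keeps ‖z - y‖ ≤ ‖y' - y‖, so the derivative of the remainder is at most ε‖y' -
  -- y‖ on `C` and the mean value inequality produces the square.
  set C := (Metric.ball y₀ r ∩ S) ∩ Metric.closedBall y ‖y' - y‖ with hC
  have hconv : Convex ℝ C := ((convex_ball y₀ r).inter hS).inter (convex_closedBall _ _)
  set k : E → F := fun z => f z - fderivWithin ℝ f S y (z - y) - (1 / 2 : ℝ) • H (z - y) (z - y)
    with hk
  have hkd : ∀ z ∈ C, HasFDerivWithinAt k
      (fderivWithin ℝ f S z - fderivWithin ℝ f S y - H (z - y)) C z := by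
    intro z hz
    have e1 : HasFDerivWithinAt f (fderivWithin ℝ f S z) C z :=
      (hball hz.1).2.hasFDerivWithinAt.mono fun w hw => hw.1.2
    have e2 : HasFDerivWithinAt (fun w : E => w - y) (ContinuousLinearMap.id ℝ E) C z :=
      (hasFDerivWithinAt_id z C).sub_const y
    have e3 := (fderivWithin ℝ f S y).hasFDerivAt.comp_hasFDerivWithinAt z e2
    have e4 := ((H.hasFDerivAt.comp_hasFDerivWithinAt z e2).clm_apply e2).const_smul (1 / 2 : ℝ)
    refine ((e1.sub e3).sub e4).congr_fderiv ?_
    ext w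
    have hs : H w (z - y) = H (z - y) w := hsymm w (z - y)
    simp only [sub_apply, smul_apply, add_apply, ContinuousLinearMap.comp_apply,
      ContinuousLinearMap.flip_apply, ContinuousLinearMap.id_apply, Function.comp]
    rw [hs, ← two_smul ℝ (H (z - y) w), smul_smul]
    norm_num
  have hyC : y ∈ C := ⟨hp.1, by simp⟩
  have hyC' : y' ∈ C := ⟨hp.2, by simp [dist_eq_norm]⟩
  have hbound := hconv.norm_image_sub_le_of_norm_hasFDerivWithin_le (C := ε * ‖y' - y‖) hkd
    (fun z hz => ?_) hyC hyC'
  · have e : k y' - k y = f y' - f y - fderivWithin ℝ f S y (y' - y)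
        - (1 / 2 : ℝ) • H (y' - y) (y' - y) := by
      simp only [hk, sub_self, map_zero, smul_zero, sub_zero]
      abel
    rw [e] at hbound
    simp only [norm_pow, norm_norm]
    calc _ ≤ _ := hbound
      _ = _ := by ring
  · refine (hPQ (hball hyC.1).1.1 (hball hz.1).1.2).trans ?_
    have : ‖z - y‖ ≤ ‖y' - y‖ := by simpa [dist_eq_norm] using hz.2
    simp only
    gcongr

end Taylor

/-! ### First and second derivatives of the Lagrangian W(x) √G_x(v, v). -/

section Lagrangian

variable {E : Type*} [NormedAddCommGroup E] [NormedSpace ℝ E]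

/-- The weighted length Lagrangian. -/
def lagrangian (W : E → ℝ) (G : E → E →L[ℝ] E →L[ℝ] ℝ) (y : E × E) : ℝ :=
  W y.1 * Real.sqrt (G y.1 y.2 y.2)

variable {W : E → ℝ} {G : E → E →L[ℝ] E →L[ℝ] ℝ} {S : Set E}

theorem hasFDerivWithinAt_fst_prod {F : Type*} [NormedAddCommGroup F] [NormedSpace ℝ F]
    {f : E → F} {f' : E →L[ℝ] F} {y : E × E}
    (hf : HasFDerivWithinAt f f' S y.1) :
    HasFDerivWithinAt (fun z : E × E => f z.1) (f' ∘L ContinuousLinearMap.fst ℝ E E)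
      (S ×ˢ univ) y :=
  hf.comp y hasFDerivWithinAt_fst fun _ h => h.1

theorem fderivWithin_lagrangian (hS : UniqueDiffOn ℝ S) {y : E × E} (hy : y.1 ∈ S)
    (hW : DifferentiableWithinAt ℝ W S y.1) (hG : DifferentiableWithinAt ℝ G S y.1)
    (hsymm : ∀ z a b, G z a b = G z b a) (hpos : 0 < G y.1 y.2 y.2) (a b : E) :
    fderivWithin ℝ (lagrangian W G) (S ×ˢ univ) y (a, b) =
      fderivWithin ℝ W S y.1 a * Real.sqrt (G y.1 y.2 y.2)
      + W y.1 * ((fderivWithin ℝ G S y.1 a y.2 y.2 + 2 * G y.1 y.2 b) *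
        (2 * Real.sqrt (G y.1 y.2 y.2))⁻¹) := by
  have h2 : HasFDerivWithinAt (fun z : E × E => z.2) (ContinuousLinearMap.snd ℝ E E) (S ×ˢ univ) y :=
    hasFDerivWithinAt_snd
  have h3 := (((hasFDerivWithinAt_fst_prod hG.hasFDerivWithinAt).clm_apply h2).clm_apply h2).sqrt
    hpos.ne'
  have h4 := (hasFDerivWithinAt_fst_prod hW.hasFDerivWithinAt).mul h3
  have h5 : HasFDerivWithinAt (lagrangian W G) _ (S ×ˢ univ) y := h4
  rw [h5.fderivWithin ((hS.prod uniqueDiffOn_univ) y ⟨hy, mem_univ _⟩)]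
  simp only [smul_apply, add_apply, ContinuousLinearMap.comp_apply, ContinuousLinearMap.flip_apply,
    ContinuousLinearMap.coe_fst', ContinuousLinearMap.coe_snd', smul_eq_mul]
  rw [hsymm y.1 b y.2]
  ring

theorem contDiffWithinAt_lagrangian {y : E × E}
    (hW : ContDiffWithinAt ℝ 2 W S y.1) (hG : ContDiffWithinAt ℝ 2 G S y.1)
    (hpos : 0 < G y.1 y.2 y.2) :
    ContDiffWithinAt ℝ 2 (lagrangian W G) (S ×ˢ univ) y := by
  have h1 : ContDiffWithinAt ℝ 2 (fun z : E × E => z.1) (S ×ˢ univ) y := contDiffWithinAt_fst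
  have h2 : ContDiffWithinAt ℝ 2 (fun z : E × E => z.2) (S ×ˢ univ) y := contDiffWithinAt_snd
  have hm : MapsTo (fun z : E × E => z.1) (S ×ˢ univ) S := fun _ h => h.1
  exact (hW.comp y h1 hm).mul ((((hG.comp y h1 hm).clm_apply h2).clm_apply h2).sqrt hpos.ne')

/-- The second variation of the weighted length Lagrangian at a unit vector. -/
theorem fderivWithin_fderivWithin_lagrangian (hS : UniqueDiffOn ℝ S) {y : E × E} (hy : y.1 ∈ S)
    (hW : ContDiffWithinAt ℝ 2 W S y.1) (hG : ContDiffWithinAt ℝ 2 G S y.1)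
    (hsymm : ∀ z a b, G z a b = G z b a)
    (hsymm' : ∀ a b c, fderivWithin ℝ G S y.1 a b c = fderivWithin ℝ G S y.1 a c b)
    (hpos : G y.1 y.2 y.2 = 1)
    (hposn : ∀ᶠ z in 𝓝[S ×ˢ univ] y, 0 < G z.1 z.2 z.2) (a b : E) :
    fderivWithin ℝ (fderivWithin ℝ (lagrangian W G) (S ×ˢ univ)) (S ×ˢ univ) y (a, b) (a, b) =
      fderivWithin ℝ (fderivWithin ℝ W S) S y.1 a a
      + fderivWithin ℝ W S y.1 a * (fderivWithin ℝ G S y.1 a y.2 y.2 + 2 * G y.1 y.2 b)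
      + W y.1 * ((1 / 2) * fderivWithin ℝ (fderivWithin ℝ G S) S y.1 a a y.2 y.2
        + 2 * fderivWithin ℝ G S y.1 a y.2 b + G y.1 b b
        - (1 / 4) * (fderivWithin ℝ G S y.1 a y.2 y.2 + 2 * G y.1 y.2 b) ^ 2) := by
  have hu := hS.prod (uniqueDiffOn_univ (𝕜 := ℝ) (E := E))
  have hy2 : y ∈ S ×ˢ (univ : Set E) := ⟨hy, mem_univ _⟩
  have hL := contDiffWithinAt_lagrangian (W := W) hW hG (by rw [hpos]; norm_num)
  have hDL := ((hL.fderivWithin_right (m := 1) hu (by norm_num) hy2).differentiableWithinAt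
    (by simp)).hasFDerivWithinAt
  have h1 := hDL.clm_apply (hasFDerivWithinAt_const ((a, b) : E × E) y _)
  have hWd := (hW.differentiableWithinAt (by simp)).hasFDerivWithinAt
  have hGd := (hG.differentiableWithinAt (by simp)).hasFDerivWithinAt
  have hDW := ((hW.fderivWithin_right (m := 1) hS (by norm_num) hy).differentiableWithinAt
    (by simp)).hasFDerivWithinAt.clm_apply (hasFDerivWithinAt_const a y.1 S)
  have hDG := ((hG.fderivWithin_right (m := 1) hS (by norm_num) hy).differentiableWithinAt
    (by simp)).hasFDerivWithinAt.clm_apply (hasFDerivWithinAt_const a y.1 S)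
  have hsnd : HasFDerivWithinAt (fun z : E × E => z.2) (ContinuousLinearMap.snd ℝ E E)
    (S ×ˢ univ) y := hasFDerivWithinAt_snd
  have kW := hasFDerivWithinAt_fst_prod hWd
  have kG := hasFDerivWithinAt_fst_prod hGd
  have kDW := hasFDerivWithinAt_fst_prod hDW
  have kDG := hasFDerivWithinAt_fst_prod hDG
  have ks := ((kG.clm_apply hsnd).clm_apply hsnd).sqrt (by rw [hpos]; norm_num)
  have kh := ((kDG.clm_apply hsnd).clm_apply hsnd).add
    (((kG.clm_apply hsnd).clm_apply (hasFDerivWithinAt_const b y _)).const_mul 2)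
  have ki := (hasDerivAt_inv (x := 2 * Real.sqrt (G y.1 y.2 y.2)) (by
    rw [hpos]; norm_num)).comp_hasFDerivWithinAt y (ks.const_mul 2)
  have kK := (kDW.mul ks).add (kW.mul (kh.mul ki))
  have hev : (fun z : E × E => fderivWithin ℝ (lagrangian W G) (S ×ˢ univ) z (a, b))
      =ᶠ[𝓝[S ×ˢ univ] y] fun z => fderivWithin ℝ W S z.1 a * Real.sqrt (G z.1 z.2 z.2)
      + W z.1 * ((fderivWithin ℝ G S z.1 a z.2 z.2 + 2 * G z.1 z.2 b) *
        (2 * Real.sqrt (G z.1 z.2 z.2))⁻¹) := by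
    have hfst : Tendsto (fun z : E × E => z.1) (𝓝[S ×ˢ univ] y) (𝓝[S] y.1) :=
      tendsto_nhdsWithin_of_tendsto_nhds_of_eventually_within _
        (continuous_fst.continuousAt.mono_left nhdsWithin_le_nhds)
        (by filter_upwards [self_mem_nhdsWithin] with z hz using hz.1)
    have eW := hW.eventually (by simp)
    have eG := hG.eventually (by simp)
    rw [insert_eq_of_mem hy] at eW eG
    filter_upwards [hposn, self_mem_nhdsWithin, hfst.eventually eW, hfst.eventually eG]
      with z hz hzS hzW hzG
    exact fderivWithin_lagrangian hS hzS.1 (hzW.differentiableWithinAt (by simp))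
      (hzG.differentiableWithinAt (by simp)) hsymm hz a b
  have kK' := HasFDerivWithinAt.congr_of_eventuallyEq (f₁ := fun z : E × E =>
    fderivWithin ℝ (lagrangian W G) (S ×ˢ univ) z (a, b)) kK hev (hev.self_of_nhdsWithin hy2)
  have h3 := DFunLike.congr_fun ((hu y hy2).eq h1 kK') (a, b)
  simp only [add_apply, ContinuousLinearMap.comp_apply, ContinuousLinearMap.flip_apply, zero_apply,
    map_zero, zero_add] at h3
  rw [h3]
  simp only [smul_apply, add_apply, ContinuousLinearMap.comp_apply, ContinuousLinearMap.flip_apply,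
    ContinuousLinearMap.coe_fst', ContinuousLinearMap.coe_snd', smul_eq_mul, hpos, Real.sqrt_one,
    zero_apply, map_zero, hsymm y.1 b y.2, hsymm' a b y.2, Function.comp, Pi.mul_apply,
    Pi.add_apply]
  ring

end Lagrangian

/-! ### Minimizing curves in coordinates: momentum, force and the expansion of the Lagrangian. -/

section MinCurve

variable {n : ℕ} [NeZero n] {M : Type*} [TopologicalSpace M]
  [ChartedSpace (EuclideanHalfSpace n) M] [IsManifold (𝓡∂ n) ∞ M]

/-- A unit speed curve on `(-∞, T]` that minimizes the weighted length, with all points but the last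
in the interior of the manifold; if the last point is on the boundary, then the curve is transversal
to the boundary there. -/
structure MinCurve (g : Metric n M) (u : M → ℝ) (α : ℝ) (β : ℝ → M) (T : ℝ) : Prop where
  contMDiffOn : ContMDiffOn 𝓘(ℝ, ℝ) (𝓡∂ n) 1 β (Iic T)
  unit_speed : ∀ s ∈ Iic T, g.inner (β s) (mfderivWithin 𝓘(ℝ, ℝ) (𝓡∂ n) β (Iic T) s (1 : ℝ))
      (mfderivWithin 𝓘(ℝ, ℝ) (𝓡∂ n) β (Iic T) s (1 : ℝ)) = 1
  minimizing : ∀ s₁ s₂, s₁ ≤ s₂ → s₂ ≤ T → ∀ l, Reach g u α (β s₁) (β s₂) l →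
    ∫ s in s₁..s₂, u (β s) ^ α ≤ l
  interior : ∀ s < T, β s ∈ (𝓡∂ n).interior M
  endpoint : β T ∈ (𝓡∂ n).interior M ∨ (extChartAt (𝓡∂ n) (β T) (β T) 0 = 0 ∧
    derivWithin (fun s => extChartAt (𝓡∂ n) (β T) (β s)) (Iic T) T 0 < 0)

theorem target_mem_nhds_of_interior {p x : M} (hx : x ∈ (𝓡∂ n).interior M)
    (hp : x ∈ (extChartAt (𝓡∂ n) p).source) :
    (extChartAt (𝓡∂ n) p).target ∈ 𝓝 (extChartAt (𝓡∂ n) p x) := by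
  rw [← mem_interior_iff_mem_nhds]
  rw [extChartAt_source] at hp
  exact ((𝓡∂ n).isInteriorPoint_iff_of_mem_atlas (n := 1) (by simp) (chart_mem_atlas _ p) hp).1 hx

theorem convex_range : Convex ℝ (range (𝓡∂ n)) := (𝓡∂ n).convex_range

variable (β : ℝ → M) (T : ℝ) (p : M)

/-- The coordinates of the curve. -/
def coord (n : ℕ) [NeZero n] {M : Type*} [TopologicalSpace M]
    [ChartedSpace (EuclideanHalfSpace n) M] (β : ℝ → M) (p : M) (s : ℝ) :
    EuclideanSpace ℝ (Fin n) :=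
  extChartAt (𝓡∂ n) p (β s)

/-- The velocity of the curve in coordinates. -/
def vel (n : ℕ) [NeZero n] {M : Type*} [TopologicalSpace M]
    [ChartedSpace (EuclideanHalfSpace n) M] (β : ℝ → M) (T : ℝ) (p : M) (s : ℝ) :
    EuclideanSpace ℝ (Fin n) :=
  derivWithin (coord n β p) (Iic T) s

/-- The momentum `u^α g(β', ·)` of the curve in coordinates. -/
def momentum (g : Metric n M) (u : M → ℝ) (α : ℝ) (β : ℝ → M) (T : ℝ) (p : M) (s : ℝ) :
    EuclideanSpace ℝ (Fin n) →L[ℝ] ℝ :=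
  chartWeight n u α p (coord n β p s) • metricForm g p (coord n β p s) (vel n β T p s)

/-- The force, that is the derivative of the Lagrangian with respect to the position. -/
def force (g : Metric n M) (u : M → ℝ) (α : ℝ) (β : ℝ → M) (T : ℝ) (p : M) (s : ℝ) :
    EuclideanSpace ℝ (Fin n) →L[ℝ] ℝ :=
  fderivWithin ℝ (chartWeight n u α p) (range (𝓡∂ n)) (coord n β p s) +
    (chartWeight n u α p (coord n β p s) / 2) •
      ((fderivWithin ℝ (metricForm g p) (range (𝓡∂ n)) (coord n β p s)).flip
        (vel n β T p s)).flip (vel n β T p s)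

theorem force_apply (g : Metric n M) (u : M → ℝ) (α : ℝ) (β : ℝ → M) (T : ℝ) (p : M) (s : ℝ)
    (z : EuclideanSpace ℝ (Fin n)) :
    force g u α β T p s z =
      fderivWithin ℝ (chartWeight n u α p) (range (𝓡∂ n)) (coord n β p s) z +
      chartWeight n u α p (coord n β p s) / 2 *
        fderivWithin ℝ (metricForm g p) (range (𝓡∂ n)) (coord n β p s) z (vel n β T p s)
          (vel n β T p s) := by
  simp [force]

/-- The Lagrangian of the weighted length in the chart at `p`. -/
def chartLagrangian (g : Metric n M) (u : M → ℝ) (α : ℝ) (p : M) :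
    EuclideanSpace ℝ (Fin n) × EuclideanSpace ℝ (Fin n) → ℝ :=
  lagrangian (chartWeight n u α p) (metricForm g p)

/-- The second variation of the Lagrangian. -/
def lagrangianHess (g : Metric n M) (u : M → ℝ) (α : ℝ) (p : M)
    (y : EuclideanSpace ℝ (Fin n) × EuclideanSpace ℝ (Fin n)) :
    EuclideanSpace ℝ (Fin n) × EuclideanSpace ℝ (Fin n) →L[ℝ]
      EuclideanSpace ℝ (Fin n) × EuclideanSpace ℝ (Fin n) →L[ℝ] ℝ :=
  fderivWithin ℝ (fderivWithin ℝ (chartLagrangian g u α p) (range (𝓡∂ n) ×ˢ univ))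
    (range (𝓡∂ n) ×ˢ univ) y

variable {β T p} {g : Metric n M} {u : M → ℝ} {α : ℝ}

theorem coord_mem_target {s : ℝ} (hp : β s ∈ (extChartAt (𝓡∂ n) p).source) :
    coord n β p s ∈ (extChartAt (𝓡∂ n) p).target := (extChartAt (𝓡∂ n) p).map_source hp

theorem coord_mem_range (s : ℝ) : coord n β p s ∈ range (𝓡∂ n) := mem_range_self _

theorem symm_coord {s : ℝ} (hp : β s ∈ (extChartAt (𝓡∂ n) p).source) :
    (extChartAt (𝓡∂ n) p).symm (coord n β p s) = β s := (extChartAt (𝓡∂ n) p).left_inv hp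

section

variable (hβ : MinCurve g u α β T)
include hβ

namespace MinCurve

theorem eventually_mem_source {s : ℝ} (hs : s ≤ T) (hp : β s ∈ (extChartAt (𝓡∂ n) p).source) :
    ∀ᶠ t in 𝓝[Iic T] s, β t ∈ (extChartAt (𝓡∂ n) p).source :=
  (hβ.contMDiffOn.continuousOn s hs).eventually ((isOpen_extChartAt_source p).mem_nhds hp)

theorem contDiffWithinAt_coord {s : ℝ} (hs : s ≤ T) (hp : β s ∈ (extChartAt (𝓡∂ n) p).source) :
    ContDiffWithinAt ℝ 1 (coord n β p) (Iic T) s := by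
  rw [extChartAt_source] at hp
  exact contMDiffWithinAt_iff_contDiffWithinAt.1
    ((contMDiffAt_extChartAt' hp).comp_contMDiffWithinAt s (hβ.contMDiffOn s hs))

theorem hasDerivWithinAt_coord {s : ℝ} (hs : s ≤ T) (hp : β s ∈ (extChartAt (𝓡∂ n) p).source) :
    HasDerivWithinAt (coord n β p) (vel n β T p s) (Iic T) s :=
  ((hβ.contDiffWithinAt_coord hs hp).differentiableWithinAt (by simp)).hasDerivWithinAt

theorem continuousWithinAt_coord {s : ℝ} (hs : s ≤ T)
    (hp : β s ∈ (extChartAt (𝓡∂ n) p).source) :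
    ContinuousWithinAt (coord n β p) (Iic T) s :=
  (hβ.contDiffWithinAt_coord hs hp).continuousWithinAt

theorem continuousWithinAt_vel {s : ℝ} (hs : s ≤ T) (hp : β s ∈ (extChartAt (𝓡∂ n) p).source) :
    ContinuousWithinAt (vel n β T p) (Iic T) s := by
  have h := ((hβ.contDiffWithinAt_coord hs hp).fderivWithin_right (m := 0)
    (uniqueDiffOn_Iic T) (by norm_num) hs).continuousWithinAt
  exact h.clm_apply continuousWithinAt_const

theorem metricForm_vel {s : ℝ} (hs : s ≤ T) (hp : β s ∈ (extChartAt (𝓡∂ n) p).source) :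
    metricForm g p (coord n β p s) (vel n β T p s) (vel n β T p s) = 1 := by
  rw [← hβ.unit_speed s hs]
  exact (inner_mfderivWithin g p ((hβ.contMDiffOn s hs).mdifferentiableWithinAt (by simp))
    (uniqueDiffOn_Iic T s hs) hp).symm

end MinCurve

end

theorem chartWeight_pos (hupos : ∀ x, 0 < u x) (y : EuclideanSpace ℝ (Fin n)) :
    0 < chartWeight n u α p y := Real.rpow_pos_of_pos (hupos _) _

section

variable (hβ : MinCurve g u α β T) (hu : ContMDiff (𝓡∂ n) 𝓘(ℝ, ℝ) 2 u) (hupos : ∀ x, 0 < u x)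
include hβ hu hupos

namespace MinCurve

theorem fderivWithin_chartLagrangian {s : ℝ} (hs : s ≤ T)
    (hp : β s ∈ (extChartAt (𝓡∂ n) p).source) (a b : EuclideanSpace ℝ (Fin n)) :
    fderivWithin ℝ (chartLagrangian g u α p) (range (𝓡∂ n) ×ˢ univ)
      (coord n β p s, vel n β T p s) (a, b) = force g u α β T p s a + momentum g u α β T p s b := by
  have hy := coord_mem_target hp
  have h1 := hβ.metricForm_vel hs hp
  have h := fderivWithin_lagrangian (W := chartWeight n u α p) (G := metricForm g p)
    (y := (coord n β p s, vel n β T p s)) uniqueDiffOn_range (coord_mem_range s)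
    ((contDiffWithinAt_chartWeight hu hupos p hy).differentiableWithinAt (by simp))
    (differentiableWithinAt_metricForm g p hy) (metricForm_symm g p) (by
      rw [h1]; norm_num) a b
  rw [chartLagrangian, h, h1, force_apply, momentum]
  simp
  ring

theorem contDiffWithinAt_chartLagrangian {s : ℝ} (hs : s ≤ T)
    (hp : β s ∈ (extChartAt (𝓡∂ n) p).source) :
    ContDiffWithinAt ℝ 2 (chartLagrangian g u α p) (range (𝓡∂ n) ×ˢ univ)
      (coord n β p s, vel n β T p s) :=
  contDiffWithinAt_lagrangian (y := (coord n β p s, vel n β T p s))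
    (contDiffWithinAt_chartWeight hu hupos p (coord_mem_target hp))
    ((contDiffWithinAt_metricForm g p (coord_mem_target hp)).of_le ENat.LEInfty.out)
    (by rw [hβ.metricForm_vel hs hp]; norm_num)

/-- The second order expansion of the weighted length density near the curve. -/
theorem taylor_chartLagrangian {s : ℝ} (hs : s ≤ T)
    (hp : β s ∈ (extChartAt (𝓡∂ n) p).source) {ε : ℝ} (hε : 0 < ε) :
    ∃ δ > 0, ∀ t ≤ T, |t - s| < δ → ∀ a b : EuclideanSpace ℝ (Fin n), ‖a‖ < δ → ‖b‖ < δ →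
      coord n β p t + a ∈ range (𝓡∂ n) →
      |chartLagrangian g u α p (coord n β p t + a, vel n β T p t + b)
        - chartWeight n u α p (coord n β p t)
        - (force g u α β T p t a + momentum g u α β T p t b)
        - (1 / 2) * lagrangianHess g u α p (coord n β p s, vel n β T p s) (a, b) (a, b)|
        ≤ ε * ‖(a, b)‖ ^ 2 := by
  set S2 : Set (EuclideanSpace ℝ (Fin n) × EuclideanSpace ℝ (Fin n)) := range (𝓡∂ n) ×ˢ univ with hS2
  set y₀ := (coord n β p s, vel n β T p s) with hy₀
  have hconv : Convex ℝ S2 := convex_range.prod convex_univ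
  have hud : UniqueDiffOn ℝ S2 := uniqueDiffOn_range.prod uniqueDiffOn_univ
  have hy : y₀ ∈ S2 := ⟨coord_mem_range s, mem_univ _⟩
  have hcd := hβ.contDiffWithinAt_chartLagrangian hu hupos hs hp
  have hcl : y₀ ∈ closure (_root_.interior S2) := by
    rw [hS2, interior_prod_eq, closure_prod_eq]
    exact ⟨range_subset_closure_interior (coord_mem_range s), by simp⟩
  have hT := taylor_two_isLittleO hconv hud hy hcd
    (hcd.isSymmSndFDerivWithinAt (by simp) hud hcl hy)
  rw [isLittleO_iff] at hT
  obtain ⟨P, hP, Q, hQ, hPQ⟩ := eventually_prod_iff.1 (hT hε)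
  obtain ⟨r, hr, hball⟩ := Metric.mem_nhdsWithin_iff.1 (hP.and hQ)
  have hct : Tendsto (fun t => (coord n β p t, vel n β T p t)) (𝓝[Iic T] s) (𝓝 y₀) :=
    (hβ.continuousWithinAt_coord hs hp).prodMk_nhds (hβ.continuousWithinAt_vel hs hp)
  have hev := (hct.eventually (Metric.ball_mem_nhds y₀ (half_pos hr))).and
    (hβ.eventually_mem_source hs hp)
  obtain ⟨δ, hδ, hδ'⟩ := Metric.mem_nhdsWithin_iff.1 hev
  refine ⟨min δ (r / 2), by positivity, fun t ht hts a b ha hb hmem => ?_⟩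
  have h1 := hδ' ⟨by simpa [Real.dist_eq] using hts.trans_le (min_le_left _ _), ht⟩
  have hy1 : (coord n β p t, vel n β T p t) ∈ Metric.ball y₀ r ∩ S2 :=
    ⟨Metric.ball_subset_ball (by linarith) h1.1, coord_mem_range t, mem_univ _⟩
  have hab : ‖(a, b)‖ < r / 2 := max_lt (ha.trans_le (min_le_right _ _)) (hb.trans_le (min_le_right _ _))
  have hy2 : (coord n β p t + a, vel n β T p t + b) ∈ Metric.ball y₀ r ∩ S2 := by
    refine ⟨?_, hmem, mem_univ _⟩
    have e : (coord n β p t + a, vel n β T p t + b) = (coord n β p t, vel n β T p t) + (a, b) := rfl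
    rw [e, Metric.mem_ball]
    calc dist ((coord n β p t, vel n β T p t) + (a, b)) y₀
        ≤ dist ((coord n β p t, vel n β T p t) + (a, b)) (coord n β p t, vel n β T p t)
          + dist (coord n β p t, vel n β T p t) y₀ := dist_triangle _ _ _
      _ < r / 2 + r / 2 := add_lt_add (by simpa [dist_eq_norm] using hab) h1.1
      _ = r := by ring
  have h2 := hPQ (hball hy1).1 (hball hy2).2
  have e : (coord n β p t + a, vel n β T p t + b) - (coord n β p t, vel n β T p t) = (a, b) := by
    simp
  simp only [e] at h2
  rw [hβ.fderivWithin_chartLagrangian hu hupos ht h1.2] at h2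
  have e2 : chartLagrangian g u α p (coord n β p t, vel n β T p t) =
      chartWeight n u α p (coord n β p t) := by
    simp [chartLagrangian, lagrangian, hβ.metricForm_vel ht h1.2]
  rw [e2] at h2
  have h3 : ‖‖((a, b) : EuclideanSpace ℝ (Fin n) × EuclideanSpace ℝ (Fin n))‖ ^ 2‖ = ‖(a, b)‖ ^ 2 :=
    Real.norm_of_nonneg (by positivity)
  rw [h3, Real.norm_eq_abs, smul_eq_mul] at h2
  exact h2

theorem continuousWithinAt_chartWeight {s : ℝ} (hs : s ≤ T)
    (hp : β s ∈ (extChartAt (𝓡∂ n) p).source) :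
    ContinuousWithinAt (fun t => chartWeight n u α p (coord n β p t)) (Iic T) s :=
  (contDiffWithinAt_chartWeight hu hupos p (coord_mem_target hp)).continuousWithinAt.comp
    (hβ.continuousWithinAt_coord hs hp) fun t _ => coord_mem_range t

omit hu hupos in
theorem continuousWithinAt_metricForm {s : ℝ} (hs : s ≤ T)
    (hp : β s ∈ (extChartAt (𝓡∂ n) p).source) :
    ContinuousWithinAt (fun t => metricForm g p (coord n β p t)) (Iic T) s :=
  (contDiffWithinAt_metricForm g p (coord_mem_target hp)).continuousWithinAt.comp
    (hβ.continuousWithinAt_coord hs hp) fun t _ => coord_mem_range t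

theorem continuousWithinAt_momentum {s : ℝ} (hs : s ≤ T)
    (hp : β s ∈ (extChartAt (𝓡∂ n) p).source) :
    ContinuousWithinAt (momentum g u α β T p) (Iic T) s :=
  (hβ.continuousWithinAt_chartWeight hu hupos hs hp).smul
    ((hβ.continuousWithinAt_metricForm hs hp).clm_apply (hβ.continuousWithinAt_vel hs hp))

theorem continuousWithinAt_force {s : ℝ} (hs : s ≤ T)
    (hp : β s ∈ (extChartAt (𝓡∂ n) p).source) :
    ContinuousWithinAt (force g u α β T p) (Iic T) s := by
  have hy := coord_mem_target hp
  have hc := hβ.continuousWithinAt_coord hs hp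
  have h1 : ContinuousWithinAt (fun t => fderivWithin ℝ (chartWeight n u α p) (range (𝓡∂ n))
      (coord n β p t)) (Iic T) s :=
    ((contDiffWithinAt_chartWeight hu hupos p hy).fderivWithin_right (m := 1) uniqueDiffOn_range
      (by norm_num) (coord_mem_range s)).continuousWithinAt.comp hc fun t _ => coord_mem_range t
  have h2 : ContinuousWithinAt (fun t => fderivWithin ℝ (metricForm g p) (range (𝓡∂ n))
      (coord n β p t)) (Iic T) s :=
    ((contDiffWithinAt_metricForm g p hy).fderivWithin_right (m := ∞) uniqueDiffOn_range
      (by simp) (coord_mem_range s)).continuousWithinAt.comp hc fun t _ => coord_mem_range t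
  have hv := hβ.continuousWithinAt_vel hs hp
  have hflip : ∀ {F : Type} [NormedAddCommGroup F] [NormedSpace ℝ F]
      {B : ℝ → EuclideanSpace ℝ (Fin n) →L[ℝ] EuclideanSpace ℝ (Fin n) →L[ℝ] F},
      ContinuousWithinAt B (Iic T) s → ContinuousWithinAt (fun t => (B t).flip) (Iic T) s :=
    fun hB => (ContinuousLinearMap.flipₗᵢ ℝ _ _ _).continuous.continuousAt.comp_continuousWithinAt hB
  exact h1.add (((hβ.continuousWithinAt_chartWeight hu hupos hs hp).div_const 2).smul
    (hflip ((hflip h2).clm_apply hv) |>.clm_apply hv))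

end MinCurve

end

end MinCurve

/-! ### The lemma of du Bois-Reymond. -/

section DuBoisReymond

/-- Integration by parts replaces q by R = q minus a primitive of f and removes the undifferentiated
test function. Testing with a primitive of R minus its mean then shows that R is constant. -/
theorem eq_add_integral_of_integral_eq_zero {f q : ℝ → ℝ} (hf : Continuous f) (hq : Continuous q)
    {a b : ℝ} (hab : a < b)
    (h : ∀ θ θ' : ℝ → ℝ, (∀ t, HasDerivAt θ (θ' t) t) → Continuous θ' → θ a = 0 → θ b = 0 →
      ∫ t in a..b, (f t * θ t + q t * θ' t) = 0) :
    ∀ t ∈ Icc a b, q t = q a + ∫ r in a..t, f r := by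
  set F : ℝ → ℝ := fun t => ∫ r in a..t, f r with hF
  have hFd : ∀ t, HasDerivAt F (f t) t := fun t =>
    intervalIntegral.integral_hasDerivAt_right (hf.intervalIntegrable _ _)
      (hf.stronglyMeasurableAtFilter _ _) hf.continuousAt
  have hFc : Continuous F := continuous_iff_continuousAt.2 fun t => (hFd t).continuousAt
  set R : ℝ → ℝ := fun t => q t - F t with hR
  have hRc : Continuous R := hq.sub hFc
  set c : ℝ := (∫ t in a..b, R t) / (b - a) with hc
  have hba : b - a ≠ 0 := by linarith
  -- Subtracting the mean `c` is what makes this test function vanish at b as well as at a.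
  set θ : ℝ → ℝ := fun t => ∫ r in a..t, (R r - c) with hθ
  have hRcc : Continuous fun r => R r - c := hRc.sub continuous_const
  have hθd : ∀ t, HasDerivAt θ (R t - c) t := fun t =>
    intervalIntegral.integral_hasDerivAt_right (hRcc.intervalIntegrable _ _)
      (hRcc.stronglyMeasurableAtFilter _ _) hRcc.continuousAt
  have hθc : Continuous θ := continuous_iff_continuousAt.2 fun t => (hθd t).continuousAt
  have hθa : θ a = 0 := by simp [hθ]
  have hi : ∫ r in a..b, (R r - c) = 0 := by
    rw [intervalIntegral.integral_sub (hRc.intervalIntegrable _ _) (by simp)]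
    simp [hc]
    field_simp
    ring
  have hθb : θ b = 0 := hi
  have h1 := h θ _ hθd hRcc hθa hθb
  have h2 : ∫ t in a..b, (F t * (R t - c) + f t * θ t) = 0 := by
    have := intervalIntegral.integral_eq_sub_of_hasDerivAt
      (f := fun t => F t * θ t) (f' := fun t => f t * θ t + F t * (R t - c)) (a := a) (b := b)
      (fun t _ => (hFd t).mul (hθd t))
      (((hf.mul hθc).add (hFc.mul hRcc)).intervalIntegrable _ _)
    simp only [hθa, hθb, mul_zero, sub_zero] at this
    rw [← this]
    congr 1; ext t; ring
  have h3 : ∫ t in a..b, (R t - c) * (R t - c) = 0 := by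
    have e : ∀ t, (R t - c) * (R t - c) = (f t * θ t + q t * (R t - c)) -
        (F t * (R t - c) + f t * θ t) - c * (R t - c) := fun t => by simp only [hR]; ring
    simp only [e]
    rw [intervalIntegral.integral_sub, intervalIntegral.integral_sub, h1, h2,
      intervalIntegral.integral_const_mul, hi]
    · simp
    all_goals apply Continuous.intervalIntegrable; fun_prop
  have h4 : ∀ t ∈ Icc a b, R t = c := by
    by_contra hcon
    push Not at hcon
    obtain ⟨t, ht, hne⟩ := hcon
    have := intervalIntegral.integral_pos hab (f := fun t => (R t - c) * (R t - c))
      (hRcc.mul hRcc).continuousOn (fun x _ => mul_self_nonneg _)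
      ⟨t, ht, mul_self_pos.2 (sub_ne_zero.2 hne)⟩
    linarith
  intro t ht
  have e1 := h4 t ht
  have e2 := h4 a ⟨le_rfl, hab.le⟩
  simp only [hR, hF, intervalIntegral.integral_same] at e1 e2
  linarith

end DuBoisReymond

/-! ### Length of varied curves and the Euler-Lagrange equation. -/

section EulerLagrange

variable {n : ℕ} [NeZero n] {M : Type*} [TopologicalSpace M]
  [ChartedSpace (EuclideanHalfSpace n) M] [IsManifold (𝓡∂ n) ∞ M]
  {g : Metric n M} {u : M → ℝ} {α : ℝ} {β : ℝ → M} {T : ℝ} {p : M}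

section

variable (hβ : MinCurve g u α β T) (hu : ContMDiff (𝓡∂ n) 𝓘(ℝ, ℝ) 2 u) (hupos : ∀ x, 0 < u x)
include hβ hu hupos

namespace MinCurve

/-- A variation of the curve is a competitor; its weighted length up to second order. -/
theorem reach_variation {s : ℝ} (hs : s ≤ T)
    (hp : β s ∈ (extChartAt (𝓡∂ n) p).source) {ε : ℝ} (hε : 0 < ε) :
    ∃ δ > 0, ∀ a b : ℝ, a ≤ b → b ≤ T → |a - s| < δ → |b - s| < δ →
      ∀ η η' : ℝ → EuclideanSpace ℝ (Fin n),
      (∀ t ∈ Icc a b, HasDerivWithinAt η (η' t) (Icc a b) t) → ContinuousOn η' (Icc a b) →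
      (∀ t ∈ Icc a b, ‖η t‖ < δ ∧ ‖η' t‖ < δ) →
      (∀ t ∈ Icc a b, coord n β p t + η t ∈ range (𝓡∂ n)) →
      Reach g u α ((extChartAt (𝓡∂ n) p).symm (coord n β p a + η a))
        ((extChartAt (𝓡∂ n) p).symm (coord n β p b + η b))
        (∫ t in a..b, (u (β t) ^ α + (force g u α β T p t (η t) + momentum g u α β T p t (η' t)) +
          (1 / 2) * lagrangianHess g u α p (coord n β p s, vel n β T p s) (η t, η' t) (η t, η' t) +
          ε * ‖(η t, η' t)‖ ^ 2)) := by
  obtain ⟨δ₁, hδ₁, hT⟩ := hβ.taylor_chartLagrangian hu hupos hs hp hε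
  obtain ⟨r, hr, hball⟩ := Metric.mem_nhdsWithin_iff.1
    (extChartAt_target_mem_nhdsWithin_of_mem (coord_mem_target hp))
  have hev := ((hβ.continuousWithinAt_coord hs hp).eventually
    (Metric.ball_mem_nhds _ (half_pos hr))).and (hβ.eventually_mem_source hs hp)
  obtain ⟨δ₂, hδ₂, hδ₂'⟩ := Metric.mem_nhdsWithin_iff.1 hev
  refine ⟨min δ₁ (min δ₂ (r / 2)), by positivity, ?_⟩
  intro a b hab hbT ha hb η η' hη hη' hsmall hmem
  have hts : ∀ t ∈ Icc a b, |t - s| < min δ₁ (min δ₂ (r / 2)) := fun t ht => by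
    rw [abs_lt] at ha hb ⊢
    constructor <;> linarith [ht.1, ht.2]
  have htT : ∀ t ∈ Icc a b, t ≤ T := fun t ht => ht.2.trans hbT
  have hsub : Icc a b ⊆ Iic T := htT
  have h2 : ∀ t ∈ Icc a b, dist (coord n β p t) (coord n β p s) < r / 2 ∧
      β t ∈ (extChartAt (𝓡∂ n) p).source := fun t ht =>
    hδ₂' ⟨by
      simpa [Real.dist_eq] using (hts t ht).trans_le ((min_le_right _ _).trans (min_le_left _ _)),
      htT t ht⟩
  have hsrc : ∀ t ∈ Icc a b, β t ∈ (extChartAt (𝓡∂ n) p).source := fun t ht => (h2 t ht).2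
  have htgt : ∀ t ∈ Icc a b, coord n β p t + η t ∈ (extChartAt (𝓡∂ n) p).target := by
    intro t ht
    refine hball ⟨?_, hmem t ht⟩
    rw [Metric.mem_ball]
    calc dist (coord n β p t + η t) (coord n β p s)
        ≤ dist (coord n β p t + η t) (coord n β p t) + dist (coord n β p t) (coord n β p s) :=
          dist_triangle _ _ _
      _ < r / 2 + r / 2 := add_lt_add (by
          simpa [dist_eq_norm] using
            (hsmall t ht).1.trans_le ((min_le_right _ _).trans (min_le_right _ _))) (h2 t ht).1
      _ = r := by ring
  have hcη : ContinuousOn η (Icc a b) := fun t ht => (hη t ht).continuousWithinAt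
  have hcv : ContinuousOn (vel n β T p) (Icc a b) := fun t ht =>
    (hβ.continuousWithinAt_vel (htT t ht) (hsrc t ht)).mono hsub
  have hcx : ContinuousOn (coord n β p) (Icc a b) := fun t ht =>
    (hβ.continuousWithinAt_coord (htT t ht) (hsrc t ht)).mono hsub
  have hcP : ContinuousOn (momentum g u α β T p) (Icc a b) := fun t ht =>
    (hβ.continuousWithinAt_momentum hu hupos (htT t ht) (hsrc t ht)).mono hsub
  have hcF : ContinuousOn (force g u α β T p) (Icc a b) := fun t ht =>
    (hβ.continuousWithinAt_force hu hupos (htT t ht) (hsrc t ht)).mono hsub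
  have hcW : ContinuousOn (fun t => chartWeight n u α p (coord n β p t)) (Icc a b) := fun t ht =>
    (hβ.continuousWithinAt_chartWeight hu hupos (htT t ht) (hsrc t ht)).mono hsub
  have hWeq : EqOn (fun t => u (β t) ^ α) (fun t => chartWeight n u α p (coord n β p t)) (Icc a b) :=
    fun t ht => by simp only [chartWeight, symm_coord (hsrc t ht)]
  have hcpair : ContinuousOn (fun t => (η t, η' t)) (Icc a b) := hcη.prodMk hη'
  have hcH : ContinuousOn (fun t => lagrangianHess g u α p (coord n β p s, vel n β T p s)
      (η t, η' t) (η t, η' t)) (Icc a b) :=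
    ((lagrangianHess g u α p (coord n β p s, vel n β T p s)).continuous.comp_continuousOn
      hcpair).clm_apply hcpair
  have hcR := (((hcW.congr hWeq).add ((hcF.clm_apply hcη).add (hcP.clm_apply hη'))).add
    (hcH.const_smul (1 / 2 : ℝ))).add ((hcpair.norm.pow 2).const_smul ε)
  have harc := Reach.arc (g := g) (α := α) hu hupos p (ξ := fun t => coord n β p t + η t)
    (ξ' := fun t => vel n β T p t + η' t) hab
    (fun t ht => ((hβ.hasDerivWithinAt_coord (htT t ht) (hsrc t ht)).mono hsub).add (hη t ht))
    (hcv.add hη') htgt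
  refine harc.mono (intervalIntegral.integral_mono_on hab ?_ ?_ fun t ht => ?_)
  · refine ContinuousOn.intervalIntegrable_of_Icc hab ?_
    have hr : MapsTo (fun t => coord n β p t + η t) (Icc a b) (range (𝓡∂ n)) := hmem
    have h1 : ContinuousOn (fun t => chartWeight n u α p (coord n β p t + η t)) (Icc a b) :=
      fun t ht => (contDiffWithinAt_chartWeight hu hupos p (htgt t ht)).continuousWithinAt.comp
        (f := fun t => coord n β p t + η t) ((hcx.add hcη) t ht) hr
    have h2 : ContinuousOn (fun t => metricForm g p (coord n β p t + η t)) (Icc a b) :=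
      fun t ht => (contDiffWithinAt_metricForm g p (htgt t ht)).continuousWithinAt.comp
        (f := fun t => coord n β p t + η t) ((hcx.add hcη) t ht) hr
    exact h1.mul ((h2.clm_apply (hcv.add hη')).clm_apply (hcv.add hη')).sqrt
  · exact hcR.intervalIntegrable_of_Icc hab
  · have h3 := hT t (htT t ht) ((hts t ht).trans_le (min_le_left _ _)) (η t) (η' t)
      ((hsmall t ht).1.trans_le (min_le_left _ _)) ((hsmall t ht).2.trans_le (min_le_left _ _))
      (hmem t ht)
    have h4 := (abs_le.1 h3).2
    have h5 : u (β t) ^ α = chartWeight n u α p (coord n β p t) := hWeq ht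
    simp only [chartLagrangian, lagrangian] at h4
    linarith

/-- The first variation vanishes. Before T the curve is in the interior, so variations of both signs
are admissible; minimality gives 0 ≤ τI + τ²J for all small τ of either sign. -/
theorem integral_force_momentum_eq_zero {s : ℝ} (hs : s < T)
    (hp : β s ∈ (extChartAt (𝓡∂ n) p).source) :
    ∃ a b, a < s ∧ s < b ∧ b ≤ T ∧ (∀ t ∈ Icc a b, β t ∈ (extChartAt (𝓡∂ n) p).source) ∧
      ∀ η η' : ℝ → EuclideanSpace ℝ (Fin n), (∀ t ∈ Icc a b, HasDerivAt η (η' t) t) →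
      ContinuousOn η' (Icc a b) → η a = 0 → η b = 0 →
      ∫ t in a..b, (force g u α β T p t (η t) + momentum g u α β T p t (η' t)) = 0 := by
  obtain ⟨δ, hδ, hvar⟩ := hβ.reach_variation hu hupos hs.le hp one_pos
  have hnhds : Iic T ∈ 𝓝 s := Iic_mem_nhds hs
  obtain ⟨r, hr, hball⟩ := Metric.mem_nhds_iff.1
    (target_mem_nhds_of_interior (hβ.interior s hs) hp)
  have hev := ((hβ.continuousWithinAt_coord hs.le hp).eventually
    (Metric.ball_mem_nhds _ (half_pos hr))).and (hβ.eventually_mem_source hs.le hp)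
  rw [nhdsWithin_eq_nhds.2 hnhds] at hev
  obtain ⟨δ₂, hδ₂, hδ₂'⟩ := Metric.mem_nhds_iff.1 hev
  set d := min (δ / 2) (min (δ₂ / 2) (T - s)) with hd
  have hd0 : 0 < d := by have := sub_pos.2 hs; positivity
  have hd1 : d ≤ δ / 2 := min_le_left _ _
  have hd2 : d ≤ δ₂ / 2 := (min_le_right _ _).trans (min_le_left _ _)
  have hd3 : d ≤ T - s := (min_le_right _ _).trans (min_le_right _ _)
  have hnear : ∀ t ∈ Icc (s - d) (s + d), dist (coord n β p t) (coord n β p s) < r / 2 ∧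
      β t ∈ (extChartAt (𝓡∂ n) p).source := fun t ht => hδ₂' (by
    rw [Metric.mem_ball, Real.dist_eq, abs_lt]
    constructor <;> linarith [ht.1, ht.2])
  refine ⟨s - d, s + d, by linarith, by linarith, by linarith, fun t ht => (hnear t ht).2, ?_⟩
  intro η η' hη hη' hηa hηb
  set a := s - d with ha
  set b := s + d with hb
  have hab : a ≤ b := by linarith
  have hsub : Icc a b ⊆ Iic T := fun t ht => by
    have := ht.2
    simp only [mem_Iic]
    linarith
  have hcη : ContinuousOn η (Icc a b) := fun t ht => (hη t ht).continuousAt.continuousWithinAt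
  obtain ⟨K₁, hK₁⟩ := isCompact_Icc.exists_bound_of_continuousOn hcη
  obtain ⟨K₂, hK₂⟩ := isCompact_Icc.exists_bound_of_continuousOn hη'
  set K := max (max K₁ K₂) 1 with hK
  have hK0 : 0 < K := lt_of_lt_of_le one_pos (le_max_right _ _)
  have hKη : ∀ t ∈ Icc a b, ‖η t‖ ≤ K := fun t ht =>
    (hK₁ t ht).trans ((le_max_left _ _).trans (le_max_left _ _))
  have hKη' : ∀ t ∈ Icc a b, ‖η' t‖ ≤ K := fun t ht =>
    (hK₂ t ht).trans ((le_max_right _ _).trans (le_max_left _ _))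
  have hcP : ContinuousOn (momentum g u α β T p) (Icc a b) := fun t ht =>
    (hβ.continuousWithinAt_momentum hu hupos (hsub ht) (hnear t ht).2).mono hsub
  have hcF : ContinuousOn (force g u α β T p) (Icc a b) := fun t ht =>
    (hβ.continuousWithinAt_force hu hupos (hsub ht) (hnear t ht).2).mono hsub
  have hcW : ContinuousOn (fun t => u (β t) ^ α) (Icc a b) := by
    have h1 : ContinuousOn (fun t => chartWeight n u α p (coord n β p t)) (Icc a b) := fun t ht =>
      (hβ.continuousWithinAt_chartWeight hu hupos (hsub ht) (hnear t ht).2).mono hsub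
    exact h1.congr fun t ht => by simp only [chartWeight, symm_coord (hnear t ht).2]
  set H := lagrangianHess g u α p (coord n β p s, vel n β T p s) with hH
  set I := ∫ t in a..b, (force g u α β T p t (η t) + momentum g u α β T p t (η' t)) with hI
  set J := ∫ t in a..b, ((1 / 2) * H (η t, η' t) (η t, η' t) + ‖(η t, η' t)‖ ^ 2) with hJ
  have hcpair : ContinuousOn (fun t => (η t, η' t)) (Icc a b) := hcη.prodMk hη'
  have i1 : IntervalIntegrable (fun t => u (β t) ^ α) volume a b := hcW.intervalIntegrable_of_Icc hab
  have i2 : IntervalIntegrable (fun t => force g u α β T p t (η t) + momentum g u α β T p t (η' t))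
      volume a b := ((hcF.clm_apply hcη).add (hcP.clm_apply hη')).intervalIntegrable_of_Icc hab
  have i3 : IntervalIntegrable (fun t => (1 / 2) * H (η t, η' t) (η t, η' t) + ‖(η t, η' t)‖ ^ 2)
      volume a b := by
    refine ContinuousOn.intervalIntegrable_of_Icc hab ?_
    exact (((H.continuous.comp_continuousOn hcpair).clm_apply hcpair).const_smul (1 / 2 : ℝ)).add
      (hcpair.norm.pow 2)
  have key : ∀ τ : ℝ, |τ| * K < min δ (r / 2) → 0 ≤ τ * I + τ ^ 2 * J := by
    intro τ hτ
    have hs1 : ∀ t ∈ Icc a b, ‖τ • η t‖ < min δ (r / 2) ∧ ‖τ • η' t‖ < min δ (r / 2) := by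
      intro t ht
      rw [norm_smul, norm_smul, Real.norm_eq_abs]
      exact ⟨(mul_le_mul_of_nonneg_left (hKη t ht) (abs_nonneg _)).trans_lt hτ,
        (mul_le_mul_of_nonneg_left (hKη' t ht) (abs_nonneg _)).trans_lt hτ⟩
    have h := hvar a b hab (by linarith) (by rw [abs_lt]; constructor <;> linarith)
      (by rw [abs_lt]; constructor <;> linarith) (fun t => τ • η t) (fun t => τ • η' t)
      (fun t ht => (hη t ht).hasDerivWithinAt.const_smul τ) (hη'.const_smul τ)
      (fun t ht => ⟨(hs1 t ht).1.trans_le (min_le_left _ _), (hs1 t ht).2.trans_le (min_le_left _ _)⟩)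
      (fun t ht => extChartAt_target_subset_range p (hball (by
        rw [Metric.mem_ball]
        calc dist (coord n β p t + τ • η t) (coord n β p s)
            ≤ dist (coord n β p t + τ • η t) (coord n β p t) + dist (coord n β p t) (coord n β p s) :=
              dist_triangle _ _ _
          _ < r / 2 + r / 2 := add_lt_add (by
              simpa [dist_eq_norm] using (hs1 t ht).1.trans_le (min_le_right _ _)) (hnear t ht).1
          _ = r := by ring)))
    simp only [hηa, hηb, smul_zero, add_zero] at h
    rw [symm_coord (hnear a ⟨le_rfl, hab⟩).2, symm_coord (hnear b ⟨hab, le_rfl⟩).2] at h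
    have h2 := hβ.minimizing a b hab (by linarith) _ h
    have e : ∀ t, (u (β t) ^ α + (force g u α β T p t (τ • η t) + momentum g u α β T p t (τ • η' t)) +
        1 / 2 * H (τ • η t, τ • η' t) (τ • η t, τ • η' t) + 1 * ‖(τ • η t, τ • η' t)‖ ^ 2) =
        u (β t) ^ α + τ * (force g u α β T p t (η t) + momentum g u α β T p t (η' t)) +
        τ ^ 2 * ((1 / 2) * H (η t, η' t) (η t, η' t) + ‖(η t, η' t)‖ ^ 2) := by
      intro t
      rw [← Prod.smul_mk]
      simp only [map_smul, smul_apply, smul_eq_mul, norm_smul, Real.norm_eq_abs, mul_pow, sq_abs]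
      ring
    simp only [e] at h2
    rw [intervalIntegral.integral_add (i1.add (i2.const_mul τ)) (i3.const_mul (τ ^ 2)),
      intervalIntegral.integral_add i1 (i2.const_mul τ), intervalIntegral.integral_const_mul,
      intervalIntegral.integral_const_mul] at h2
    linarith
  by_contra hne
  have hI0 : 0 < |I| := abs_pos.2 hne
  have hm : 0 < min δ (r / 2) := by positivity
  -- The first bound makes the variation admissible. The second makes τ₀|J| at most |I|/2, against
  -- |I| ≤ τ₀J.
  set τ₀ := min (min δ (r / 2) / (2 * K)) (|I| / (2 * (|J| + 1))) with hτ₀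
  have hJ1 : 0 < |J| + 1 := by positivity
  have hτ0 : 0 < τ₀ := by positivity
  have hτ1 : τ₀ * K < min δ (r / 2) := by
    have : τ₀ ≤ min δ (r / 2) / (2 * K) := min_le_left _ _
    rw [le_div_iff₀ (by positivity)] at this
    linarith
  have hτ2 : τ₀ * (2 * (|J| + 1)) ≤ |I| := by
    rw [← le_div_iff₀ (by positivity)]
    exact min_le_right _ _
  have k1 := key τ₀ (by rw [abs_of_pos hτ0]; exact hτ1)
  have k2 := key (-τ₀) (by rw [abs_neg, abs_of_pos hτ0]; exact hτ1)
  have k3 : τ₀ * |I| ≤ τ₀ ^ 2 * J := by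
    rcases abs_cases I with ⟨e, _⟩ | ⟨e, _⟩ <;> rw [e] <;> nlinarith
  have k4 : |I| ≤ τ₀ * J := by
    have : τ₀ * |I| ≤ τ₀ * (τ₀ * J) := by nlinarith
    exact le_of_mul_le_mul_left this hτ0
  have k5 : τ₀ * J ≤ τ₀ * |J| := mul_le_mul_of_nonneg_left (le_abs_self J) hτ0.le
  nlinarith

/-- The curve is only C¹, so differentiability of the momentum has to come from the integrated
equation. It is obtained for each fixed vector and reassembled from the coordinate vectors. -/
theorem hasDerivAt_momentum {s : ℝ} (hs : s < T) (hp : β s ∈ (extChartAt (𝓡∂ n) p).source) :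
    HasDerivAt (momentum g u α β T p) (force g u α β T p s) s := by
  obtain ⟨a, b, has, hsb, hbT, hsrc, hint⟩ := hβ.integral_force_momentum_eq_zero hu hupos hs hp
  have hab : a < b := has.trans hsb
  have hsub : Icc a b ⊆ Iic T := fun t ht => ht.2.trans hbT
  have hcP : ContinuousOn (momentum g u α β T p) (Icc a b) := fun t ht =>
    (hβ.continuousWithinAt_momentum hu hupos (hsub ht) (hsrc t ht)).mono hsub
  have hcF : ContinuousOn (force g u α β T p) (Icc a b) := fun t ht =>
    (hβ.continuousWithinAt_force hu hupos (hsub ht) (hsrc t ht)).mono hsub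
  have hz : ∀ z, HasDerivAt (fun t => momentum g u α β T p t z) (force g u α β T p s z) s := by
    intro z
    -- Projecting to [a, b] extends the force and the momentum to continuous functions on the whole
    -- line without changing them on [a, b].
    set f : ℝ → ℝ := fun t => force g u α β T p (projIcc a b hab.le t) z with hf
    set q : ℝ → ℝ := fun t => momentum g u α β T p (projIcc a b hab.le t) z with hq
    have hpj : Continuous fun t => (projIcc a b hab.le t : ℝ) :=
      continuous_subtype_val.comp continuous_projIcc
    have hfc : Continuous f := (hcF.comp_continuous hpj fun t =>
      (projIcc a b hab.le t).2).clm_apply continuous_const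
    have hqc : Continuous q := (hcP.comp_continuous hpj fun t =>
      (projIcc a b hab.le t).2).clm_apply continuous_const
    have hfe : ∀ t ∈ Icc a b, f t = force g u α β T p t z := fun t ht => by
      simp only [hf, projIcc_of_mem hab.le ht]
    have hqe : ∀ t ∈ Icc a b, q t = momentum g u α β T p t z := fun t ht => by
      simp only [hq, projIcc_of_mem hab.le ht]
    have key := eq_add_integral_of_integral_eq_zero hfc hqc hab fun θ θ' hθ hθ' h0 h1 => by
      rw [← hint (fun t => θ t • z) (fun t => θ' t • z) (fun t _ => (hθ t).smul_const z)
        (hθ'.smul continuous_const).continuousOn (by simp [h0]) (by simp [h1])]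
      refine intervalIntegral.integral_congr fun t ht => ?_
      rw [uIcc_of_le hab.le] at ht
      simp only [hfe t ht, hqe t ht, map_smul, smul_eq_mul]
      ring
    have hd : HasDerivAt (fun t => q a + ∫ r in a..t, f r) (f s) s :=
      (intervalIntegral.integral_hasDerivAt_right (hfc.intervalIntegrable _ _)
        (hfc.stronglyMeasurableAtFilter _ _) hfc.continuousAt).const_add _
    rw [hfe s ⟨has.le, hsb.le⟩] at hd
    refine hd.congr_of_eventuallyEq ?_
    filter_upwards [Icc_mem_nhds has hsb] with t ht
    rw [← hqe t ht, key t ht]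
  have hsum : ∀ L : EuclideanSpace ℝ (Fin n) →L[ℝ] ℝ,
      L = ∑ i, L (EuclideanSpace.single i 1) • EuclideanSpace.proj i := fun L => by
    ext z
    conv_lhs => rw [eq_sum_single z]
    simp [mul_comm]
  have h1 : HasDerivAt (fun t => ∑ i, momentum g u α β T p t (EuclideanSpace.single i 1) •
      (EuclideanSpace.proj i : EuclideanSpace ℝ (Fin n) →L[ℝ] ℝ))
      (∑ i, force g u α β T p s (EuclideanSpace.single i 1) • EuclideanSpace.proj i) s :=
    HasDerivAt.fun_sum fun i _ => (hz _).smul_const _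
  rw [← hsum] at h1
  refine h1.congr_of_eventuallyEq (Eventually.of_forall fun t => ?_)
  exact hsum _

/-- The Euler-Lagrange equation. -/
theorem hasDerivWithinAt_momentum {s : ℝ} (hs : s ≤ T)
    (hp : β s ∈ (extChartAt (𝓡∂ n) p).source) :
    HasDerivWithinAt (momentum g u α β T p) (force g u α β T p s) (Iic T) s := by
  rcases hs.lt_or_eq with hs | rfl
  · exact (hβ.hasDerivAt_momentum hu hupos hs hp).hasDerivWithinAt
  obtain ⟨δ, hδ, hsrc⟩ := Metric.mem_nhdsWithin_iff.1 (hβ.eventually_mem_source le_rfl hp)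
  have hsrc' : ∀ t ∈ Ioo (s - δ) s, β t ∈ (extChartAt (𝓡∂ n) p).source := fun t ht =>
    hsrc ⟨by rw [Metric.mem_ball, Real.dist_eq, abs_lt]; constructor <;> linarith [ht.1, ht.2],
      ht.2.le⟩
  -- At the endpoint no two-sided variation is available. The one-sided derivative exists because
  -- the force is continuous up to T.
  refine hasDerivWithinAt_Iic_of_tendsto_deriv (s := Ioo (s - δ) s)
    (fun t ht => (hβ.hasDerivAt_momentum hu hupos ht.2
      (hsrc' t ht)).differentiableAt.differentiableWithinAt)
    ((hβ.continuousWithinAt_momentum hu hupos le_rfl hp).mono fun t ht => ht.2.le)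
    (Ioo_mem_nhdsLT (by linarith)) ?_
  have h1 : Tendsto (force g u α β s p) (𝓝[<] s) (𝓝 (force g u α β s p s)) :=
    (hβ.continuousWithinAt_force hu hupos le_rfl hp).mono_left (nhdsWithin_mono _ Iio_subset_Iic_self)
  refine h1.congr' ?_
  filter_upwards [Ioo_mem_nhdsLT (show s - δ < s by linarith)] with t ht
  exact (hβ.hasDerivAt_momentum hu hupos ht.2 (hsrc' t ht)).deriv.symm

end MinCurve

end

end EulerLagrange

/-! ### Orthonormal frames of a bilinear form and traces computed in them. -/

section Frame

variable {n : ℕ} [NeZero n]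

/-- `F` is an orthonormal frame of the bilinear form `G`, written as a linear map. -/
def IsFrame (G : EuclideanSpace ℝ (Fin n) →L[ℝ] EuclideanSpace ℝ (Fin n) →L[ℝ] ℝ)
    (F : EuclideanSpace ℝ (Fin n) →L[ℝ] EuclideanSpace ℝ (Fin n)) : Prop :=
  ∀ z w, G (F z) (F w) = inner ℝ z w

namespace IsFrame

variable {G : EuclideanSpace ℝ (Fin n) →L[ℝ] EuclideanSpace ℝ (Fin n) →L[ℝ] ℝ}
  {F : EuclideanSpace ℝ (Fin n) →L[ℝ] EuclideanSpace ℝ (Fin n)}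

theorem injective (hF : IsFrame G F) : Function.Injective F := by
  rw [injective_iff_map_eq_zero]
  intro z hz
  have := hF z z
  rw [hz, map_zero] at this
  exact inner_self_eq_zero.1 this.symm

theorem surjective (hF : IsFrame G F) : Function.Surjective F :=
  (LinearMap.injective_iff_surjective (f := F.toLinearMap)).1 hF.injective

theorem apply_self (hF : IsFrame G F) (a : Fin n) :
    G (F (EuclideanSpace.single a 1)) (F (EuclideanSpace.single a 1)) = 1 := by
  rw [hF]; simp

theorem sum_smul (hF : IsFrame G F) (x : EuclideanSpace ℝ (Fin n)) :
    ∑ a, G (F (EuclideanSpace.single a 1)) x • F (EuclideanSpace.single a 1) = x := by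
  obtain ⟨z, rfl⟩ := hF.surjective x
  simp only [hF _ z, ← map_smul, ← map_sum]
  congr 1
  ext i
  simp [Pi.single_apply, EuclideanSpace.inner_single_left]

theorem sum_mul_apply (hF : IsFrame G F) (d : EuclideanSpace ℝ (Fin n) →L[ℝ] ℝ)
    (x : EuclideanSpace ℝ (Fin n)) :
    ∑ a, G (F (EuclideanSpace.single a 1)) x * d (F (EuclideanSpace.single a 1)) = d x := by
  conv_rhs => rw [← hF.sum_smul x]
  simp

/-- The inverse Gram matrix is Σₐ fₐ fₐᵀ for any orthonormal frame fₐ, so contraction with it is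
summation over the frame. -/
theorem sum_eq_sum_inv (hF : IsFrame G F) (B : EuclideanSpace ℝ (Fin n) →ₗ[ℝ]
      EuclideanSpace ℝ (Fin n) →ₗ[ℝ] ℝ) (hG : ∀ x y, G x y = G y x) :
    ∑ i, ∑ j, (Matrix.of fun i j => G (EuclideanSpace.single i 1) (EuclideanSpace.single j 1))⁻¹ i j *
      B (EuclideanSpace.single i 1) (EuclideanSpace.single j 1) =
    ∑ a, B (F (EuclideanSpace.single a 1)) (F (EuclideanSpace.single a 1)) := by
  set Gm : Matrix (Fin n) (Fin n) ℝ :=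
    Matrix.of fun i j => G (EuclideanSpace.single i 1) (EuclideanSpace.single j 1) with hGm
  set K : Matrix (Fin n) (Fin n) ℝ := Matrix.of fun j k => ∑ a, F (EuclideanSpace.single a 1) j *
    F (EuclideanSpace.single a 1) k with hK
  have h : Gm * K = 1 := by
    ext i k
    rw [Matrix.mul_apply]
    simp only [hGm, hK, Matrix.of_apply, Finset.mul_sum]
    rw [Finset.sum_comm]
    have h1 : ∀ a, ∑ j, G (EuclideanSpace.single i 1) (EuclideanSpace.single j 1) *
        (F (EuclideanSpace.single a 1) j * F (EuclideanSpace.single a 1) k) =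
        G (F (EuclideanSpace.single a 1)) (EuclideanSpace.single i 1) *
          F (EuclideanSpace.single a 1) k := by
      intro a
      rw [hG (F _)]
      nth_rewrite 3 [eq_sum_single (F (EuclideanSpace.single a 1))]
      rw [map_sum, Finset.sum_mul]
      refine Finset.sum_congr rfl fun j _ => ?_
      rw [map_smul, smul_eq_mul]
      ring
    simp only [h1]
    have h2 := hF.sum_mul_apply (EuclideanSpace.proj k :
      EuclideanSpace ℝ (Fin n) →L[ℝ] ℝ) (EuclideanSpace.single i 1)
    simp only [PiLp.proj_apply] at h2
    rw [h2]
    simp [Matrix.one_apply, eq_comm]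
  rw [Matrix.inv_eq_right_inv h]
  simp only [hK, Matrix.of_apply, bilin_eq_sum B (F _) (F _), Finset.sum_mul]
  conv_rhs => rw [Finset.sum_comm]
  refine Finset.sum_congr rfl fun i _ => ?_
  conv_rhs => rw [Finset.sum_comm]
  refine Finset.sum_congr rfl fun j _ => Finset.sum_congr rfl fun a _ => by ring

/-- Basis independence of the trace of an endomorphism. It is used to turn the coordinate Ricci
contraction into a sum over a frame. -/
theorem sum_apply_apply (hF : IsFrame G F)
    (L : EuclideanSpace ℝ (Fin n) →ₗ[ℝ] EuclideanSpace ℝ (Fin n)) :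
    ∑ a, G (F (EuclideanSpace.single a 1)) (L (F (EuclideanSpace.single a 1))) =
      ∑ i, L (EuclideanSpace.single i 1) i := by
  have h1 : ∀ a, G (F (EuclideanSpace.single a 1)) (L (F (EuclideanSpace.single a 1))) =
      ∑ i, F (EuclideanSpace.single a 1) i *
        G (F (EuclideanSpace.single a 1)) (L (EuclideanSpace.single i 1)) := by
    intro a
    nth_rewrite 2 [eq_sum_single (F (EuclideanSpace.single a 1))]
    simp
  simp only [h1]
  rw [Finset.sum_comm]
  refine Finset.sum_congr rfl fun i _ => ?_
  conv_rhs => rw [← hF.sum_smul (L (EuclideanSpace.single i 1))]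
  simp [mul_comm]

/-- A symmetric form has an orthogonal basis, which positivity allows to normalize. -/
theorem of_pos (hG : ∀ x y, G x y = G y x) (hpos : ∀ x ≠ 0, 0 < G x x) : ∃ F, IsFrame G F := by
  obtain ⟨v, hv⟩ := LinearMap.BilinForm.exists_orthogonal_basis
    (B := (G.toLinearMap₁₂ : LinearMap.BilinForm ℝ (EuclideanSpace ℝ (Fin n)))) ⟨fun x y => hG x y⟩
  have hr : Module.finrank ℝ (EuclideanSpace ℝ (Fin n)) = n := by simp
  set b : Fin n → EuclideanSpace ℝ (Fin n) := fun i => v (Fin.cast hr.symm i) with hb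
  have hbo : ∀ i j, i ≠ j → G (b i) (b j) = 0 := fun i j hij => hv (by simpa using hij)
  have hbp : ∀ i, 0 < G (b i) (b i) := fun i => hpos _ (v.ne_zero _)
  set e : Fin n → EuclideanSpace ℝ (Fin n) := fun i => (Real.sqrt (G (b i) (b i)))⁻¹ • b i with he
  have hee : ∀ i j, G (e i) (e j) = if i = j then 1 else 0 := by
    intro i j
    simp only [he, map_smul, smul_apply, smul_eq_mul]
    split_ifs with hij
    · subst hij
      have h := hbp i
      have h2 := Real.mul_self_sqrt h.le
      have h3 := (Real.sqrt_pos.2 h).ne'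
      field_simp
      rw [pow_two, h2]
    · rw [hbo i j hij]; simp
  refine ⟨∑ i, (EuclideanSpace.proj i : EuclideanSpace ℝ (Fin n) →L[ℝ] ℝ).smulRight (e i),
    fun z w => ?_⟩
  simp only [sum_apply, ContinuousLinearMap.smulRight_apply, map_sum, map_smul, smul_apply,
    PiLp.proj_apply, smul_eq_mul, hee, PiLp.inner_apply]
  simp

end IsFrame

end Frame

/-! ### Metric trace, Ricci contraction and gradient in coordinates. -/

section Trace

variable {n : ℕ} [NeZero n] {M : Type*} [TopologicalSpace M]
  [ChartedSpace (EuclideanHalfSpace n) M] [IsManifold (𝓡∂ n) ∞ M] (g : Metric n M)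

theorem exists_isFrame (p : M) {y : EuclideanSpace ℝ (Fin n)}
    (hy : y ∈ (extChartAt (𝓡∂ n) p).target) : ∃ F, IsFrame (metricForm g p y) F :=
  IsFrame.of_pos (metricForm_symm g p y) fun _ hx => metricForm_pos g p hy hx

/-- The trace of a bilinear form with respect to the metric, in coordinates. -/
def gTrace (p : M) (y : EuclideanSpace ℝ (Fin n))
    (B : EuclideanSpace ℝ (Fin n) →L[ℝ] EuclideanSpace ℝ (Fin n) →L[ℝ] ℝ) : ℝ :=
  ∑ i, ∑ j, gramInv g p y i j * B (EuclideanSpace.single i 1) (EuclideanSpace.single j 1)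

variable {g}

theorem IsFrame.gTrace_eq {p : M} {y : EuclideanSpace ℝ (Fin n)}
    {F : EuclideanSpace ℝ (Fin n) →L[ℝ] EuclideanSpace ℝ (Fin n)}
    (hF : IsFrame (metricForm g p y) F)
    (B : EuclideanSpace ℝ (Fin n) →L[ℝ] EuclideanSpace ℝ (Fin n) →L[ℝ] ℝ) :
    gTrace g p y B = ∑ a, B (F (EuclideanSpace.single a 1)) (F (EuclideanSpace.single a 1)) :=
  hF.sum_eq_sum_inv B.toLinearMap₁₂ (metricForm_symm g p y)

/-- The Ricci curvature as a sum over a frame. -/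
theorem IsFrame.sum_curvature {p : M} {y : EuclideanSpace ℝ (Fin n)}
    (hy : y ∈ (extChartAt (𝓡∂ n) p).target)
    {F : EuclideanSpace ℝ (Fin n) →L[ℝ] EuclideanSpace ℝ (Fin n)}
    (hF : IsFrame (metricForm g p y) F) (v : EuclideanSpace ℝ (Fin n)) :
    ∑ a, metricForm g p y (F (EuclideanSpace.single a 1))
      (curvature g p y (F (EuclideanSpace.single a 1)) v v) =
    ∑ j, ∑ k, ricciCoord g p j k y * v j * v k := by
  rw [sum_ricciCoord g p hy]
  let L : EuclideanSpace ℝ (Fin n) →ₗ[ℝ] EuclideanSpace ℝ (Fin n) :=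
    { toFun := fun x => curvature g p y x v v
      map_add' := fun a b => by simp [curvature]; abel
      map_smul' := fun c a => by simp [curvature, smul_sub, smul_add] }
  exact hF.sum_apply_apply L

/-- The gradient of a function with differential `d`, in coordinates. -/
def gradVec (g : Metric n M) (p : M) (y : EuclideanSpace ℝ (Fin n))
    (d : EuclideanSpace ℝ (Fin n) →L[ℝ] ℝ) : EuclideanSpace ℝ (Fin n) :=
  ∑ i, ∑ j, (gramInv g p y i j * d (EuclideanSpace.single j 1)) • EuclideanSpace.single i 1

theorem IsFrame.gradVec_eq {p : M} {y : EuclideanSpace ℝ (Fin n)}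
    {F : EuclideanSpace ℝ (Fin n) →L[ℝ] EuclideanSpace ℝ (Fin n)}
    (hF : IsFrame (metricForm g p y) F) (d : EuclideanSpace ℝ (Fin n) →L[ℝ] ℝ) :
    gradVec g p y d = ∑ a, d (F (EuclideanSpace.single a 1)) • F (EuclideanSpace.single a 1) := by
  ext k
  have h := hF.gTrace_eq ((EuclideanSpace.proj k : EuclideanSpace ℝ (Fin n) →L[ℝ] ℝ).smulRight d)
  simp only [gTrace, ContinuousLinearMap.smulRight_apply, smul_apply, smul_eq_mul,
    PiLp.proj_apply] at h
  simp only [gradVec, WithLp.ofLp_sum, WithLp.ofLp_smul, Finset.sum_apply, Pi.smul_apply, smul_eq_mul]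
  rw [Finset.sum_congr rfl fun a _ => mul_comm (d _) _, ← h]
  refine Finset.sum_congr rfl fun i _ => Finset.sum_congr rfl fun j _ => by ring

theorem metricForm_gradVec {p : M} {y : EuclideanSpace ℝ (Fin n)}
    (hy : y ∈ (extChartAt (𝓡∂ n) p).target) (d : EuclideanSpace ℝ (Fin n) →L[ℝ] ℝ)
    (z : EuclideanSpace ℝ (Fin n)) : metricForm g p y (gradVec g p y d) z = d z := by
  obtain ⟨F, hF⟩ := exists_isFrame g p hy
  rw [hF.gradVec_eq]
  simp only [map_sum, map_smul, sum_apply, smul_apply, smul_eq_mul]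
  rw [← hF.sum_mul_apply d z]
  exact Finset.sum_congr rfl fun a _ => mul_comm _ _

end Trace

/-! ### Local solutions of a linear differential equation up to a right endpoint. -/

section LinearODE

open scoped NNReal

/-- Picard-Lindelöf on an interval cut off at T: the coefficients need only be defined to the left
of T, and at T itself the equation holds with a one-sided derivative. -/
theorem exists_hasDerivWithinAt_eq_mul {𝓐 : Type*} [NormedRing 𝓐] [NormedSpace ℝ 𝓐]
    [CompleteSpace 𝓐] {T s : ℝ} (hs : s ≤ T) {L : ℝ → 𝓐}
    (hL : ∀ᶠ t in 𝓝[Iic T] s, ContinuousWithinAt L (Iic T) t) (x₀ : 𝓐) :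
    ∃ F : ℝ → 𝓐, F s = x₀ ∧ ∃ δ > 0, ∀ t ≤ T, |t - s| < δ →
      HasDerivWithinAt F (L t * F t) (Iic T) t := by
  have hLs : ContinuousWithinAt L (Iic T) s := hL.self_of_nhdsWithin hs
  have hb : ∀ᶠ t in 𝓝[Iic T] s, ‖L t‖ < ‖L s‖ + 1 :=
    hLs.norm.eventually (gt_mem_nhds (by linarith))
  obtain ⟨δ₁, hδ₁, hball⟩ := Metric.mem_nhdsWithin_iff.1 (hL.and hb)
  set K : ℝ := ‖L s‖ + 1 with hK
  have hK0 : 0 < K := by positivity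
  -- A bound for the vector field on the unit ball around x₀; times up to 1/C keep the solution in
  -- that ball.
  set C : ℝ := K * (‖x₀‖ + 1) with hC
  have hC0 : 0 < C := by positivity
  set d : ℝ := min (δ₁ / 2) (1 / C) with hd
  have hd0 : 0 < d := by positivity
  have hd1 : d ≤ δ₁ / 2 := min_le_left _ _
  have hd2 : C * d ≤ 1 := by
    have : d ≤ 1 / C := min_le_right _ _
    rw [le_div_iff₀ hC0] at this
    linarith
  set tmax := min T (s + d) with htmax
  have hsm : s ≤ tmax := le_min hs (by linarith)
  have hmem : ∀ t ∈ Icc (s - d) tmax, ContinuousWithinAt L (Iic T) t ∧ ‖L t‖ < K := by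
    intro t ht
    have h1 := ht.2.trans (min_le_right _ _)
    refine hball ⟨?_, ht.2.trans (min_le_left _ _)⟩
    rw [Metric.mem_ball, Real.dist_eq, abs_lt]
    constructor <;> linarith [ht.1]
  have hPL : IsPicardLindelof (fun t x => L t * x) (tmin := s - d) (tmax := tmax)
      ⟨s, by linarith, hsm⟩ x₀ 1 0 C.toNNReal K.toNNReal := by
    refine ⟨fun t ht => ?_, fun x _ t ht => ?_, fun t ht x hx => ?_, ?_⟩
    · refine LipschitzWith.lipschitzOnWith (LipschitzWith.of_dist_le_mul fun x y => ?_)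
      rw [dist_eq_norm, dist_eq_norm, ← mul_sub, Real.coe_toNNReal _ hK0.le]
      exact (norm_mul_le _ _).trans (mul_le_mul_of_nonneg_right (hmem t ht).2.le (norm_nonneg _))
    · exact ((hmem t ht).1.mono fun r hr => hr.2.trans (min_le_left _ _)).mul continuousWithinAt_const
    · rw [Real.coe_toNNReal _ hC0.le]
      refine (norm_mul_le _ _).trans (mul_le_mul (hmem t ht).2.le ?_ (norm_nonneg _) hK0.le)
      have h1 : ‖x - x₀‖ ≤ 1 := by simpa [dist_eq_norm] using hx
      have h2 := norm_add_le x₀ (x - x₀)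
      rw [add_sub_cancel] at h2
      linarith
    · rw [Real.coe_toNNReal _ hC0.le]
      simp only [NNReal.coe_one, NNReal.coe_zero, sub_zero]
      refine le_trans (mul_le_mul_of_nonneg_left (max_le ?_ ?_) hC0.le) hd2
      · have := min_le_right T (s + d)
        linarith
      · linarith
  obtain ⟨F, hF0, hF⟩ := hPL.exists_eq_forall_mem_Icc_hasDerivWithinAt₀
  refine ⟨F, hF0, d, hd0, fun t ht hts => ?_⟩
  rw [abs_lt] at hts
  have h1 : t ∈ Icc (s - d) tmax := ⟨by linarith, le_min ht (by linarith)⟩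
  refine (hF t h1).mono_of_mem_nhdsWithin ?_
  filter_upwards [self_mem_nhdsWithin, mem_nhdsWithin_of_mem_nhds
    (Ioo_mem_nhds (show s - d < t by linarith) (show t < s + d by linarith))] with r hr1 hr2
  exact ⟨hr2.1.le, le_min hr1 hr2.2.le⟩

end LinearODE

/-! ### Orthonormal frames transported along the curve with a rotation. -/

section MovingFrame

variable {n : ℕ} [NeZero n] {M : Type*} [TopologicalSpace M]
  [ChartedSpace (EuclideanHalfSpace n) M] [IsManifold (𝓡∂ n) ∞ M]

/-- The logarithmic derivative of the weight `u ^ α` in coordinates. -/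
def logDeriv (n : ℕ) [NeZero n] {M : Type*} [TopologicalSpace M]
    [ChartedSpace (EuclideanHalfSpace n) M] (u : M → ℝ) (α : ℝ) (p : M)
    (y : EuclideanSpace ℝ (Fin n)) : EuclideanSpace ℝ (Fin n) →L[ℝ] ℝ :=
  (chartWeight n u α p y)⁻¹ • fderivWithin ℝ (chartWeight n u α p) (range (𝓡∂ n)) y

/-- The rotation that carries a parallel frame into a frame that moves with a geodesic of the
conformal metric. -/
def rotation (g : Metric n M) (u : M → ℝ) (α : ℝ) (p : M) (y v : EuclideanSpace ℝ (Fin n)) :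
    EuclideanSpace ℝ (Fin n) →L[ℝ] EuclideanSpace ℝ (Fin n) :=
  (metricForm g p y v).smulRight (gradVec g p y (logDeriv n u α p y)) -
    (logDeriv n u α p y).smulRight v

theorem rotation_apply (g : Metric n M) (u : M → ℝ) (α : ℝ) (p : M)
    (y v z : EuclideanSpace ℝ (Fin n)) :
    rotation g u α p y v z = metricForm g p y v z • gradVec g p y (logDeriv n u α p y) -
      logDeriv n u α p y z • v := by
  simp [rotation]

/-- The right side is antisymmetric in z and w: the rotation is an infinitesimal isometry. At v
itself it equals ∇l - l(v)v, which is the covariant acceleration of a geodesic of W²g parametrized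
by g-length. -/
theorem metricForm_rotation (g : Metric n M) (u : M → ℝ) (α : ℝ) {p : M}
    {y : EuclideanSpace ℝ (Fin n)} (hy : y ∈ (extChartAt (𝓡∂ n) p).target)
    (v z w : EuclideanSpace ℝ (Fin n)) :
    metricForm g p y (rotation g u α p y v z) w = metricForm g p y v z * logDeriv n u α p y w -
      logDeriv n u α p y z * metricForm g p y v w := by
  rw [rotation_apply]
  simp only [map_sub, map_smul, sub_apply, smul_apply, smul_eq_mul, metricForm_gradVec hy]

variable {g : Metric n M} {u : M → ℝ} {α : ℝ} {β : ℝ → M} {T : ℝ} {p : M}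

/-- The coefficients of the equation of a moving frame along the curve. -/
def frameCoeff (g : Metric n M) (u : M → ℝ) (α : ℝ) (β : ℝ → M) (T : ℝ) (p : M) (t : ℝ) :
    EuclideanSpace ℝ (Fin n) →L[ℝ] EuclideanSpace ℝ (Fin n) :=
  rotation g u α p (coord n β p t) (vel n β T p t) -
    christoffelMap g p (coord n β p t) (vel n β T p t)

section

variable (hβ : MinCurve g u α β T) (hu : ContMDiff (𝓡∂ n) 𝓘(ℝ, ℝ) 2 u) (hupos : ∀ x, 0 < u x)
include hβ hu hupos

namespace MinCurve

theorem continuousWithinAt_frameCoeff {s : ℝ} (hs : s ≤ T)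
    (hp : β s ∈ (extChartAt (𝓡∂ n) p).source) :
    ContinuousWithinAt (frameCoeff g u α β T p) (Iic T) s := by
  have hy := coord_mem_target hp
  have hc := hβ.continuousWithinAt_coord hs hp
  have hmaps : MapsTo (coord n β p) (Iic T) (range (𝓡∂ n)) := fun t _ => coord_mem_range t
  have hv := hβ.continuousWithinAt_vel hs hp
  have h1 : ContinuousWithinAt (fun t => fderivWithin ℝ (chartWeight n u α p) (range (𝓡∂ n))
      (coord n β p t)) (Iic T) s :=
    ((contDiffWithinAt_chartWeight hu hupos p hy).fderivWithin_right (m := 1) uniqueDiffOn_range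
      (by norm_num) (coord_mem_range s)).continuousWithinAt.comp hc hmaps
  have hd : ContinuousWithinAt (fun t => logDeriv n u α p (coord n β p t)) (Iic T) s :=
    ((hβ.continuousWithinAt_chartWeight hu hupos hs hp).inv₀ (chartWeight_pos hupos _).ne').smul h1
  have hg : ContinuousWithinAt (fun t => gradVec g p (coord n β p t)
      (logDeriv n u α p (coord n β p t))) (Iic T) s := by
    unfold gradVec
    refine tendsto_finsetSum _ fun i _ => tendsto_finsetSum _ fun j _ => ?_
    refine ContinuousWithinAt.smul (ContinuousWithinAt.mul ?_ (hd.clm_apply continuousWithinAt_const))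
      continuousWithinAt_const
    exact (contDiffWithinAt_gramInv g p hy i j).continuousWithinAt.comp hc hmaps
  have hsr : ∀ {c : ℝ → EuclideanSpace ℝ (Fin n) →L[ℝ] ℝ} {f : ℝ → EuclideanSpace ℝ (Fin n)},
      ContinuousWithinAt c (Iic T) s → ContinuousWithinAt f (Iic T) s →
      ContinuousWithinAt (fun t => (c t).smulRight (f t)) (Iic T) s := by
    intro c f hc hf
    exact ((ContinuousLinearMap.smulRightL ℝ (EuclideanSpace ℝ (Fin n))
      (EuclideanSpace ℝ (Fin n))).continuous.continuousAt.comp_continuousWithinAt hc).clm_apply hf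
  refine ((hsr ((hβ.continuousWithinAt_metricForm hs hp).clm_apply hv) hg).sub (hsr hd hv)).sub ?_
  exact ((contDiffWithinAt_christoffelMap g p hy).continuousWithinAt.comp hc hmaps).clm_apply hv

/-- The Christoffel terms cancel by metric compatibility and the rotation terms by skewness, so the
transport preserves orthonormality. -/
theorem hasDerivWithinAt_metricForm_frame {s : ℝ} (hs : s ≤ T)
    (hp : β s ∈ (extChartAt (𝓡∂ n) p).source)
    {F : ℝ → EuclideanSpace ℝ (Fin n) →L[ℝ] EuclideanSpace ℝ (Fin n)}
    (hF : HasDerivWithinAt F (frameCoeff g u α β T p s ∘L F s) (Iic T) s)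
    (z w : EuclideanSpace ℝ (Fin n)) :
    HasDerivWithinAt (fun t => metricForm g p (coord n β p t) (F t z) (F t w)) 0 (Iic T) s := by
  have hy := coord_mem_target hp
  have hG := (differentiableWithinAt_metricForm g p hy).hasFDerivWithinAt.comp_hasDerivWithinAt s
    (hβ.hasDerivWithinAt_coord hs hp) fun t _ => coord_mem_range t
  have hFz : ∀ z, HasDerivWithinAt (fun t => F t z) (frameCoeff g u α β T p s (F s z)) (Iic T) s :=
    fun z => by simpa using hF.clm_apply (hasDerivWithinAt_const s (Iic T) z)
  refine ((hG.clm_apply (hFz z)).clm_apply (hFz w)).congr_deriv ?_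
  simp only [Function.comp, add_apply]
  rw [fderivWithin_metricForm_eq g p hy]
  simp only [frameCoeff, sub_apply, map_sub]
  rw [metricForm_symm g p _ (F s z) (rotation g u α p _ _ (F s w)), metricForm_rotation g u α hy,
    metricForm_rotation g u α hy]
  ring

/-- The moving frame. -/
theorem exists_frame {s : ℝ} (hs : s ≤ T) (hp : β s ∈ (extChartAt (𝓡∂ n) p).source) :
    ∃ F : ℝ → EuclideanSpace ℝ (Fin n) →L[ℝ] EuclideanSpace ℝ (Fin n), ∃ δ > 0, ∀ t ≤ T,
      |t - s| < δ → β t ∈ (extChartAt (𝓡∂ n) p).source ∧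
      IsFrame (metricForm g p (coord n β p t)) (F t) ∧
      HasDerivWithinAt F (frameCoeff g u α β T p t ∘L F t) (Iic T) t := by
  obtain ⟨F₀, hF₀⟩ := exists_isFrame g p (coord_mem_target hp)
  have hev := hβ.eventually_mem_source hs hp
  obtain ⟨F, hFs, δ₁, hδ₁, hF⟩ := exists_hasDerivWithinAt_eq_mul hs
    (L := frameCoeff g u α β T p) (by
      filter_upwards [hev, self_mem_nhdsWithin] with t ht ht'
      exact hβ.continuousWithinAt_frameCoeff hu hupos ht' ht) F₀
  obtain ⟨δ₂, hδ₂, hsrc⟩ := Metric.mem_nhdsWithin_iff.1 hev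
  have hsrc' : ∀ t ≤ T, |t - s| < min δ₁ δ₂ → β t ∈ (extChartAt (𝓡∂ n) p).source :=
    fun t ht hts => hsrc ⟨by
      rw [Metric.mem_ball, Real.dist_eq]; exact hts.trans_le (min_le_right _ _), ht⟩
  refine ⟨F, min δ₁ δ₂, by positivity, fun t ht hts => ⟨hsrc' t ht hts, fun z w => ?_,
    hF t ht (hts.trans_le (min_le_left _ _))⟩⟩
  have hconv : Convex ℝ (Iic T ∩ Metric.ball s (min δ₁ δ₂)) := (convex_Iic T).inter (convex_ball _ _)
  have h := hconv.norm_image_sub_le_of_norm_hasDerivWithin_le (C := 0)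
    (f := fun t => metricForm g p (coord n β p t) (F t z) (F t w)) (f' := fun _ => 0)
    (x := s) (y := t) (fun r hr => ?_) (by simp) ⟨hs, Metric.mem_ball_self (by positivity)⟩
    ⟨ht, by rwa [Metric.mem_ball, Real.dist_eq]⟩
  · rw [zero_mul, norm_le_zero_iff, sub_eq_zero] at h
    rw [h, hFs, hF₀]
  · have hr2 : |r - s| < min δ₁ δ₂ := by simpa [Real.dist_eq] using hr.2
    exact (hβ.hasDerivWithinAt_metricForm_frame hu hupos hr.1 (hsrc' r hr.1 hr2)
      (hF r hr.1 (hr2.trans_le (min_le_left _ _))) z w).mono inter_subset_left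

end MinCurve

end

end MovingFrame

/-! ### The second variation in covariant form and its sum over a frame. -/

section SecondVariation

variable {n : ℕ} [NeZero n] {M : Type*} [TopologicalSpace M]
  [ChartedSpace (EuclideanHalfSpace n) M] [IsManifold (𝓡∂ n) ∞ M] {g : Metric n M}

theorem fderivWithin_christoffelMap_symm {p : M} {y : EuclideanSpace ℝ (Fin n)}
    (hy : y ∈ (extChartAt (𝓡∂ n) p).target) (a b c : EuclideanSpace ℝ (Fin n)) :
    fderivWithin ℝ (christoffelMap g p) (range (𝓡∂ n)) y a b c =
      fderivWithin ℝ (christoffelMap g p) (range (𝓡∂ n)) y a c b := by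
  have hyS := extChartAt_target_subset_range p hy
  have hΓ := ((contDiffWithinAt_christoffelMap g p hy).differentiableWithinAt
    (by simp)).hasFDerivWithinAt
  have h : ∀ b c, HasFDerivWithinAt (fun z => christoffelMap g p z b c) _ (range (𝓡∂ n)) y :=
    fun b c => (hΓ.clm_apply (hasFDerivWithinAt_const b y _)).clm_apply
      (hasFDerivWithinAt_const c y _)
  have h2 := (h c b).congr_of_eventuallyEq (f₁ := fun z => christoffelMap g p z b c) (by
    filter_upwards [extChartAt_target_mem_nhdsWithin_of_mem hy] with z hz
    exact christoffelMap_symm g p hz b c) (christoffelMap_symm g p hy b c)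
  simpa using DFunLike.congr_fun ((uniqueDiffOn_range y hyS).eq (h b c) h2) a

/-- The second variation of the Lagrangian, corrected by the derivative of `W G (v, Γ(ξ, ξ))`, is
expressed through covariant derivatives. -/
theorem lagrangian_hess_sub {W : EuclideanSpace ℝ (Fin n) → ℝ} {p : M}
    {y : EuclideanSpace ℝ (Fin n)} (hy : y ∈ (extChartAt (𝓡∂ n) p).target)
    (hW : ContDiffWithinAt ℝ 2 W (range (𝓡∂ n)) y) {v : EuclideanSpace ℝ (Fin n)}
    (hv : metricForm g p y v v = 1) {ξ η ζ : EuclideanSpace ℝ (Fin n)}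
    (hζ : ζ = η - christoffelMap g p y v ξ) :
    fderivWithin ℝ (fderivWithin ℝ (lagrangian W (metricForm g p)) (range (𝓡∂ n) ×ˢ univ))
        (range (𝓡∂ n) ×ˢ univ) (y, v) (ξ, ζ) (ξ, ζ)
      - (fderivWithin ℝ W (range (𝓡∂ n)) y (christoffelMap g p y ξ ξ)
        + W y / 2 * fderivWithin ℝ (metricForm g p) (range (𝓡∂ n)) y (christoffelMap g p y ξ ξ) v v
        + W y * metricForm g p y v (fderivWithin ℝ (christoffelMap g p) (range (𝓡∂ n)) y v ξ ξ)
        + 2 * (W y * metricForm g p y v (christoffelMap g p y ζ ξ))) =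
    fderivWithin ℝ (fderivWithin ℝ W (range (𝓡∂ n))) (range (𝓡∂ n)) y ξ ξ
      - fderivWithin ℝ W (range (𝓡∂ n)) y (christoffelMap g p y ξ ξ)
      + 2 * fderivWithin ℝ W (range (𝓡∂ n)) y ξ * metricForm g p y v η
      + W y * (metricForm g p y η η - metricForm g p y v η ^ 2)
      - W y * metricForm g p y ξ (curvature g p y ξ v v) := by
  have hyS := extChartAt_target_subset_range p hy
  have hG := (contDiffWithinAt_metricForm g p hy).of_le (show (2 : ℕ∞ω) ≤ ∞ from ENat.LEInfty.out)
  have hGc : ContinuousWithinAt (fun z : EuclideanSpace ℝ (Fin n) × EuclideanSpace ℝ (Fin n) =>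
      metricForm g p z.1 z.2 z.2) (range (𝓡∂ n) ×ˢ univ) (y, v) := by
    have h1 : ContinuousWithinAt (fun z : EuclideanSpace ℝ (Fin n) × EuclideanSpace ℝ (Fin n) =>
        metricForm g p z.1) (range (𝓡∂ n) ×ˢ univ) (y, v) :=
      ContinuousWithinAt.comp (f := fun z : EuclideanSpace ℝ (Fin n) × EuclideanSpace ℝ (Fin n) => z.1)
        (t := range (𝓡∂ n)) (x := (y, v)) hG.continuousWithinAt continuousWithinAt_fst fun z hz => hz.1
    exact (h1.clm_apply continuousWithinAt_snd).clm_apply continuousWithinAt_snd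
  have hh := fderivWithin_fderivWithin_lagrangian (W := W) (G := metricForm g p) (y := (y, v))
    uniqueDiffOn_range hyS hW hG (metricForm_symm g p) (fun a b c => fderivWithin_metricForm_symm g p hy b c a) hv
    (hGc.eventually (lt_mem_nhds (by simp only [hv]; norm_num))) ξ ζ
  set G := metricForm g p y with hGdef
  have sG : ∀ a b, G a b = G b a := metricForm_symm g p y
  set Γ := christoffelMap g p y with hΓdef
  have sΓ : ∀ a b, Γ a b = Γ b a := christoffelMap_symm g p hy
  have e1 := fderivWithin_metricForm_eq g p hy ξ v v
  have e2 := fderivWithin_metricForm_eq g p hy ξ v ζ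
  have e3 := fderivWithin_fderivWithin_metricForm g p hy ξ ξ v v
  have e3' := fderivWithin_metricForm_eq g p hy ξ (Γ ξ v) v
  have e3'' := fderivWithin_metricForm_eq g p hy ξ v (Γ ξ v)
  have e4 := fderivWithin_metricForm_eq g p hy (Γ ξ ξ) v v
  -- The Hessian produces the curvature in the form g(v, R(ξ, v)ξ); skewness turns it into -g(ξ,
  -- R(ξ, v)v), whose sum over a frame is minus the Ricci curvature.
  have e5 := metricForm_curvature g p hy ξ v ξ v
  have e6 : curvature g p y ξ v ξ = fderivWithin ℝ (christoffelMap g p) (range (𝓡∂ n)) y ξ v ξ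
    - fderivWithin ℝ (christoffelMap g p) (range (𝓡∂ n)) y v ξ ξ + Γ ξ (Γ v ξ) - Γ v (Γ ξ ξ) := rfl
  rw [e6, fderivWithin_christoffelMap_symm hy ξ v ξ] at e5
  simp only [← hGdef, ← hΓdef] at e1 e2 e3 e3' e3'' e4 e5 hh
  rw [sΓ (Γ ξ ξ) v, sG _ v] at e4
  rw [sΓ ξ v] at e1 e2 e3 e3' e3''
  rw [sG _ v] at e1
  rw [sG (Γ ξ (Γ v ξ)) v] at e3'
  rw [sG (fderivWithin ℝ (christoffelMap g p) (range (𝓡∂ n)) y ξ ξ v) v, e3', e3''] at e3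
  have e7 : G v ζ = G v η - G v (Γ v ξ) := by rw [hζ, map_sub]
  have e8 : G (Γ v ξ) ζ = G η (Γ v ξ) - G (Γ v ξ) (Γ v ξ) := by rw [hζ, map_sub, sG _ η]
  have e9 : G ζ ζ = G η η - 2 * G η (Γ v ξ) + G (Γ v ξ) (Γ v ξ) := by
    simp only [hζ, map_sub, sub_apply]
    rw [sG (Γ v ξ) η]
    ring
  rw [sΓ ζ ξ, hh, e1, e2, e3, e4, e7, e8, e9]
  simp only [map_sub, map_add] at e5
  linear_combination W y * e5

/-- The bilinear form `P (Γ(a, b))`. -/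
def christoffelForm (g : Metric n M) (p : M) (y : EuclideanSpace ℝ (Fin n))
    (P : EuclideanSpace ℝ (Fin n) →L[ℝ] ℝ) :
    EuclideanSpace ℝ (Fin n) →L[ℝ] EuclideanSpace ℝ (Fin n) →L[ℝ] ℝ :=
  (ContinuousLinearMap.compL ℝ (EuclideanSpace ℝ (Fin n)) (EuclideanSpace ℝ (Fin n)) ℝ P) ∘L
    christoffelMap g p y

theorem christoffelForm_apply (p : M) (y : EuclideanSpace ℝ (Fin n))
    (P : EuclideanSpace ℝ (Fin n) →L[ℝ] ℝ) (a b : EuclideanSpace ℝ (Fin n)) :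
    christoffelForm g p y P a b = P (christoffelMap g p y a b) := rfl

/-- The covariant Hessian of a function in coordinates. -/
def covHess (g : Metric n M) (p : M) (W : EuclideanSpace ℝ (Fin n) → ℝ)
    (y : EuclideanSpace ℝ (Fin n)) :
    EuclideanSpace ℝ (Fin n) →L[ℝ] EuclideanSpace ℝ (Fin n) →L[ℝ] ℝ :=
  fderivWithin ℝ (fderivWithin ℝ W (range (𝓡∂ n))) (range (𝓡∂ n)) y -
    christoffelForm g p y (fderivWithin ℝ W (range (𝓡∂ n)) y)

/-- The quantity whose vanishing characterizes the equality case. -/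
def deficit (g : Metric n M) (u : M → ℝ) (α : ℝ) (p : M) (y v : EuclideanSpace ℝ (Fin n)) : ℝ :=
  ∑ j, ∑ k, ricciCoord g p j k y * v j * v k
    - gTrace g p y (covHess g p (chartWeight n u α p) y) / chartWeight n u α p y
    + logDeriv n u α p y (gradVec g p y (logDeriv n u α p y))
    - (((n : ℝ) - 1) / 4 + (1 / α - ((n : ℝ) - 1) / 4) / 2) * logDeriv n u α p y v ^ 2

/-- The covariant derivative of φf along the curve is φ'f + φΩf, where Ω is the rotation. The whole
frame is used, without splitting off the tangent vector; the tangential direction accounts for n - 1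
instead of n in front of φ'². The rotation is the source of the term -φ²(|l|² - l(v)²), which a
parallel frame would not give and which supplies |l|² in `deficit`. -/
theorem sum_second_variation {u : M → ℝ} {α : ℝ} (hupos : ∀ x, 0 < u x) {p : M}
    {y : EuclideanSpace ℝ (Fin n)} (hy : y ∈ (extChartAt (𝓡∂ n) p).target)
    {v : EuclideanSpace ℝ (Fin n)} (hv : metricForm g p y v v = 1)
    {F : EuclideanSpace ℝ (Fin n) →L[ℝ] EuclideanSpace ℝ (Fin n)}
    (hF : IsFrame (metricForm g p y) F) (φ φ' : ℝ) :
    ∑ a : Fin n, (covHess g p (chartWeight n u α p) y (φ • F (EuclideanSpace.single a 1))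
        (φ • F (EuclideanSpace.single a 1))
      + 2 * fderivWithin ℝ (chartWeight n u α p) (range (𝓡∂ n)) y (φ • F (EuclideanSpace.single a 1))
        * metricForm g p y v (φ' • F (EuclideanSpace.single a 1)
          + φ • rotation g u α p y v (F (EuclideanSpace.single a 1)))
      + chartWeight n u α p y * (metricForm g p y (φ' • F (EuclideanSpace.single a 1)
          + φ • rotation g u α p y v (F (EuclideanSpace.single a 1)))
            (φ' • F (EuclideanSpace.single a 1)
          + φ • rotation g u α p y v (F (EuclideanSpace.single a 1)))
        - metricForm g p y v (φ' • F (EuclideanSpace.single a 1)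
          + φ • rotation g u α p y v (F (EuclideanSpace.single a 1))) ^ 2)
      - chartWeight n u α p y * metricForm g p y (φ • F (EuclideanSpace.single a 1))
        (curvature g p y (φ • F (EuclideanSpace.single a 1)) v v)) =
    φ ^ 2 * gTrace g p y (covHess g p (chartWeight n u α p) y)
      + chartWeight n u α p y * (((n : ℝ) - 1) * φ' ^ 2
        + 2 * φ * φ' * logDeriv n u α p y v
        - φ ^ 2 * (logDeriv n u α p y (gradVec g p y (logDeriv n u α p y))
          - logDeriv n u α p y v ^ 2)
        - φ ^ 2 * ∑ j, ∑ k, ricciCoord g p j k y * v j * v k) := by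
  have sG := metricForm_symm g p y
  set l := logDeriv n u α p y with hl
  set W := chartWeight n u α p y with hW
  have hWpos : 0 < W := chartWeight_pos hupos y
  have hDW : ∀ z, fderivWithin ℝ (chartWeight n u α p) (range (𝓡∂ n)) y z = W * l z := fun z => by
    simp only [hl, logDeriv, smul_apply, smul_eq_mul, ← hW]
    field_simp
  set D := l (gradVec g p y l) with hD
  set δ := l v with hδ
  have hcurv : ∀ z, curvature g p y (φ • z) v v = φ • curvature g p y z v v := fun z => by
    simp only [curvature, map_smul, smul_apply, smul_sub, smul_add]
  rw [hF.gTrace_eq, ← hF.sum_curvature hy]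
  have hm2 : ∑ a, metricForm g p y v (F (EuclideanSpace.single a 1)) *
      metricForm g p y v (F (EuclideanSpace.single a 1)) = 1 := by
    refine Eq.trans ?_ ((hF.sum_mul_apply (metricForm g p y v) v).trans hv)
    exact Finset.sum_congr rfl fun a _ => by rw [sG v]
  have hmd : ∑ a, metricForm g p y v (F (EuclideanSpace.single a 1)) *
      l (F (EuclideanSpace.single a 1)) = δ := by
    rw [hδ, ← hF.sum_mul_apply l v]
    exact Finset.sum_congr rfl fun a _ => by rw [sG v]
  have hd2 : ∑ a, l (F (EuclideanSpace.single a 1)) * l (F (EuclideanSpace.single a 1)) = D := by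
    rw [hD, hF.gradVec_eq, map_sum]
    exact Finset.sum_congr rfl fun a _ => by rw [map_smul, smul_eq_mul]
  have hn : ∑ _a : Fin n, (1 : ℝ) = n := by simp
  rw [← hn]
  have key : ∀ a : Fin n, covHess g p (chartWeight n u α p) y (φ • F (EuclideanSpace.single a 1))
        (φ • F (EuclideanSpace.single a 1))
      + 2 * fderivWithin ℝ (chartWeight n u α p) (range (𝓡∂ n)) y (φ • F (EuclideanSpace.single a 1))
        * metricForm g p y v (φ' • F (EuclideanSpace.single a 1)
          + φ • rotation g u α p y v (F (EuclideanSpace.single a 1)))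
      + W * (metricForm g p y (φ' • F (EuclideanSpace.single a 1)
          + φ • rotation g u α p y v (F (EuclideanSpace.single a 1)))
            (φ' • F (EuclideanSpace.single a 1)
          + φ • rotation g u α p y v (F (EuclideanSpace.single a 1)))
        - metricForm g p y v (φ' • F (EuclideanSpace.single a 1)
          + φ • rotation g u α p y v (F (EuclideanSpace.single a 1))) ^ 2)
      - W * metricForm g p y (φ • F (EuclideanSpace.single a 1))
        (curvature g p y (φ • F (EuclideanSpace.single a 1)) v v) =
      φ ^ 2 * covHess g p (chartWeight n u α p) y (F (EuclideanSpace.single a 1))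
        (F (EuclideanSpace.single a 1)) + W * φ' ^ 2 * 1
      + W * (φ ^ 2 * D - φ' ^ 2 - 2 * φ * φ' * δ - φ ^ 2 * δ ^ 2) *
        (metricForm g p y v (F (EuclideanSpace.single a 1)) *
          metricForm g p y v (F (EuclideanSpace.single a 1)))
      + W * (4 * φ * φ' + 2 * φ ^ 2 * δ) * (metricForm g p y v (F (EuclideanSpace.single a 1)) *
          l (F (EuclideanSpace.single a 1)))
      - W * (2 * φ ^ 2) * (l (F (EuclideanSpace.single a 1)) * l (F (EuclideanSpace.single a 1)))
      - W * φ ^ 2 * metricForm g p y (F (EuclideanSpace.single a 1))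
        (curvature g p y (F (EuclideanSpace.single a 1)) v v) := by
    intro a
    set f := F (EuclideanSpace.single a 1) with hf
    have hff : metricForm g p y f f = 1 := hF.apply_self a
    set Ωf := rotation g u α p y v f with hΩ
    have r1 : metricForm g p y v Ωf = metricForm g p y v f * δ - l f := by
      rw [sG, hΩ, metricForm_rotation g u α hy, hv, mul_one]
    have r2 : metricForm g p y f Ωf = 0 := by
      rw [sG, hΩ, metricForm_rotation g u α hy]
      ring
    have r3 : metricForm g p y Ωf Ωf = metricForm g p y v f * (metricForm g p y v f * D - l f * δ)
        - l f * (metricForm g p y v f * δ - l f) := by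
      nth_rewrite 1 [hΩ]
      rw [metricForm_rotation g u α hy, r1, hΩ, rotation_apply, map_sub, map_smul, map_smul]
      simp only [smul_eq_mul, ← hl, ← hD, ← hδ]
    rw [hcurv, hDW]
    simp only [map_smul, map_add, add_apply, smul_apply, smul_eq_mul, hff, r1, r2, sG Ωf f, r3]
    ring
  rw [Finset.sum_congr rfl fun a _ => key a]
  simp only [Finset.sum_sub_distrib, Finset.sum_add_distrib, ← Finset.mul_sum, hm2, hmd, hd2]
  ring

/-- With φ = ψr and r = W^(-1/2) one has φ' = (ψ' - l(v)ψ/2)r. The expansion leaves ((n-1)/4)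
l(v)²ψ² and the cross term -(n-3) l(v)ψψ'. With c = 1/α - (n-1)/4, Young's inequality spends (c/2)
l(v)²ψ² on the cross term, half of the room in the condition on α; the other half is kept for the
rigidity statement. -/
theorem second_variation_le {u : M → ℝ} {α : ℝ} (hupos : ∀ x, 0 < u x)
    (hα' : ((n : ℝ) - 1) / 4 < 1 / α) {p : M} {y v : EuclideanSpace ℝ (Fin n)} (ψ ψ' : ℝ) {r : ℝ}
    (hr : r ^ 2 * chartWeight n u α p y = 1) :
    (ψ * r) ^ 2 * gTrace g p y (covHess g p (chartWeight n u α p) y)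
      + chartWeight n u α p y * (((n : ℝ) - 1) * ((ψ' - logDeriv n u α p y v / 2 * ψ) * r) ^ 2
        + 2 * (ψ * r) * ((ψ' - logDeriv n u α p y v / 2 * ψ) * r) * logDeriv n u α p y v
        - (ψ * r) ^ 2 * (logDeriv n u α p y (gradVec g p y (logDeriv n u α p y))
          - logDeriv n u α p y v ^ 2)
        - (ψ * r) ^ 2 * ∑ j, ∑ k, ricciCoord g p j k y * v j * v k) ≤
    (((n : ℝ) - 1) + ((n : ℝ) - 3) ^ 2 / (2 * (1 / α - ((n : ℝ) - 1) / 4))) * ψ' ^ 2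
      - deficit g u α p y v * ψ ^ 2 := by
  have hW := chartWeight_pos (n := n) (p := p) (α := α) hupos y
  rw [deficit]
  set W := chartWeight n u α p y
  set δ := logDeriv n u α p y v
  set D := logDeriv n u α p y (gradVec g p y (logDeriv n u α p y))
  set R := ∑ j, ∑ k, ricciCoord g p j k y * v j * v k
  set L := gTrace g p y (covHess g p (chartWeight n u α p) y)
  have hL : L / W = r ^ 2 * L := by
    rw [div_eq_iff hW.ne']
    linear_combination (-L) * hr
  rw [hL]
  set c := 1 / α - ((n : ℝ) - 1) / 4 with hc
  have hc0 : 0 < c := by linarith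
  have e : (((n : ℝ) - 3) ^ 2 / (2 * c)) * ψ' ^ 2 + ((n : ℝ) - 3) * δ * ψ * ψ' + c / 2 * δ ^ 2 * ψ ^ 2
      = (((n : ℝ) - 3) * ψ' + c * δ * ψ) ^ 2 / (2 * c) := by
    field_simp
    ring
  have e2 : 0 ≤ (((n : ℝ) - 3) * ψ' + c * δ * ψ) ^ 2 / (2 * c) := by positivity
  rw [← e] at e2
  have e3 : (ψ * r) ^ 2 * L + W * (((n : ℝ) - 1) * ((ψ' - δ / 2 * ψ) * r) ^ 2
        + 2 * (ψ * r) * ((ψ' - δ / 2 * ψ) * r) * δ - (ψ * r) ^ 2 * (D - δ ^ 2) - (ψ * r) ^ 2 * R) =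
      ψ ^ 2 * (r ^ 2 * L) + (((n : ℝ) - 1) * (ψ' - δ / 2 * ψ) ^ 2
        + 2 * ψ * (ψ' - δ / 2 * ψ) * δ - ψ ^ 2 * (D - δ ^ 2) - ψ ^ 2 * R) := by
    linear_combination (((n : ℝ) - 1) * (ψ' - δ / 2 * ψ) ^ 2
        + 2 * ψ * (ψ' - δ / 2 * ψ) * δ - ψ ^ 2 * (D - δ ^ 2) - ψ ^ 2 * R) * hr
  rw [e3]
  linarith

end SecondVariation

/-! ### Construction of the variation fields. -/

section VariationField

variable {n : ℕ} [NeZero n] {M : Type*} [TopologicalSpace M]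
  [ChartedSpace (EuclideanHalfSpace n) M] [IsManifold (𝓡∂ n) ∞ M]
  {g : Metric n M} {u : M → ℝ} {α : ℝ} {β : ℝ → M} {T : ℝ} {p : M}

/-- The derivative of `P (Γ(ξ, ξ))` along the curve, where `P` is the momentum. -/
def momentumChristoffelDeriv (g : Metric n M) (u : M → ℝ) (α : ℝ) (β : ℝ → M) (T : ℝ) (p : M) (t : ℝ)
    (ξ ξ' : EuclideanSpace ℝ (Fin n)) : ℝ :=
  force g u α β T p t (christoffelMap g p (coord n β p t) ξ ξ)
    + momentum g u α β T p t (fderivWithin ℝ (christoffelMap g p) (range (𝓡∂ n)) (coord n β p t)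
      (vel n β T p t) ξ ξ)
    + 2 * momentum g u α β T p t (christoffelMap g p (coord n β p t) ξ' ξ)

/-- The constant in front of the derivative of the cutoff function in the second variation. -/
def cutoffConst (n : ℕ) (α : ℝ) : ℝ :=
  ((n : ℝ) - 1) + ((n : ℝ) - 3) ^ 2 / (2 * (1 / α - ((n : ℝ) - 1) / 4))

/-- A family of variation fields along the curve with values in the multiples of orthonormal frames,
together with its derivative. -/
structure IsVariationField (g : Metric n M) (u : M → ℝ) (α : ℝ) (β : ℝ → M) (T : ℝ) (p : M) (s : ℝ)
    (ψ : ℝ → ℝ) (k : ℝ) (A A' : ℝ → EuclideanSpace ℝ (Fin n) →L[ℝ] EuclideanSpace ℝ (Fin n))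
    (δ : ℝ) : Prop where
  pos : 0 < δ
  mem_source : ∀ t ≤ T, |t - s| < δ → β t ∈ (extChartAt (𝓡∂ n) p).source
  hasDeriv : ∀ t ≤ T, |t - s| < δ → HasDerivWithinAt A (A' t) (Iic T) t
  cont : ∀ t ≤ T, |t - s| < δ → ContinuousWithinAt A' (Iic T) t
  trace : ∀ t ≤ T, |t - s| < δ → ∀ B : EuclideanSpace ℝ (Fin n) →L[ℝ] EuclideanSpace ℝ (Fin n) →L[ℝ] ℝ,
    chartWeight n u α p (coord n β p t) *
      ∑ a, B (A t (EuclideanSpace.single a 1)) (A t (EuclideanSpace.single a 1)) =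
      ψ t ^ 2 * gTrace g p (coord n β p t) B
  injective : ∀ t ≤ T, |t - s| < δ → ψ t ≠ 0 → Function.Injective (A t)
  eq_zero : ∀ t ≤ T, |t - s| < δ → ψ t = 0 → A t = 0
  second_variation : ∑ a : Fin n, (lagrangianHess g u α p (coord n β p s, vel n β T p s)
      (A s (EuclideanSpace.single a 1), A' s (EuclideanSpace.single a 1))
      (A s (EuclideanSpace.single a 1), A' s (EuclideanSpace.single a 1))
    - momentumChristoffelDeriv g u α β T p s (A s (EuclideanSpace.single a 1))
      (A' s (EuclideanSpace.single a 1))) ≤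
    cutoffConst n α * k ^ 2 - deficit g u α p (coord n β p s) (vel n β T p s) * ψ s ^ 2

section

variable (hβ : MinCurve g u α β T) (hu : ContMDiff (𝓡∂ n) 𝓘(ℝ, ℝ) 2 u) (hupos : ∀ x, 0 < u x)
include hβ hu hupos

namespace MinCurve

theorem hasDerivWithinAt_chartWeight {s : ℝ} (hs : s ≤ T)
    (hp : β s ∈ (extChartAt (𝓡∂ n) p).source) :
    HasDerivWithinAt (fun t => chartWeight n u α p (coord n β p t))
      (chartWeight n u α p (coord n β p s) *
        logDeriv n u α p (coord n β p s) (vel n β T p s)) (Iic T) s := by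
  have h := (((contDiffWithinAt_chartWeight (α := α) hu hupos p
    (coord_mem_target hp)).differentiableWithinAt
    (by simp)).hasFDerivWithinAt.comp_hasDerivWithinAt s (hβ.hasDerivWithinAt_coord hs hp)
    fun t _ => coord_mem_range t)
  refine h.congr_deriv ?_
  simp only [logDeriv, smul_apply, smul_eq_mul]
  rw [mul_inv_cancel_left₀ (chartWeight_pos hupos _).ne']

/-- The field is A = ψ W^(-1/2) F for the moving frame F. The variations are straight lines in the
chart instead of geodesics, so the second derivative of the Lagrangian is not covariant by itself.
Subtracting the derivative of P(Γ(ξ, ξ)), with P the momentum, corrects this through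
`lagrangian_hess_sub`. -/
theorem exists_isVariationField (hα' : ((n : ℝ) - 1) / 4 < 1 / α) {s : ℝ} (hs : s ≤ T)
    (hp : β s ∈ (extChartAt (𝓡∂ n) p).source) {ψ : ℝ → ℝ} {k : ℝ}
    (hψ : ∀ t, HasDerivAt ψ k t) :
    ∃ A A' δ, IsVariationField g u α β T p s ψ k A A' δ := by
  obtain ⟨F, δ, hδ, hF⟩ := hβ.exists_frame hu hupos hs hp
  set W : ℝ → ℝ := fun t => chartWeight n u α p (coord n β p t) with hW
  have hWpos : ∀ t, 0 < W t := fun t => chartWeight_pos hupos _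
  set r : ℝ → ℝ := fun t => (Real.sqrt (W t))⁻¹ with hr
  have hrpos : ∀ t, 0 < r t := fun t => inv_pos.2 (Real.sqrt_pos.2 (hWpos t))
  have hrW : ∀ t, r t ^ 2 * W t = 1 := fun t => by
    have := Real.sq_sqrt (hWpos t).le
    have h0 := (hWpos t).ne'
    simp only [hr, inv_pow, this]
    field_simp
  set l : ℝ → ℝ := fun t => logDeriv n u α p (coord n β p t) (vel n β T p t) with hl
  have hrd : ∀ t ≤ T, |t - s| < δ → HasDerivWithinAt r (-(l t / 2) * r t) (Iic T) t := by
    intro t ht hts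
    have h1 := ((hβ.hasDerivWithinAt_chartWeight hu hupos ht (hF t ht hts).1).sqrt (hWpos t).ne').inv
      (Real.sqrt_pos.2 (hWpos t)).ne'
    refine h1.congr_deriv ?_
    have h2 := Real.sq_sqrt (hWpos t).le
    have h3 := (Real.sqrt_pos.2 (hWpos t)).ne'
    simp only [hr, hl]
    change -(W t * _ / (2 * √(W t))) / √(W t) ^ 2 = _
    nth_rewrite 1 [← h2]
    field_simp
  set A : ℝ → EuclideanSpace ℝ (Fin n) →L[ℝ] EuclideanSpace ℝ (Fin n) :=
    fun t => (ψ t * r t) • F t with hA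
  set A' : ℝ → EuclideanSpace ℝ (Fin n) →L[ℝ] EuclideanSpace ℝ (Fin n) :=
    fun t => (ψ t * r t) • (frameCoeff g u α β T p t ∘L F t) + ((k - l t / 2 * ψ t) * r t) • F t
    with hA'
  have hlc : ∀ t ≤ T, |t - s| < δ → ContinuousWithinAt l (Iic T) t := by
    intro t ht hts
    have hsrc := (hF t ht hts).1
    have hc := hβ.continuousWithinAt_coord ht hsrc
    have h1 : ContinuousWithinAt (fun t => fderivWithin ℝ (chartWeight n u α p) (range (𝓡∂ n))
        (coord n β p t)) (Iic T) t :=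
      ((contDiffWithinAt_chartWeight hu hupos p (coord_mem_target hsrc)).fderivWithin_right (m := 1)
        uniqueDiffOn_range (by norm_num) (coord_mem_range t)).continuousWithinAt.comp hc
        fun t _ => coord_mem_range t
    exact (((hβ.continuousWithinAt_chartWeight hu hupos ht hsrc).inv₀
      (chartWeight_pos hupos _).ne').smul h1).clm_apply (hβ.continuousWithinAt_vel ht hsrc)
  refine ⟨A, A', δ, hδ, fun t ht hts => (hF t ht hts).1, fun t ht hts => ?_, fun t ht hts => ?_,
    fun t ht hts B => ?_, fun t ht hts hne => ?_, fun t ht hts h0 => by simp [hA, h0], ?_⟩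
  · refine (((hψ t).hasDerivWithinAt.mul (hrd t ht hts)).smul (hF t ht hts).2.2).congr_deriv ?_
    simp only [hA']
    congr 2
    ring
  · have c1 : ContinuousWithinAt ψ (Iic T) t := (hψ t).continuousAt.continuousWithinAt
    have c2 := (hrd t ht hts).continuousWithinAt
    have c3 := (hF t ht hts).2.2.continuousWithinAt
    have c4 := hβ.continuousWithinAt_frameCoeff hu hupos ht (hF t ht hts).1
    exact ((c1.mul c2).smul (c4.clm_comp c3)).add
      (((continuousWithinAt_const.sub (((hlc t ht hts).div_const 2).mul c1)).mul c2).smul c3)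
  · rw [(hF t ht hts).2.1.gTrace_eq]
    simp only [hA, smul_apply, map_smul, smul_eq_mul, Finset.mul_sum]
    refine Finset.sum_congr rfl fun a _ => ?_
    linear_combination (ψ t ^ 2 * B (F t (EuclideanSpace.single a 1))
      (F t (EuclideanSpace.single a 1))) * hrW t
  · intro x y hxy
    simp only [hA, smul_apply] at hxy
    exact (hF t ht hts).2.1.injective
      ((smul_right_injective _ (mul_ne_zero hne (hrpos t).ne')) hxy)
  · have hs0 : |s - s| < δ := by simpa using hδ
    have hy := coord_mem_target hp
    have hv := hβ.metricForm_vel hs hp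
    have hFs := (hF s hs hs0).2.1
    have h1 := second_variation_le (g := g) (u := u) (α := α) hupos hα' (p := p)
      (y := coord n β p s) (v := vel n β T p s) (ψ s) k (r := r s) (hrW s)
    rw [← sum_second_variation hupos hy hv hFs] at h1
    refine le_trans (le_of_eq (Finset.sum_congr rfl fun a _ => ?_)) h1
    have h2 := lagrangian_hess_sub (g := g) (W := chartWeight n u α p) hy
      (contDiffWithinAt_chartWeight hu hupos p hy) hv (ξ := A s (EuclideanSpace.single a 1))
      (η := ((k - l s / 2 * ψ s) * r s) • F s (EuclideanSpace.single a 1) + (ψ s * r s) •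
        rotation g u α p (coord n β p s) (vel n β T p s) (F s (EuclideanSpace.single a 1)))
      (ζ := A' s (EuclideanSpace.single a 1)) (by
        simp only [hA', hA, frameCoeff, add_apply, smul_apply, ContinuousLinearMap.comp_apply,
          sub_apply, smul_sub, map_smul]
        abel)
    rw [momentumChristoffelDeriv, force_apply]
    exact h2

end MinCurve

end

end VariationField

/-! ### Increment of the Christoffel correction, and admissibility of the variations at the
boundary. -/

section Step

/-- Mean value inequality for f(t) - t f'(s). Both ends of the time step may vary near s, as the
subdivision argument requires; the lemma is applied to `momentumTrace`. -/
theorem abs_sub_sub_mul_le_of_hasDerivWithinAt {T s δ : ℝ} (hδ : 0 < δ) {f f' : ℝ → ℝ}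
    (hf : ∀ t ≤ T, |t - s| < δ → HasDerivWithinAt f (f' t) (Iic T) t)
    (hf' : ContinuousWithinAt f' (Iic T) s) {ε : ℝ} (hε : 0 < ε) :
    ∃ δ' > 0, ∀ s₁ s₂, s₁ ≤ s₂ → s₂ ≤ T → |s₁ - s| < δ' → |s₂ - s| < δ' →
      |f s₂ - f s₁ - (s₂ - s₁) * f' s| ≤ ε * (s₂ - s₁) := by
  obtain ⟨δ₁, hδ₁, h1⟩ := Metric.continuousWithinAt_iff.1 hf' ε hε
  have hconv : Convex ℝ (Iic T ∩ Metric.ball s (min δ δ₁)) := (convex_Iic T).inter (convex_ball _ _)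
  refine ⟨min δ δ₁, by positivity, fun s₁ s₂ h12 h2 hs1 hs2 => ?_⟩
  have h := hconv.norm_image_sub_le_of_norm_hasDerivWithin_le (C := ε)
    (f := fun t => f t - t * f' s) (f' := fun t => f' t - 1 * f' s)
    (x := s₁) (y := s₂) (fun r hr => ?_) (fun r hr => ?_) ⟨h12.trans h2, by
      rwa [Metric.mem_ball, Real.dist_eq]⟩ ⟨h2, by rwa [Metric.mem_ball, Real.dist_eq]⟩
  · rw [Real.norm_eq_abs, Real.norm_eq_abs, abs_of_nonneg (sub_nonneg.2 h12)] at h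
    convert h using 2
    ring
  · have hr2 : |r - s| < min δ δ₁ := by simpa [Real.dist_eq] using hr.2
    exact ((hf r hr.1 (hr2.trans_le (min_le_left _ _))).sub
      ((hasDerivWithinAt_id r _).mul_const _)).mono inter_subset_left
  · have hr2 : dist r s < δ₁ := (Metric.mem_ball.1 hr.2).trans_le (min_le_right _ _)
    have h3 := (h1 hr.1 hr2).le
    rw [Real.dist_eq] at h3
    rw [Real.norm_eq_abs, one_mul]
    exact h3

variable {n : ℕ} [NeZero n] {M : Type*} [TopologicalSpace M]
  [ChartedSpace (EuclideanHalfSpace n) M] [IsManifold (𝓡∂ n) ∞ M]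
  {g : Metric n M} {u : M → ℝ} {α : ℝ} {β : ℝ → M} {T : ℝ} {p : M}

/-- The sum over a frame of `P (Γ(A e, A e))`. -/
def momentumTrace (g : Metric n M) (u : M → ℝ) (α : ℝ) (β : ℝ → M) (T : ℝ) (p : M)
    (A : ℝ → EuclideanSpace ℝ (Fin n) →L[ℝ] EuclideanSpace ℝ (Fin n)) (t : ℝ) : ℝ :=
  ∑ a : Fin n, momentum g u α β T p t (christoffelMap g p (coord n β p t)
    (A t (EuclideanSpace.single a 1)) (A t (EuclideanSpace.single a 1)))

/-- The Euclidean inner product as a bilinear form. -/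
def euclid (n : ℕ) : EuclideanSpace ℝ (Fin n) →L[ℝ] EuclideanSpace ℝ (Fin n) →L[ℝ] ℝ :=
  ∑ a, (EuclideanSpace.proj a : EuclideanSpace ℝ (Fin n) →L[ℝ] ℝ).smulRight
    (EuclideanSpace.proj a : EuclideanSpace ℝ (Fin n) →L[ℝ] ℝ)

theorem euclid_self (z : EuclideanSpace ℝ (Fin n)) : euclid n z z = ‖z‖ ^ 2 := by
  rw [EuclideanSpace.norm_sq_eq]
  simp [euclid, sum_apply, pow_two]

/-- Points near `β s₁` are reached from `β t₀` with a weighted length that is bounded to second order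
by the quadratic form `B`. -/
def StartIn (g : Metric n M) (u : M → ℝ) (α : ℝ) (β : ℝ → M) (T : ℝ) (p : M) (t₀ s₁ : ℝ)
    (A₁ : EuclideanSpace ℝ (Fin n) →L[ℝ] EuclideanSpace ℝ (Fin n))
    (B : EuclideanSpace ℝ (Fin n) →L[ℝ] EuclideanSpace ℝ (Fin n) →L[ℝ] ℝ) : Prop :=
  ∀ ε > 0, ∀ᶠ z in 𝓝 0, coord n β p s₁ + A₁ z ∈ range (𝓡∂ n) →
    Reach g u α (β t₀) ((extChartAt (𝓡∂ n) p).symm (coord n β p s₁ + A₁ z))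
      ((∫ t in t₀..s₁, u (β t) ^ α) + momentum g u α β T p s₁ (A₁ z) + (1 / 2) * B z z + ε * ‖z‖ ^ 2)

/-- The second variation form of a variation field. -/
def variationForm (g : Metric n M) (u : M → ℝ) (α : ℝ) (β : ℝ → M) (T : ℝ) (p : M) (s : ℝ)
    (A A' : EuclideanSpace ℝ (Fin n) →L[ℝ] EuclideanSpace ℝ (Fin n)) :
    EuclideanSpace ℝ (Fin n) →L[ℝ] EuclideanSpace ℝ (Fin n) →L[ℝ] ℝ :=
  (lagrangianHess g u α p (coord n β p s, vel n β T p s)).bilinearComp (A.prod A') (A.prod A')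

theorem range_eq_setOf : range (𝓡∂ n) = {y : EuclideanSpace ℝ (Fin n) | 0 ≤ y 0} :=
  range_modelWithCornersEuclideanHalfSpace n

theorem abs_apply_self_sub_le {E : Type*} [NormedAddCommGroup E] [NormedSpace ℝ E]
    (H : E →L[ℝ] E →L[ℝ] ℝ) (a b : E) :
    |H a a - H b b| ≤ ‖H‖ * ‖a - b‖ * (‖a‖ + ‖b‖) := by
  have e : H a a - H b b = H (a - b) a + H b (a - b) := by simp
  have h1 := H.le_opNorm₂ (a - b) a
  have h2 := H.le_opNorm₂ b (a - b)
  rw [e]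
  refine (abs_add_le _ _).trans ?_
  rw [Real.norm_eq_abs] at h1 h2
  linarith

section

variable (hβ : MinCurve g u α β T) (hu : ContMDiff (𝓡∂ n) 𝓘(ℝ, ℝ) 2 u) (hupos : ∀ x, 0 < u x)
include hβ hu hupos

namespace MinCurve

theorem hasDerivWithinAt_momentumTrace {s : ℝ} {ψ : ℝ → ℝ} {k δ : ℝ}
    {A A' : ℝ → EuclideanSpace ℝ (Fin n) →L[ℝ] EuclideanSpace ℝ (Fin n)}
    (hA : IsVariationField g u α β T p s ψ k A A' δ) {t : ℝ} (ht : t ≤ T) (hts : |t - s| < δ) :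
    HasDerivWithinAt (momentumTrace g u α β T p A)
      (∑ a : Fin n, momentumChristoffelDeriv g u α β T p t (A t (EuclideanSpace.single a 1))
        (A' t (EuclideanSpace.single a 1))) (Iic T) t := by
  have hsrc := hA.mem_source t ht hts
  have hy := coord_mem_target hsrc
  have hΓ := (((contDiffWithinAt_christoffelMap g p hy).differentiableWithinAt
    (by simp)).hasFDerivWithinAt).comp_hasDerivWithinAt t (hβ.hasDerivWithinAt_coord ht hsrc)
    fun t _ => coord_mem_range t
  refine HasDerivWithinAt.fun_sum fun a _ => ?_
  have h1 := (hA.hasDeriv t ht hts).clm_apply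
    (hasDerivWithinAt_const t (Iic T) (EuclideanSpace.single a (1 : ℝ)))
  refine ((hβ.hasDerivWithinAt_momentum hu hupos ht hsrc).clm_apply
    ((hΓ.clm_apply h1).clm_apply h1)).congr_deriv ?_
  simp only [momentumChristoffelDeriv, map_zero, add_zero, map_add, add_apply, Function.comp]
  rw [christoffelMap_symm g p hy (A t _) (A' t _)]
  ring

theorem continuousWithinAt_momentumTraceDeriv {s : ℝ} (hs : s ≤ T) {ψ : ℝ → ℝ} {k δ : ℝ}
    {A A' : ℝ → EuclideanSpace ℝ (Fin n) →L[ℝ] EuclideanSpace ℝ (Fin n)}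
    (hA : IsVariationField g u α β T p s ψ k A A' δ) :
    ContinuousWithinAt (fun t => ∑ a : Fin n, momentumChristoffelDeriv g u α β T p t
      (A t (EuclideanSpace.single a 1)) (A' t (EuclideanSpace.single a 1))) (Iic T) s := by
  have hs0 : |s - s| < δ := by simpa using hA.pos
  have hsrc := hA.mem_source s hs hs0
  have hy := coord_mem_target hsrc
  have hc := hβ.continuousWithinAt_coord hs hsrc
  have cF := hβ.continuousWithinAt_force hu hupos hs hsrc
  have cP := hβ.continuousWithinAt_momentum hu hupos hs hsrc
  have cΓ := (contDiffWithinAt_christoffelMap g p hy).continuousWithinAt.comp hc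
    fun t (_ : t ∈ Iic T) => coord_mem_range t
  have cDΓ := ((contDiffWithinAt_christoffelMap g p hy).fderivWithin_right (m := ∞)
    uniqueDiffOn_range (by simp) (coord_mem_range s)).continuousWithinAt.comp hc
    fun t (_ : t ∈ Iic T) => coord_mem_range t
  have cv := hβ.continuousWithinAt_vel hs hsrc
  refine tendsto_finsetSum _ fun a _ => ?_
  have cA : ContinuousWithinAt (fun t => A t (EuclideanSpace.single a 1)) (Iic T) s :=
    (hA.hasDeriv s hs hs0).continuousWithinAt.clm_apply continuousWithinAt_const
  have cA' : ContinuousWithinAt (fun t => A' t (EuclideanSpace.single a 1)) (Iic T) s :=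
    (hA.cont s hs hs0).clm_apply continuousWithinAt_const
  exact ((cF.clm_apply ((cΓ.clm_apply cA).clm_apply cA)).add
    (cP.clm_apply (((cDΓ.clm_apply cv).clm_apply cA).clm_apply cA))).add
    (continuousWithinAt_const.mul (cP.clm_apply ((cΓ.clm_apply cA').clm_apply cA)))

omit hu hupos in
/-- The variations of the curve stay in the half space. -/
theorem eventually_coord_add_mem_range {s : ℝ} (hs : s ≤ T) {ψ : ℝ → ℝ} {k δ : ℝ}
    {A A' : ℝ → EuclideanSpace ℝ (Fin n) →L[ℝ] EuclideanSpace ℝ (Fin n)}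
    (hA : IsVariationField g u α β T (β s) s ψ k A A' δ) :
    ∃ δ' > 0, ∃ ρ > 0, ∀ s₁ s₂, s₂ ≤ T → |s₁ - s| < δ' → |s₂ - s| < δ' →
      ∀ z, ‖z‖ < ρ → coord n β (β s) s₂ + A s₂ z ∈ range (𝓡∂ n) →
      ∀ t ∈ Icc s₁ s₂, coord n β (β s) t + A t z ∈ range (𝓡∂ n) := by
  have hs0 : |s - s| < δ := by simpa using hA.pos
  have hsrc := hA.mem_source s hs hs0
  have hcx := hβ.continuousWithinAt_coord hs hsrc
  have hcA := (hA.hasDeriv s hs hs0).continuousWithinAt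
  have hcA' := hA.cont s hs hs0
  have hend : β s ∈ (𝓡∂ n).interior M ∨ (s = T ∧ vel n β T (β s) s 0 < 0) := by
    rcases hs.lt_or_eq with h | rfl
    · exact Or.inl (hβ.interior s h)
    · exact hβ.endpoint.imp id fun h => ⟨rfl, h.2⟩
  have hnear : ∀ {δ' s₁ s₂ : ℝ}, |s₁ - s| < δ' → |s₂ - s| < δ' → ∀ t ∈ Icc s₁ s₂, |t - s| < δ' := by
    intro δ' s₁ s₂ h1 h2 t ht
    rw [abs_lt] at h1 h2 ⊢
    constructor <;> linarith [ht.1, ht.2]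
  rcases hend with hint | ⟨rfl, hneg⟩
  · obtain ⟨r, hr, hball⟩ := Metric.mem_nhds_iff.1 (target_mem_nhds_of_interior hint hsrc)
    have hev : ∀ᶠ t in 𝓝[Iic T] s, dist (coord n β (β s) t) (coord n β (β s) s) < r / 2 ∧
        ‖A t‖ < ‖A s‖ + 1 :=
      (hcx.eventually (Metric.ball_mem_nhds _ (half_pos hr))).and
        (hcA.norm.eventually (gt_mem_nhds (by linarith)))
    obtain ⟨δ', hδ', hsub⟩ := Metric.mem_nhdsWithin_iff.1 hev
    have hK : 0 < ‖A s‖ + 1 := by positivity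
    refine ⟨δ', hδ', r / 2 / (‖A s‖ + 1), by positivity, fun s₁ s₂ h2 hs1 hs2 z hz _ t ht => ?_⟩
    have h3 := hsub ⟨by rw [Metric.mem_ball, Real.dist_eq]; exact hnear hs1 hs2 t ht,
      ht.2.trans h2⟩
    refine extChartAt_target_subset_range (β s) (hball ?_)
    rw [Metric.mem_ball]
    rw [lt_div_iff₀ hK] at hz
    calc dist (coord n β (β s) t + A t z) (coord n β (β s) s)
        ≤ dist (coord n β (β s) t + A t z) (coord n β (β s) t)
          + dist (coord n β (β s) t) (coord n β (β s) s) := dist_triangle _ _ _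
      _ < r / 2 + r / 2 := by
        refine add_lt_add ?_ h3.1
        rw [dist_eq_norm, add_sub_cancel_left]
        refine ((A t).le_opNorm z).trans_lt (lt_of_le_of_lt ?_ hz)
        rw [mul_comm]
        exact mul_le_mul_of_nonneg_left h3.2.le (norm_nonneg _)
      _ = r := by ring
  · set c := -(vel n β s (β s) s 0) / 2 with hc
    have hc0 : 0 < c := by linarith
    have hcv : ContinuousWithinAt (fun t => vel n β s (β s) t 0) (Iic s) s :=
      (EuclideanSpace.proj (0 : Fin n) : EuclideanSpace ℝ (Fin n) →L[ℝ] ℝ).continuous.continuousAt.comp_continuousWithinAt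
        (hβ.continuousWithinAt_vel le_rfl hsrc)
    have hev : ∀ᶠ t in 𝓝[Iic s] s, vel n β s (β s) t 0 < -c ∧ ‖A' t‖ < ‖A' s‖ + 1 :=
      (hcv.eventually (gt_mem_nhds (show vel n β s (β s) s 0 < -c by linarith))).and
        (hcA'.norm.eventually (gt_mem_nhds (by linarith)))
    obtain ⟨δ', hδ', hsub⟩ := Metric.mem_nhdsWithin_iff.1 hev
    have hK : 0 < ‖A' s‖ + 1 := by positivity
    refine ⟨min δ δ', by have := hA.pos; positivity, c / (‖A' s‖ + 1), by positivity,
      fun s₁ s₂ h2 hs1 hs2 z hz hmem t ht => ?_⟩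
    rw [lt_div_iff₀ hK] at hz
    rw [range_eq_setOf, mem_ofPred_eq] at hmem ⊢
    have hd : ∀ r ∈ Icc s₁ s₂, HasDerivWithinAt (fun t => (coord n β (β s) t + A t z) 0)
        ((vel n β s (β s) r + A' r z) 0) (Iic s) r := by
      intro r hr
      have hrs := hnear hs1 hs2 r hr
      have hrT : r ≤ s := hr.2.trans h2
      have h1 := (hβ.hasDerivWithinAt_coord hrT
        (hA.mem_source r hrT (hrs.trans_le (min_le_left _ _)))).add
        ((hA.hasDeriv r hrT (hrs.trans_le (min_le_left _ _))).clm_apply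
          (hasDerivWithinAt_const r (Iic s) z))
      have h3 := (EuclideanSpace.proj (0 : Fin n) :
        EuclideanSpace ℝ (Fin n) →L[ℝ] ℝ).hasFDerivAt.comp_hasDerivWithinAt r h1
      refine h3.congr_deriv ?_
      simp
    -- Transversality enters here. The first coordinate of the curve decreases at rate more than c,
    -- and the variation changes it at rate less than c. Hence the varied first coordinate decreases
    -- in time, and nonnegativity at s₂ gives it at all earlier times.
    have hanti : AntitoneOn (fun t => (coord n β (β s) t + A t z) 0) (Icc s₁ s₂) := by
      refine antitoneOn_of_hasDerivWithinAt_nonpos (convex_Icc s₁ s₂)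
        (f' := fun r => (vel n β s (β s) r + A' r z) 0)
        (fun r hr => (hd r hr).continuousWithinAt.mono fun x hx => hx.2.trans h2) (fun r hr => ?_)
        (fun r hr => ?_)
      · rw [interior_Icc] at hr ⊢
        exact (hd r (Ioo_subset_Icc_self hr)).mono fun x hx => hx.2.le.trans h2
      · rw [interior_Icc] at hr
        have hrs := hnear hs1 hs2 r (Ioo_subset_Icc_self hr)
        have h3 := hsub ⟨by
          rw [Metric.mem_ball, Real.dist_eq]; exact hrs.trans_le (min_le_right _ _),
          show r ≤ s from hr.2.le.trans h2⟩
        have h4 : |(A' r z) 0| ≤ ‖A' r z‖ := by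
          simpa using PiLp.norm_apply_le (A' r z) 0
        have h5 := (A' r).le_opNorm z
        have h6 : ‖A' r‖ * ‖z‖ ≤ ‖z‖ * (‖A' s‖ + 1) := by
          rw [mul_comm]
          exact mul_le_mul_of_nonneg_left h3.2.le (norm_nonneg _)
        have h7 := le_abs_self ((A' r z) 0)
        have h8 := h3.1
        simp only [PiLp.add_apply]
        linarith
    exact hmem.trans (hanti ht ⟨ht.1.trans ht.2, le_rfl⟩ ht.2)

end MinCurve

end

end Step

/-! ### Moving a second order upper bound forward along the curve. -/

section StepIn

variable {n : ℕ} [NeZero n] {M : Type*} [TopologicalSpace M]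
  [ChartedSpace (EuclideanHalfSpace n) M] [IsManifold (𝓡∂ n) ∞ M]
  {g : Metric n M} {u : M → ℝ} {α : ℝ} {β : ℝ → M} {T : ℝ} {p : M}

section

variable (hβ : MinCurve g u α β T) (hu : ContMDiff (𝓡∂ n) 𝓘(ℝ, ℝ) 2 u) (hupos : ∀ x, 0 < u x)
include hβ hu hupos

namespace MinCurve

omit hupos in
theorem continuousOn_rpow (hupos : ∀ x, 0 < u x) : ContinuousOn (fun t => u (β t) ^ α) (Iic T) :=
  (hu.continuous.comp_continuousOn hβ.contMDiffOn.continuousOn).rpow_const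
    fun _ _ => Or.inl (hupos _).ne'

theorem intervalIntegrable_rpow {a b : ℝ} (ha : a ≤ T) (hb : b ≤ T) :
    IntervalIntegrable (fun t => u (β t) ^ α) volume a b :=
  ((hβ.continuousOn_rpow hu hupos).mono fun t ht => by
    rw [mem_uIcc] at ht
    rcases ht with h | h
    · exact h.2.trans hb
    · exact h.2.trans ha).intervalIntegrable

/-- A competitor ending at x(s₁) + A(s₁)z is prolonged by the arc t ↦ x(t) + A(t)z. The first order
terms integrate to the difference of the momentum pairings by the Euler-Lagrange equation; the
second order terms are frozen at time s. The radius δ does not depend on t₀ or on the incoming form,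
so steps can be chained. -/
theorem startIn_step {s : ℝ} (hs : s ≤ T) {ψ : ℝ → ℝ} {k δ₀ : ℝ}
    {A A' : ℝ → EuclideanSpace ℝ (Fin n) →L[ℝ] EuclideanSpace ℝ (Fin n)}
    (hA : IsVariationField g u α β T (β s) s ψ k A A' δ₀) {ε : ℝ} (hε : 0 < ε) :
    ∃ δ > 0, ∀ s₁ s₂, s₁ ≤ s₂ → s₂ ≤ T → |s₁ - s| < δ → |s₂ - s| < δ → ∀ t₀ ≤ T, ∀ B,
      StartIn g u α β T (β s) t₀ s₁ (A s₁) B →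
      StartIn g u α β T (β s) t₀ s₂ (A s₂)
        (B + (s₂ - s₁) • (variationForm g u α β T (β s) s (A s) (A' s) + ε • euclid n)) := by
  set p := β s with hpdef
  have hs0 : |s - s| < δ₀ := by simpa using hA.pos
  have hp := hA.mem_source s hs hs0
  set H := lagrangianHess g u α p (coord n β p s, vel n β T p s) with hH
  set J : ℝ → EuclideanSpace ℝ (Fin n) →L[ℝ] EuclideanSpace ℝ (Fin n) × EuclideanSpace ℝ (Fin n) :=
    fun t => (A t).prod (A' t) with hJ
  have hJc : ContinuousWithinAt J (Iic T) s := by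
    have h1 := (hA.hasDeriv s hs hs0).continuousWithinAt.prodMk (hA.cont s hs hs0)
    exact (ContinuousLinearMap.prodₗᵢ (𝕜 := ℝ) (E := EuclideanSpace ℝ (Fin n))
      (F := EuclideanSpace ℝ (Fin n)) (G := EuclideanSpace ℝ (Fin n)) ℝ).continuous.continuousAt.comp_continuousWithinAt h1
  set K := ‖J s‖ + 1 with hK
  have hK0 : 0 < K := by positivity
  -- Since ‖(Az, A'z)‖ ≤ K‖z‖, the Taylor error costs at most ε/4 times ‖z‖². The constant `ε₂`
  -- below bounds the cost of freezing the Hessian at s by ε/2 times ‖z‖² before the factor 1/2, so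
  -- both fit into (ε/2)‖z‖².
  set ε₁ := ε / (4 * K ^ 2) with hε₁
  have hε₁0 : 0 < ε₁ := by positivity
  set ε₂ := ε / (4 * K * (‖H‖ + 1)) with hε₂
  have hH1 : 0 < ‖H‖ + 1 := by positivity
  have hε₂0 : 0 < ε₂ := by positivity
  obtain ⟨δ₁, hδ₁, hvar⟩ := hβ.reach_variation hu hupos hs hp hε₁0
  obtain ⟨δ₂, hδ₂, ρ, hρ, hrange⟩ := hβ.eventually_coord_add_mem_range hs hA
  have hev : ∀ᶠ t in 𝓝[Iic T] s, dist (J t) (J s) < ε₂ ∧ ‖J t‖ < K :=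
    (hJc.eventually (Metric.ball_mem_nhds _ hε₂0)).and
      (hJc.norm.eventually (gt_mem_nhds (by linarith)))
  obtain ⟨δ₃, hδ₃, hsub⟩ := Metric.mem_nhdsWithin_iff.1 hev
  set δ := min (min δ₀ δ₁) (min δ₂ δ₃) with hδ
  have hδ0 : 0 < δ := by have := hA.pos; positivity
  refine ⟨δ, hδ0, fun s₁ s₂ h12 h2T hs1 hs2 t₀ ht₀ B hstart ε' hε' => ?_⟩
  have hnear : ∀ t ∈ Icc s₁ s₂, |t - s| < δ := by
    intro t ht
    rw [abs_lt] at hs1 hs2 ⊢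
    constructor <;> linarith [ht.1, ht.2]
  have htT : ∀ t ∈ Icc s₁ s₂, t ≤ T := fun t ht => ht.2.trans h2T
  have hsubT : Icc s₁ s₂ ⊆ Iic T := htT
  have h0 : ∀ t ∈ Icc s₁ s₂, |t - s| < δ₀ := fun t ht =>
    (hnear t ht).trans_le ((min_le_left _ _).trans (min_le_left _ _))
  have hJt : ∀ t ∈ Icc s₁ s₂, dist (J t) (J s) < ε₂ ∧ ‖J t‖ < K := fun t ht => hsub ⟨by
    rw [Metric.mem_ball, Real.dist_eq]
    exact (hnear t ht).trans_le ((min_le_right _ _).trans (min_le_right _ _)), htT t ht⟩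
  have hsrc : ∀ t ∈ Icc s₁ s₂, β t ∈ (extChartAt (𝓡∂ n) p).source := fun t ht =>
    hA.mem_source t (htT t ht) (h0 t ht)
  have hmem1 : s₁ ∈ Icc s₁ s₂ := ⟨le_rfl, h12⟩
  have hmem2 : s₂ ∈ Icc s₁ s₂ := ⟨h12, le_rfl⟩
  have hcA : ContinuousOn A (Icc s₁ s₂) := fun t ht =>
    ((hA.hasDeriv t (htT t ht) (h0 t ht)).continuousWithinAt).mono hsubT
  have hcA' : ContinuousOn A' (Icc s₁ s₂) := fun t ht =>
    (hA.cont t (htT t ht) (h0 t ht)).mono hsubT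
  have hcP : ContinuousOn (momentum g u α β T p) (Icc s₁ s₂) := fun t ht =>
    (hβ.continuousWithinAt_momentum hu hupos (htT t ht) (hsrc t ht)).mono hsubT
  have hcF : ContinuousOn (force g u α β T p) (Icc s₁ s₂) := fun t ht =>
    (hβ.continuousWithinAt_force hu hupos (htT t ht) (hsrc t ht)).mono hsubT
  have hJnorm : ∀ t ∈ Icc s₁ s₂, ∀ z, ‖A t z‖ ≤ K * ‖z‖ ∧ ‖A' t z‖ ≤ K * ‖z‖ ∧
      ‖(A t z, A' t z)‖ ≤ K * ‖z‖ := by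
    intro t ht z
    have h1 : ‖(A t z, A' t z)‖ ≤ K * ‖z‖ := ((J t).le_opNorm z).trans
      (mul_le_mul_of_nonneg_right (hJt t ht).2.le (norm_nonneg _))
    exact ⟨(le_max_left _ _).trans h1, (le_max_right _ _).trans h1, h1⟩
  have hsmall : ∀ᶠ z : EuclideanSpace ℝ (Fin n) in 𝓝 0, ‖z‖ < min ρ (δ₁ / K) := by
    have := Metric.ball_mem_nhds (0 : EuclideanSpace ℝ (Fin n))
      (show 0 < min ρ (δ₁ / K) by positivity)
    filter_upwards [this] with z hz
    simpa using hz
  filter_upwards [hstart ε' hε', hsmall] with z hz1 hz2 hz3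
  have hrg := hrange s₁ s₂ h2T
    (hs1.trans_le ((min_le_right _ _).trans (min_le_left _ _)))
    (hs2.trans_le ((min_le_right _ _).trans (min_le_left _ _))) z
    (hz2.trans_le (min_le_left _ _)) hz3
  have hKz : K * ‖z‖ < δ₁ := by
    have := hz2.trans_le (min_le_right _ _)
    rw [lt_div_iff₀ hK0] at this
    linarith
  have hreach1 := hz1 (hrg s₁ hmem1)
  have hreach2 := hvar s₁ s₂ h12 h2T
    (hs1.trans_le ((min_le_left _ _).trans (min_le_right _ _)))
    (hs2.trans_le ((min_le_left _ _).trans (min_le_right _ _)))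
    (fun t => A t z) (fun t => A' t z)
    (fun t ht => by
      have h1 := (hA.hasDeriv t (htT t ht) (h0 t ht)).clm_apply (hasDerivWithinAt_const t (Iic T) z)
      simp only [map_zero, add_zero] at h1
      exact h1.mono hsubT)
    (hcA'.clm_apply continuousOn_const)
    (fun t ht => ⟨(hJnorm t ht z).1.trans_lt hKz, (hJnorm t ht z).2.1.trans_lt hKz⟩) hrg
  refine (hreach1.trans hreach2).mono ?_
  have hz := hcA.clm_apply (continuousOn_const (c := z))
  have hz' := hcA'.clm_apply (continuousOn_const (c := z))
  have hpair := hz.prodMk hz'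
  have i1 : IntervalIntegrable (fun t => u (β t) ^ α) volume s₁ s₂ :=
    hβ.intervalIntegrable_rpow hu hupos (h12.trans h2T) h2T
  have i2 : IntervalIntegrable (fun t => force g u α β T p t (A t z) + momentum g u α β T p t (A' t z))
      volume s₁ s₂ := ((hcF.clm_apply hz).add (hcP.clm_apply hz')).intervalIntegrable_of_Icc h12
  have i3 : IntervalIntegrable (fun t => (1 / 2) * H (A t z, A' t z) (A t z, A' t z) +
      ε₁ * ‖(A t z, A' t z)‖ ^ 2) volume s₁ s₂ := by
    refine ContinuousOn.intervalIntegrable_of_Icc h12 ?_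
    exact (((H.continuous.comp_continuousOn hpair).clm_apply hpair).const_smul (1 / 2 : ℝ)).add
      ((hpair.norm.pow 2).const_smul ε₁)
  have hFTC : ∫ t in s₁..s₂, (force g u α β T p t (A t z) + momentum g u α β T p t (A' t z)) =
      momentum g u α β T p s₂ (A s₂ z) - momentum g u α β T p s₁ (A s₁ z) := by
    refine intervalIntegral.integral_eq_sub_of_hasDerivAt_of_le h12
      (f := fun t => momentum g u α β T p t (A t z)) (hcP.clm_apply hz) (fun t ht => ?_) i2
    have hti := Ioo_subset_Icc_self ht
    have hnh : Iic T ∈ 𝓝 t := Iic_mem_nhds (ht.2.trans_le h2T)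
    have h1 := ((hA.hasDeriv t (htT t hti) (h0 t hti)).hasDerivAt hnh).clm_apply
      (hasDerivAt_const t z)
    have h2 := ((hβ.hasDerivWithinAt_momentum hu hupos (htT t hti) (hsrc t hti)).hasDerivAt
      hnh).clm_apply h1
    simpa using h2
  have hle : ∫ t in s₁..s₂, ((1 / 2) * H (A t z, A' t z) (A t z, A' t z) +
      ε₁ * ‖(A t z, A' t z)‖ ^ 2) ≤ (s₂ - s₁) * ((1 / 2) *
        (H (A s z, A' s z) (A s z, A' s z) + ε * ‖z‖ ^ 2)) := by
    rw [← smul_eq_mul, ← intervalIntegral.integral_const]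
    refine intervalIntegral.integral_mono_on h12 i3 intervalIntegrable_const fun t ht => ?_
    have e1 := abs_apply_self_sub_le H (A t z, A' t z) (A s z, A' s z)
    have e2 : ‖(A t z, A' t z) - (A s z, A' s z)‖ ≤ ε₂ * ‖z‖ := by
      have : ‖(J t - J s) z‖ ≤ ε₂ * ‖z‖ := ((J t - J s).le_opNorm z).trans
        (mul_le_mul_of_nonneg_right (by rw [← dist_eq_norm]; exact (hJt t ht).1.le) (norm_nonneg _))
      exact this
    have e3 := (hJnorm t ht z).2.2
    have e4 : ‖(A s z, A' s z)‖ ≤ K * ‖z‖ := ((J s).le_opNorm z).trans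
      (mul_le_mul_of_nonneg_right (by linarith) (norm_nonneg _))
    have e5 : ‖H‖ * ‖(A t z, A' t z) - (A s z, A' s z)‖ * (‖(A t z, A' t z)‖ + ‖(A s z, A' s z)‖) ≤
        (‖H‖ + 1) * (ε₂ * ‖z‖) * (K * ‖z‖ + K * ‖z‖) := by
      gcongr
      linarith
    have e6 : (‖H‖ + 1) * (ε₂ * ‖z‖) * (K * ‖z‖ + K * ‖z‖) = ε / 2 * ‖z‖ ^ 2 := by
      rw [hε₂]
      field_simp
      ring
    have e7 : ε₁ * ‖(A t z, A' t z)‖ ^ 2 ≤ ε₁ * (K * ‖z‖) ^ 2 := by gcongr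
    have e8 : ε₁ * (K * ‖z‖) ^ 2 = ε / 4 * ‖z‖ ^ 2 := by
      rw [hε₁]
      field_simp
    have e9 := (abs_le.1 (e1.trans (e5.trans_eq e6))).2
    linarith
  have hsplit : ∫ t in s₁..s₂, (u (β t) ^ α + (force g u α β T p t (A t z) +
      momentum g u α β T p t (A' t z)) + 1 / 2 * H (A t z, A' t z) (A t z, A' t z) +
      ε₁ * ‖(A t z, A' t z)‖ ^ 2) = (∫ t in s₁..s₂, u (β t) ^ α) +
      (momentum g u α β T p s₂ (A s₂ z) - momentum g u α β T p s₁ (A s₁ z)) +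
      ∫ t in s₁..s₂, ((1 / 2) * H (A t z, A' t z) (A t z, A' t z) +
      ε₁ * ‖(A t z, A' t z)‖ ^ 2) := by
    rw [← hFTC, ← intervalIntegral.integral_add i1 i2, ← intervalIntegral.integral_add (i1.add i2) i3]
    refine intervalIntegral.integral_congr fun t _ => ?_
    ring
  have hadj := intervalIntegral.integral_add_adjacent_intervals
    (hβ.intervalIntegrable_rpow (α := α) hu hupos ht₀ (h12.trans h2T)) i1
  rw [hsplit, ← hadj]
  have eB : (B + (s₂ - s₁) • (variationForm g u α β T p s (A s) (A' s) + ε • euclid n)) z z =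
      B z z + (s₂ - s₁) * (H (A s z, A' s z) (A s z, A' s z) + ε * ‖z‖ ^ 2) := by
    simp only [add_apply, smul_apply, smul_eq_mul, euclid_self]
    rfl
  rw [eB]
  linarith

end MinCurve

end

end StepIn

/-! ### Second order bounds under a change of variables. -/

section QuadraticComp

variable {E : Type*} [NormedAddCommGroup E] [NormedSpace ℝ E]
  {F : Type*} [NormedAddCommGroup F] [NormedSpace ℝ F]

/-- Second order chain rule in one-sided form: the linear part P meets the Hessian of f, and the
quadratic part Q only its derivative. The constant ε₁ is chosen through a local Lipschitz bound of f
at x. -/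
theorem quadratic_comp_le {f : E → F} {S : Set E} (hS : Convex ℝ S) (hu : UniqueDiffOn ℝ S)
    {x : E} (hx : x ∈ S) (hf : ContDiffWithinAt ℝ 2 f S x)
    (hsymm : IsSymmSndFDerivWithinAt ℝ f S x) (P : F →L[ℝ] ℝ) (Q : F →L[ℝ] F →L[ℝ] ℝ) {ε : ℝ}
    (hε : 0 < ε) :
    ∃ ε₁ > 0, ∀ᶠ y in 𝓝[S] x, P (f y - f x) + (1 / 2) * Q (f y - f x) (f y - f x)
      + ε₁ * ‖f y - f x‖ ^ 2 ≤
      P (fderivWithin ℝ f S x (y - x)) + (1 / 2) *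
        (Q (fderivWithin ℝ f S x (y - x)) (fderivWithin ℝ f S x (y - x))
        + P (fderivWithin ℝ (fderivWithin ℝ f S) S x (y - x) (y - x))) + ε * ‖y - x‖ ^ 2 := by
  set L := fderivWithin ℝ f S x with hL
  set H := fderivWithin ℝ (fderivWithin ℝ f S) S x with hH
  have htend : Tendsto (fun y => (x, y)) (𝓝[S] x) (𝓝[S] x ×ˢ 𝓝[S] x) := by
    refine Tendsto.prodMk ?_ tendsto_id
    exact tendsto_const_pure.mono_right (pure_le_nhdsWithin hx)
  have h2 : (fun y => f y - f x - L (y - x) - (1 / 2 : ℝ) • H (y - x) (y - x)) =o[𝓝[S] x]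
      fun y => ‖y - x‖ ^ 2 := (taylor_two_isLittleO hS hu hx hf hsymm).comp_tendsto htend
  have h1 : (fun y => f y - f x - L (y - x)) =o[𝓝[S] x] fun y => y - x :=
    (hf.differentiableWithinAt (by simp)).hasFDerivWithinAt.isLittleO
  have hLO : (fun y => L (y - x)) =O[𝓝[S] x] fun y => y - x := L.isBigO_comp _ _
  have hfO : (fun y => f y - f x) =O[𝓝[S] x] fun y => y - x := by
    have := h1.isBigO.add hLO
    simpa using this
  have hP : (fun y => P (f y - f x - L (y - x) - (1 / 2 : ℝ) • H (y - x) (y - x))) =o[𝓝[S] x]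
      fun y => ‖y - x‖ ^ 2 := (P.isBigO_comp _ _).trans_isLittleO h2
  have hQ : (fun y => Q (f y - f x) (f y - f x) - Q (L (y - x)) (L (y - x))) =o[𝓝[S] x]
      fun y => ‖y - x‖ ^ 2 := by
    have hb : (fun y => Q (f y - f x) (f y - f x) - Q (L (y - x)) (L (y - x))) =O[𝓝[S] x]
        fun y => ‖f y - f x - L (y - x)‖ * (‖f y - f x‖ + ‖L (y - x)‖) := by
      refine IsBigO.of_bound ‖Q‖ (Eventually.of_forall fun y => ?_)
      have := abs_apply_self_sub_le Q (f y - f x) (L (y - x))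
      rw [Real.norm_eq_abs, Real.norm_of_nonneg (by positivity)]
      linarith
    refine hb.trans_isLittleO ?_
    have h3 : (fun y => ‖f y - f x‖ + ‖L (y - x)‖) =O[𝓝[S] x] fun y => ‖y - x‖ :=
      (hfO.norm_norm).add hLO.norm_norm
    have h4 := (h1.norm_norm).mul_isBigO h3
    refine h4.congr_right fun y => by rw [pow_two]
  obtain ⟨C, hC⟩ := hfO.bound
  refine ⟨ε / (2 * (C ^ 2 + 1)), by positivity, ?_⟩
  filter_upwards [hC, hP.bound (show 0 < ε / 4 by positivity), hQ.bound (show 0 < ε / 4 by positivity)]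
    with y k1 k2 k3
  rw [Real.norm_eq_abs, Real.norm_of_nonneg (by positivity)] at k2 k3
  have e1 := (abs_le.1 k2).2
  have e2 := (abs_le.1 k3).2
  simp only [map_sub, map_smul, smul_eq_mul] at e1
  have e3 : ε / (2 * (C ^ 2 + 1)) * ‖f y - f x‖ ^ 2 ≤ ε / 2 * ‖y - x‖ ^ 2 := by
    have h5 : ‖f y - f x‖ ^ 2 ≤ (C ^ 2 + 1) * ‖y - x‖ ^ 2 := by
      have : ‖f y - f x‖ ^ 2 ≤ (C * ‖y - x‖) ^ 2 := pow_le_pow_left₀ (norm_nonneg _) k1 2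
      nlinarith [sq_nonneg ‖y - x‖]
    calc ε / (2 * (C ^ 2 + 1)) * ‖f y - f x‖ ^ 2
        ≤ ε / (2 * (C ^ 2 + 1)) * ((C ^ 2 + 1) * ‖y - x‖ ^ 2) := by gcongr
      _ = ε / 2 * ‖y - x‖ ^ 2 := by field_simp
  simp only [map_sub] at e1 e2 ⊢
  have : 0 ≤ ε * ‖y - x‖ ^ 2 := by positivity
  linarith

end QuadraticComp

/-! ### Barriers for the weighted distance and their invariance under chart changes. -/

section AdmIn

variable {n : ℕ} [NeZero n] {M : Type*} [TopologicalSpace M]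
  [ChartedSpace (EuclideanHalfSpace n) M] [IsManifold (𝓡∂ n) ∞ M]
  {g : Metric n M} {u : M → ℝ} {α : ℝ} {β : ℝ → M} {T : ℝ} {p q : M}

/-- Points near `β s` are reached from `β t₀` with a weighted length that is bounded to second order
by a quadratic form whose covariant trace is at most `κ u^α`. -/
def AdmIn (g : Metric n M) (u : M → ℝ) (α : ℝ) (β : ℝ → M) (T : ℝ) (p : M) (t₀ s κ : ℝ) : Prop :=
  ∃ Q : EuclideanSpace ℝ (Fin n) →L[ℝ] EuclideanSpace ℝ (Fin n) →L[ℝ] ℝ,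
    (∀ ε > 0, ∀ᶠ y in 𝓝[range (𝓡∂ n)] (coord n β p s),
      Reach g u α (β t₀) ((extChartAt (𝓡∂ n) p).symm y)
        ((∫ t in t₀..s, u (β t) ^ α) + (momentum g u α β T p s (y - coord n β p s)
          + (1 / 2) * Q (y - coord n β p s) (y - coord n β p s) + ε * ‖y - coord n β p s‖ ^ 2))) ∧
    gTrace g p (coord n β p s) (Q - christoffelForm g p (coord n β p s) (momentum g u α β T p s)) ≤
      κ * u (β s) ^ α

theorem chartChange_coord {s : ℝ} (hp : β s ∈ (extChartAt (𝓡∂ n) p).source) :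
    chartChange n p q (coord n β p s) = coord n β q s := by
  rw [chartChange, symm_coord hp]
  rfl

variable (hβ : MinCurve g u α β T)
include hβ

namespace MinCurve

theorem vel_chartChange {s : ℝ} (hs : s ≤ T) (hp : β s ∈ (extChartAt (𝓡∂ n) p).source)
    (hq : β s ∈ (extChartAt (𝓡∂ n) q).source) :
    vel n β T q s = fderivWithin ℝ (chartChange n p q) (range (𝓡∂ n)) (coord n β p s)
      (vel n β T p s) := by
  have h1 := ((contDiffWithinAt_chartChange (p := q) (coord_mem_target hp) (by
    rwa [symm_coord hp])).differentiableWithinAt (by simp)).hasFDerivWithinAt.comp_hasDerivWithinAt s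
      (hβ.hasDerivWithinAt_coord hs hp) fun t _ => coord_mem_range t
  have h2 : HasDerivWithinAt (coord n β q) _ (Iic T) s := h1.congr_of_eventuallyEq (by
    filter_upwards [hβ.eventually_mem_source hs hp] with t ht
    exact (chartChange_coord ht).symm) (chartChange_coord hp).symm
  exact h2.derivWithin (uniqueDiffOn_Iic T s hs)

theorem momentum_chartChange {s : ℝ} (hs : s ≤ T) (hp : β s ∈ (extChartAt (𝓡∂ n) p).source)
    (hq : β s ∈ (extChartAt (𝓡∂ n) q).source) (z : EuclideanSpace ℝ (Fin n)) :
    momentum g u α β T p s z = momentum g u α β T q s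
      (fderivWithin ℝ (chartChange n p q) (range (𝓡∂ n)) (coord n β p s) z) := by
  simp only [momentum, smul_apply, smul_eq_mul, chartWeight, symm_coord hp, symm_coord hq]
  rw [metricForm_chartChange g (coord_mem_target hp) (by rwa [symm_coord hp]) (p := q),
    chartChange_coord hp, hβ.vel_chartChange hs hp hq]

/-- The coordinate Hessian of the barrier gains P∘H under a change of charts with Hessian H. The
Christoffel map gains the same term, so Q - P∘Γ transforms as a tensor. Its trace agrees in both
charts because the derivative of the coordinate change maps frames to frames. -/
theorem admIn_chartChange {t₀ s κ : ℝ} (hs : s ≤ T) (hp : β s ∈ (extChartAt (𝓡∂ n) p).source)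
    (hq : β s ∈ (extChartAt (𝓡∂ n) q).source) (h : AdmIn g u α β T q t₀ s κ) :
    AdmIn g u α β T p t₀ s κ := by
  obtain ⟨Q, hQ, htr⟩ := h
  have hy := coord_mem_target hp
  have hyq : (extChartAt (𝓡∂ n) p).symm (coord n β p s) ∈ (extChartAt (𝓡∂ n) q).source := by
    rwa [symm_coord hp]
  set ψ := chartChange n p q with hψ
  set L := fderivWithin ℝ ψ (range (𝓡∂ n)) (coord n β p s) with hL
  set H := fderivWithin ℝ (fderivWithin ℝ ψ (range (𝓡∂ n))) (range (𝓡∂ n)) (coord n β p s) with hH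
  have hψx : ψ (coord n β p s) = coord n β q s := chartChange_coord hp
  have hψc : ContDiffWithinAt ℝ ∞ ψ (range (𝓡∂ n)) (coord n β p s) :=
    contDiffWithinAt_chartChange hy hyq
  have hψ2 := hψc.of_le (show (2 : ℕ∞ω) ≤ ∞ from ENat.LEInfty.out)
  set P := momentum g u α β T q s with hP
  have hPL : ∀ z, momentum g u α β T p s z = P (L z) := hβ.momentum_chartChange hs hp hq
  refine ⟨Q.bilinearComp L L + (ContinuousLinearMap.compL ℝ (EuclideanSpace ℝ (Fin n))
    (EuclideanSpace ℝ (Fin n)) ℝ P) ∘L H, fun ε hε => ?_, ?_⟩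
  · obtain ⟨ε₁, hε₁, hle⟩ := quadratic_comp_le convex_range uniqueDiffOn_range (coord_mem_range s)
      hψ2 (isSymmSndFDerivWithinAt_range hψ2 (coord_mem_range s)) P Q hε
    have htend : Tendsto ψ (𝓝[range (𝓡∂ n)] (coord n β p s)) (𝓝[range (𝓡∂ n)] (coord n β q s)) := by
      refine tendsto_nhdsWithin_of_tendsto_nhds_of_eventually_within _ ?_
        (Eventually.of_forall fun z => mem_range_self _)
      rw [← hψx]
      exact hψc.continuousWithinAt
    filter_upwards [hle, htend.eventually (hQ ε₁ hε₁), eventually_mem_chart hy hyq] with y h1 h2 h3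
    have e : (extChartAt (𝓡∂ n) q).symm (ψ y) = (extChartAt (𝓡∂ n) p).symm y :=
      (extChartAt (𝓡∂ n) q).left_inv h3.2
    rw [e] at h2
    refine h2.mono (add_le_add le_rfl ?_)
    rw [hψx] at h1
    rw [hPL]
    exact h1
  · obtain ⟨F, hF⟩ := exists_isFrame g p hy
    have hF' : IsFrame (metricForm g q (coord n β q s)) (L ∘L F) := by
      intro z w
      rw [← hF z w, metricForm_chartChange g hy hyq, ← hψ, hψx]
      rfl
    rw [hF'.gTrace_eq] at htr
    rw [hF.gTrace_eq]
    refine le_trans (le_of_eq (Finset.sum_congr rfl fun a _ => ?_)) htr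
    simp only [sub_apply, christoffelForm_apply, hPL]
    rw [christoffelMap_chartChange g hy hyq, ← hψ, ← hL, ← hH, hψx, map_add]
    change Q (L (F _)) (L (F _)) + P (H _ _) - _ =
      Q (L (F _)) (L (F _)) - P (christoffelMap g q _ (L (F _)) (L (F _)))
    ring

end MinCurve

end AdmIn

/-! ### One step of the Riccati comparison. -/

section StepAdm

variable {n : ℕ} [NeZero n] {M : Type*} [TopologicalSpace M]
  [ChartedSpace (EuclideanHalfSpace n) M] [IsManifold (𝓡∂ n) ∞ M]
  {g : Metric n M} {u : M → ℝ} {α : ℝ} {β : ℝ → M} {T : ℝ} {p : M}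

theorem chartWeight_coord {s : ℝ} (hp : β s ∈ (extChartAt (𝓡∂ n) p).source) :
    chartWeight n u α p (coord n β p s) = u (β s) ^ α := by
  rw [chartWeight, symm_coord hp]

/-- Pulling the barrier back by A turns its covariant trace into a plain sum over the standard basis
minus `momentumTrace`; the normalization A = ψ W^(-1/2) F converts κW into ψ²κ. -/
theorem AdmIn.exists_startIn {t₀ s s₁ κ δ k : ℝ} {ψ : ℝ → ℝ}
    {A A' : ℝ → EuclideanSpace ℝ (Fin n) →L[ℝ] EuclideanSpace ℝ (Fin n)}
    (hA : IsVariationField g u α β T p s ψ k A A' δ) (hupos : ∀ x, 0 < u x) (hs₁ : s₁ ≤ T)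
    (hs : |s₁ - s| < δ) (h : AdmIn g u α β T p t₀ s₁ κ) :
    ∃ B, StartIn g u α β T p t₀ s₁ (A s₁) B ∧
      ∑ a : Fin n, B (EuclideanSpace.single a 1) (EuclideanSpace.single a 1)
        - momentumTrace g u α β T p A s₁ ≤ ψ s₁ ^ 2 * κ := by
  obtain ⟨Q, hQ, htr⟩ := h
  refine ⟨Q.bilinearComp (A s₁) (A s₁), fun ε hε => ?_, ?_⟩
  · have htend : Tendsto (fun z => coord n β p s₁ + A s₁ z) (𝓝 0) (𝓝 (coord n β p s₁)) := by
      have : Continuous fun z => coord n β p s₁ + A s₁ z := by fun_prop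
      simpa using this.tendsto 0
    have hK : 0 < ‖A s₁‖ ^ 2 + 1 := by positivity
    filter_upwards [htend.eventually (eventually_nhdsWithin_iff.1 (hQ (ε / (‖A s₁‖ ^ 2 + 1))
      (by positivity)))] with z hz hzr
    refine (hz hzr).mono ?_
    simp only [add_sub_cancel_left]
    have e1 : ε / (‖A s₁‖ ^ 2 + 1) * ‖A s₁ z‖ ^ 2 ≤ ε * ‖z‖ ^ 2 := by
      have h1 : ‖A s₁ z‖ ^ 2 ≤ (‖A s₁‖ ^ 2 + 1) * ‖z‖ ^ 2 := by
        have := pow_le_pow_left₀ (norm_nonneg _) ((A s₁).le_opNorm z) 2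
        nlinarith [sq_nonneg ‖z‖]
      calc ε / (‖A s₁‖ ^ 2 + 1) * ‖A s₁ z‖ ^ 2
          ≤ ε / (‖A s₁‖ ^ 2 + 1) * ((‖A s₁‖ ^ 2 + 1) * ‖z‖ ^ 2) := by gcongr
        _ = ε * ‖z‖ ^ 2 := by field_simp
    change _ ≤ _ + _ + (1 / 2) * Q (A s₁ z) (A s₁ z) + _
    linarith
  · have hW := chartWeight_pos (n := n) (α := α) (p := p) hupos (coord n β p s₁)
    have h1 := hA.trace s₁ hs₁ hs
      (Q - christoffelForm g p (coord n β p s₁) (momentum g u α β T p s₁))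
    have h2 : ∑ a : Fin n, Q.bilinearComp (A s₁) (A s₁) (EuclideanSpace.single a 1)
        (EuclideanSpace.single a 1) - momentumTrace g u α β T p A s₁ = ∑ a : Fin n,
        (Q - christoffelForm g p (coord n β p s₁) (momentum g u α β T p s₁))
        (A s₁ (EuclideanSpace.single a 1)) (A s₁ (EuclideanSpace.single a 1)) := by
      rw [momentumTrace, ← Finset.sum_sub_distrib]
      rfl
    rw [h2]
    rw [← chartWeight_coord (hA.mem_source s₁ hs₁ hs)] at htr
    have h3 := mul_le_mul_of_nonneg_left htr (sq_nonneg (ψ s₁))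
    rw [← h1] at h3
    refine le_of_mul_le_mul_left (h3.trans_eq ?_) hW
    ring

/-- The starting point of the induction. Where the cutoff vanishes the variation field is zero, so
the only endpoint is β(t₀) itself, reached by a constant curve. The barrier in position variables
has no such start, which is why `StartIn` uses the parameter z. -/
theorem exists_startIn_of_eq_zero {t₀ s δ k : ℝ} {ψ : ℝ → ℝ}
    {A A' : ℝ → EuclideanSpace ℝ (Fin n) →L[ℝ] EuclideanSpace ℝ (Fin n)}
    (hA : IsVariationField g u α β T p s ψ k A A' δ) (ht₀ : t₀ ≤ T)
    (hs : |t₀ - s| < δ) (hψ : ψ t₀ = 0) :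
    ∃ B, StartIn g u α β T p t₀ t₀ (A t₀) B ∧
      ∑ a : Fin n, B (EuclideanSpace.single a 1) (EuclideanSpace.single a 1)
        - momentumTrace g u α β T p A t₀ ≤ 0 := by
  have h0 := hA.eq_zero t₀ ht₀ hs hψ
  refine ⟨0, fun ε hε => Eventually.of_forall fun z _ => ?_, ?_⟩
  · simp only [h0, zero_apply, add_zero, symm_coord (hA.mem_source t₀ ht₀ hs)]
    refine (Reach.refl _).mono ?_
    simp only [intervalIntegral.integral_same, map_zero, mul_zero, add_zero, zero_add]
    positivity
  · simp [momentumTrace, h0]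

/-- For ψ ≠ 0 the field A is invertible, so every nearby point has the form x + Az, and the form B
can be transported to position variables. -/
theorem StartIn.admIn {t₀ s s₂ κ δ k : ℝ} {ψ : ℝ → ℝ}
    {A A' : ℝ → EuclideanSpace ℝ (Fin n) →L[ℝ] EuclideanSpace ℝ (Fin n)}
    (hA : IsVariationField g u α β T p s ψ k A A' δ) (hupos : ∀ x, 0 < u x) (hs₂ : s₂ ≤ T)
    (hs : |s₂ - s| < δ) (hψ : ψ s₂ ≠ 0)
    {B : EuclideanSpace ℝ (Fin n) →L[ℝ] EuclideanSpace ℝ (Fin n) →L[ℝ] ℝ}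
    (h : StartIn g u α β T p t₀ s₂ (A s₂) B)
    (htr : ∑ a : Fin n, B (EuclideanSpace.single a 1) (EuclideanSpace.single a 1)
        - momentumTrace g u α β T p A s₂ ≤ ψ s₂ ^ 2 * κ) :
    AdmIn g u α β T p t₀ s₂ κ := by
  have hinj := hA.injective s₂ hs₂ hs hψ
  have hker : LinearMap.ker (A s₂).toLinearMap = ⊥ := LinearMap.ker_eq_bot.2 hinj
  have hran : LinearMap.range (A s₂).toLinearMap = ⊤ := LinearMap.range_eq_top.2
    ((LinearMap.injective_iff_surjective (f := (A s₂).toLinearMap)).1 hinj)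
  set e := ContinuousLinearEquiv.ofBijective (A s₂) hker hran with he
  have hAe : ∀ z, A s₂ (e.symm z) = z := fun z => e.apply_symm_apply z
  have heA : ∀ z, e.symm (A s₂ z) = z := fun z => e.symm_apply_apply z
  set Q := B.bilinearComp (e.symm : EuclideanSpace ℝ (Fin n) →L[ℝ] EuclideanSpace ℝ (Fin n))
    (e.symm : EuclideanSpace ℝ (Fin n) →L[ℝ] EuclideanSpace ℝ (Fin n)) with hQ
  have hQB : ∀ z, Q z z = B (e.symm z) (e.symm z) := fun z => rfl
  refine ⟨Q, fun ε hε => ?_, ?_⟩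
  · set K := ‖(e.symm : EuclideanSpace ℝ (Fin n) →L[ℝ] EuclideanSpace ℝ (Fin n))‖ with hK
    have hK0 : 0 < K ^ 2 + 1 := by positivity
    have htend : Tendsto (fun y => e.symm (y - coord n β p s₂)) (𝓝 (coord n β p s₂)) (𝓝 0) := by
      have : Continuous fun y => e.symm (y - coord n β p s₂) := by fun_prop
      simpa using this.tendsto (coord n β p s₂)
    filter_upwards [mem_nhdsWithin_of_mem_nhds (htend.eventually (h (ε / (K ^ 2 + 1))
      (by positivity))), self_mem_nhdsWithin] with y hy hyr
    rw [hAe, add_sub_cancel] at hy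
    refine (hy hyr).mono ?_
    have e1 : ε / (K ^ 2 + 1) * ‖e.symm (y - coord n β p s₂)‖ ^ 2 ≤
        ε * ‖y - coord n β p s₂‖ ^ 2 := by
      have h1 : ‖e.symm (y - coord n β p s₂)‖ ^ 2 ≤ (K ^ 2 + 1) * ‖y - coord n β p s₂‖ ^ 2 := by
        have := pow_le_pow_left₀ (norm_nonneg _) ((e.symm : EuclideanSpace ℝ (Fin n) →L[ℝ]
          EuclideanSpace ℝ (Fin n)).le_opNorm (y - coord n β p s₂)) 2
        rw [← hK, ContinuousLinearEquiv.coe_coe] at this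
        nlinarith [sq_nonneg ‖y - coord n β p s₂‖]
      calc ε / (K ^ 2 + 1) * ‖e.symm (y - coord n β p s₂)‖ ^ 2
          ≤ ε / (K ^ 2 + 1) * ((K ^ 2 + 1) * ‖y - coord n β p s₂‖ ^ 2) := by gcongr
        _ = ε * ‖y - coord n β p s₂‖ ^ 2 := by field_simp
    rw [hQB]
    linarith
  · have hW := chartWeight_pos (n := n) (α := α) (p := p) hupos (coord n β p s₂)
    have h1 := hA.trace s₂ hs₂ hs
      (Q - christoffelForm g p (coord n β p s₂) (momentum g u α β T p s₂))
    have h2 : ∑ a : Fin n, B (EuclideanSpace.single a 1)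
        (EuclideanSpace.single a 1) - momentumTrace g u α β T p A s₂ = ∑ a : Fin n,
        (Q - christoffelForm g p (coord n β p s₂) (momentum g u α β T p s₂))
        (A s₂ (EuclideanSpace.single a 1)) (A s₂ (EuclideanSpace.single a 1)) := by
      rw [momentumTrace, ← Finset.sum_sub_distrib]
      refine Finset.sum_congr rfl fun a _ => ?_
      rw [sub_apply, sub_apply, hQB, heA, christoffelForm_apply]
    rw [h2] at htr
    rw [← chartWeight_coord (hA.mem_source s₂ hs₂ hs)]
    have hψ2 : 0 < ψ s₂ ^ 2 := by positivity
    refine le_of_mul_le_mul_left ?_ hψ2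
    rw [← h1]
    have h3 := mul_le_mul_of_nonneg_left htr hW.le
    refine h3.trans_eq ?_
    ring

/-- The quantity `deficit` at a point of the curve, in the chart at that point. -/
def curveDeficit (g : Metric n M) (u : M → ℝ) (α : ℝ) (β : ℝ → M) (T s : ℝ) : ℝ :=
  deficit g u α (β s) (coord n β (β s) s) (vel n β T (β s) s)

section

variable (hβ : MinCurve g u α β T) (hu : ContMDiff (𝓡∂ n) 𝓘(ℝ, ℝ) 2 u) (hupos : ∀ x, 0 < u x)
include hβ hu hupos

namespace MinCurve

/-- The local form of the Riccati comparison along the curve. -/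
theorem admIn_step (hα' : ((n : ℝ) - 1) / 4 < 1 / α) {s : ℝ} (hs : s ≤ T) {ψ : ℝ → ℝ} {k : ℝ}
    (hψ : ∀ t, HasDerivAt ψ k t) {ε : ℝ} (hε : 0 < ε) :
    ∃ δ > 0, ∀ s₁ s₂, s₁ ≤ s₂ → s₂ ≤ T → |s₁ - s| < δ → |s₂ - s| < δ → ∀ t₀ ≤ T, ∀ c κ,
      ((s₁ = t₀ ∧ ψ t₀ = 0 ∧ c = 0) ∨
        ∃ κ₁, AdmIn g u α β T (β s₁) t₀ s₁ κ₁ ∧ c = ψ s₁ ^ 2 * κ₁) →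
      ψ s₂ ≠ 0 →
      ψ s₂ ^ 2 * κ = c + (s₂ - s₁) *
        (cutoffConst n α * k ^ 2 - curveDeficit g u α β T s * ψ s ^ 2 + ε) →
      AdmIn g u α β T (β s₂) t₀ s₂ κ := by
  obtain ⟨A, A', δ₀, hA⟩ := hβ.exists_isVariationField (p := β s) hu hupos hα' hs
    (mem_extChartAt_source (β s)) hψ
  set p := β s with hp
  have hn : (0 : ℝ) < n := by exact_mod_cast Nat.pos_of_ne_zero (NeZero.ne n)
  -- The n basis vectors contribute ε/(2n) each to the error; the remaining ε/2 is used for the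
  -- increment of `momentumTrace`.
  obtain ⟨δ₁, hδ₁, hstep⟩ := hβ.startIn_step hu hupos hs hA
    (show 0 < ε / (2 * n) by positivity)
  obtain ⟨δ₂, hδ₂, htrace⟩ := abs_sub_sub_mul_le_of_hasDerivWithinAt hA.pos
    (fun t ht hts => hβ.hasDerivWithinAt_momentumTrace hu hupos hA ht hts)
    (hβ.continuousWithinAt_momentumTraceDeriv hu hupos hs hA) (half_pos hε)
  have hδ : 0 < min δ₀ (min δ₁ δ₂) := by have := hA.pos; positivity
  refine ⟨_, hδ, fun s₁ s₂ h12 h2T hs1 hs2 t₀ ht₀ c κ hstart hne hκ => ?_⟩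
  have hs1' := hs1.trans_le (min_le_left _ _)
  have hs2' := hs2.trans_le (min_le_left _ _)
  have h1T := h12.trans h2T
  obtain ⟨B, hB, hBtr⟩ : ∃ B, StartIn g u α β T p t₀ s₁ (A s₁) B ∧
      ∑ a : Fin n, B (EuclideanSpace.single a 1) (EuclideanSpace.single a 1)
        - momentumTrace g u α β T p A s₁ ≤ c := by
    rcases hstart with ⟨rfl, h0, rfl⟩ | ⟨κ₁, h1, rfl⟩
    · exact exists_startIn_of_eq_zero hA ht₀ hs1' h0
    · exact (hβ.admIn_chartChange h1T (hA.mem_source s₁ h1T hs1')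
        (mem_extChartAt_source _) h1).exists_startIn hA hupos h1T hs1'
  have h2 := hstep s₁ s₂ h12 h2T (hs1.trans_le ((min_le_right _ _).trans (min_le_left _ _)))
    (hs2.trans_le ((min_le_right _ _).trans (min_le_left _ _))) t₀ ht₀ B hB
  have h3 := (abs_le.1 (htrace s₁ s₂ h12 h2T
    (hs1.trans_le ((min_le_right _ _).trans (min_le_right _ _)))
    (hs2.trans_le ((min_le_right _ _).trans (min_le_right _ _))))).1
  refine hβ.admIn_chartChange h2T (mem_extChartAt_source _) (hA.mem_source s₂ h2T hs2')
    (h2.admIn hA hupos h2T hs2' hne ?_)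
  have h4 := hA.second_variation
  rw [Finset.sum_sub_distrib] at h4
  have e1 : ∑ a : Fin n, (B + (s₂ - s₁) • (variationForm g u α β T p s (A s) (A' s) +
      (ε / (2 * n)) • euclid n)) (EuclideanSpace.single a 1) (EuclideanSpace.single a 1) =
      ∑ a : Fin n, B (EuclideanSpace.single a 1) (EuclideanSpace.single a 1) + (s₂ - s₁) *
      (∑ a : Fin n, lagrangianHess g u α p (coord n β p s, vel n β T p s)
      (A s (EuclideanSpace.single a 1), A' s (EuclideanSpace.single a 1))
      (A s (EuclideanSpace.single a 1), A' s (EuclideanSpace.single a 1)) + ε / 2) := by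
    have e2 : ∑ _a : Fin n, ε / (2 * n) = ε / 2 := by
      simp
      field_simp
    rw [← e2, ← Finset.sum_add_distrib, Finset.mul_sum, ← Finset.sum_add_distrib]
    refine Finset.sum_congr rfl fun a _ => ?_
    simp only [add_apply, smul_apply, smul_eq_mul, euclid_self]
    simp only [PiLp.norm_single, norm_one, one_pow, mul_one]
    rfl
  rw [e1, hκ]
  have h5 : 0 ≤ s₂ - s₁ := by linarith
  have h6 := mul_le_mul_of_nonneg_left h4 h5
  rw [curveDeficit]
  linarith

end MinCurve

end

end StepAdm

/-! ### Riccati comparison over long intervals. -/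

section Propagation

variable {n : ℕ} [NeZero n] {M : Type*} [TopologicalSpace M]
  [ChartedSpace (EuclideanHalfSpace n) M] [IsManifold (𝓡∂ n) ∞ M]
  {g : Metric n M} {u : M → ℝ} {α : ℝ} {β : ℝ → M} {T : ℝ} {p : M}

theorem AdmIn.mono {t₀ s κ κ' : ℝ} (hupos : ∀ x, 0 < u x) (h : AdmIn g u α β T p t₀ s κ)
    (hκ : κ ≤ κ') : AdmIn g u α β T p t₀ s κ' := by
  obtain ⟨Q, hQ, htr⟩ := h
  exact ⟨Q, hQ, htr.trans (mul_le_mul_of_nonneg_right hκ (Real.rpow_pos_of_pos (hupos _) _).le)⟩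

/-- The value `c` of the Riccati quantity, scaled by the square of the cutoff function, is attained
at time `s`. -/
def RiccatiAt (g : Metric n M) (u : M → ℝ) (α : ℝ) (β : ℝ → M) (T : ℝ) (ψ : ℝ → ℝ) (t₀ s c : ℝ) :
    Prop :=
  (s = t₀ ∧ ψ t₀ = 0 ∧ c = 0) ∨ ∃ κ, AdmIn g u α β T (β s) t₀ s κ ∧ c = ψ s ^ 2 * κ

section

variable (hβ : MinCurve g u α β T) (hu : ContMDiff (𝓡∂ n) 𝓘(ℝ, ℝ) 2 u) (hupos : ∀ x, 0 < u x)
include hβ hu hupos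

namespace MinCurve

/-- Compactness subdivides [a, b] into finitely many steps, each inside one neighbourhood supplied
by `admIn_step`. The errors add up to (b - a)ε and the nonnegative deficit is discarded. Working
with ψ²κ instead of κ allows the start at a zero of ψ. -/
theorem riccatiAt_propagate (hα' : ((n : ℝ) - 1) / 4 < 1 / α)
    (hD : ∀ s ≤ T, 0 ≤ curveDeficit g u α β T s) {ψ : ℝ → ℝ} {k : ℝ}
    (hψ : ∀ t, HasDerivAt ψ k t) {a b : ℝ} (hab : a ≤ b) (hb : b ≤ T)
    (hne : ∀ t ∈ Ioc a b, ψ t ≠ 0) {ε : ℝ} (hε : 0 < ε) {t₀ c : ℝ} (ht₀ : t₀ ≤ T)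
    (h : RiccatiAt g u α β T ψ t₀ a c) :
    RiccatiAt g u α β T ψ t₀ b (c + (b - a) * (cutoffConst n α * k ^ 2 + ε)) := by
  have hstep : ∀ s : Icc a b, _ := fun s => hβ.admIn_step hu hupos hα' (s.2.2.trans hb) hψ hε
  choose δ hδ hst using hstep
  obtain ⟨t, ht0, htm, ⟨m, hm⟩, htc⟩ := exists_monotone_Icc_subset_open_cover_Icc hab
    (c := fun s : Icc a b => Metric.ball s (δ s)) (fun s => Metric.isOpen_ball)
    (fun s _ => mem_iUnion.2 ⟨s, Metric.mem_ball_self (hδ s)⟩)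
  have key : ∀ i, RiccatiAt g u α β T ψ t₀ (t i)
      (c + ((t i : ℝ) - a) * (cutoffConst n α * k ^ 2 + ε)) := by
    intro i
    induction i with
    | zero => simpa [ht0] using h
    | succ i ih =>
      obtain ⟨s, hs⟩ := htc i
      have hle : t i ≤ t (i + 1) := htm (Nat.le_succ i)
      rcases hle.eq_or_lt with heq | hlt
      · rw [← heq]; exact ih
      have hlt' : (t i : ℝ) < t (i + 1) := hlt
      have h1 : |(t i : ℝ) - s| < δ s := by
        have := hs ⟨le_rfl, hle⟩
        rwa [Metric.mem_ball, Subtype.dist_eq, Real.dist_eq] at this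
      have h2 : |(t (i + 1) : ℝ) - s| < δ s := by
        have := hs ⟨hle, le_rfl⟩
        rwa [Metric.mem_ball, Subtype.dist_eq, Real.dist_eq] at this
      have hne' : ψ (t (i + 1)) ≠ 0 :=
        hne _ ⟨(t i).2.1.trans_lt hlt', (t (i + 1)).2.2⟩
      -- The value prescribed by the step with the deficit retained; it is then enlarged by dropping
      -- the deficit term.
      set κ := (c + ((t i : ℝ) - a) * (cutoffConst n α * k ^ 2 + ε) +
        ((t (i + 1) : ℝ) - t i) * (cutoffConst n α * k ^ 2 - curveDeficit g u α β T s * ψ s ^ 2 + ε)) /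
          ψ (t (i + 1)) ^ 2 with hκ
      have hpos : 0 < ψ (t (i + 1)) ^ 2 := by positivity
      have h3 := hst s (t i) (t (i + 1)) hle ((t (i + 1)).2.2.trans hb) h1 h2 t₀ ht₀ _ κ ih hne' (by
        rw [hκ]; field_simp)
      refine Or.inr ⟨(c + ((t (i + 1) : ℝ) - a) * (cutoffConst n α * k ^ 2 + ε)) /
        ψ (t (i + 1)) ^ 2, h3.mono hupos ?_, by field_simp⟩
      rw [hκ]
      refine div_le_div_of_nonneg_right ?_ hpos.le
      have h4 : 0 ≤ curveDeficit g u α β T s * ψ s ^ 2 :=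
        mul_nonneg (hD s (s.2.2.trans hb)) (sq_nonneg _)
      have h5 : 0 ≤ ((t (i + 1) : ℝ) - t i) * (curveDeficit g u α β T s * ψ s ^ 2) :=
        mul_nonneg (by linarith) h4
      linarith
  have := key m
  rwa [hm m le_rfl] at this

/-- The cutoff rises linearly from 0 at s - R to 1 at s. Its derivative costs C/R² over length R,
and with ε = 1/R² the total is (C + 1)/R. Completeness to the left is used here, since R must be
arbitrarily large. -/
theorem exists_admIn_le (hα' : ((n : ℝ) - 1) / 4 < 1 / α)
    (hD : ∀ s ≤ T, 0 ≤ curveDeficit g u α β T s) {s : ℝ} (hs : s ≤ T) {η : ℝ} (hη : 0 < η) :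
    ∃ t₀ < s, AdmIn g u α β T (β s) t₀ s η := by
  set C := |cutoffConst n α| with hC
  set R := 2 * (C + 1) / η with hR
  have hC0 : 0 ≤ C := abs_nonneg _
  have hR0 : 0 < R := by positivity
  have h := hβ.riccatiAt_propagate hu hupos hα' hD (ψ := fun t => (t - (s - R)) / R) (k := 1 / R)
    (fun t => ((hasDerivAt_id t).sub_const _).div_const R) (a := s - R) (b := s) (by linarith) hs
    (fun t ht => by
      have : 0 < (t - (s - R)) / R := div_pos (by linarith [ht.1]) hR0
      exact this.ne') (ε := 1 / R ^ 2) (by positivity) (t₀ := s - R) (c := 0) (by linarith)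
    (Or.inl ⟨rfl, by simp, rfl⟩)
  rcases h with ⟨h1, _⟩ | ⟨κ, h1, h2⟩
  · linarith
  refine ⟨s - R, by linarith, h1.mono hupos ?_⟩
  have e : (s - (s - R)) / R = 1 := by
    rw [sub_sub_cancel]
    exact div_self hR0.ne'
  simp only [e] at h2
  have e2 : 0 + (s - (s - R)) * (cutoffConst n α * (1 / R) ^ 2 + 1 / R ^ 2) =
      (cutoffConst n α + 1) / R := by
    field_simp
    ring
  rw [e2, one_pow, one_mul] at h2
  rw [← h2, div_le_iff₀ hR0]
  have e3 : η * R = 2 * (C + 1) := by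
    rw [hR]
    field_simp
  rw [e3]
  have := le_abs_self (cutoffConst n α)
  linarith

/-- Once κ is tiny just before s, a constant cutoff costs nothing; a positive deficit near s pushes
κ below zero, and the way from s to T cannot bring it back. -/
theorem exists_admIn_neg (hα' : ((n : ℝ) - 1) / 4 < 1 / α)
    (hD : ∀ s ≤ T, 0 ≤ curveDeficit g u α β T s) {s : ℝ} (hs : s ≤ T)
    (hpos : 0 < curveDeficit g u α β T s) :
    ∃ t₀ < T, ∃ κ < 0, AdmIn g u α β T (β T) t₀ T κ := by
  set d := curveDeficit g u α β T s with hd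
  have hψ : ∀ t : ℝ, HasDerivAt (fun _ : ℝ => (1 : ℝ)) 0 t := fun t => hasDerivAt_const t 1
  obtain ⟨δ, hδ, hst⟩ := hβ.admIn_step hu hupos hα' hs hψ (half_pos hpos)
  set s₁ := s - δ / 2 with hs₁
  -- Budget: κ starts at δd/16, drops by (δ/2)(d/2) = δd/4 on [s - δ/2, s], and regains at most
  -- δd/16 from s to T.
  have hη : 0 < δ * d / 16 := by positivity
  obtain ⟨t₀, ht₀, h1⟩ := hβ.exists_admIn_le hu hupos hα' hD (s := s₁) (by linarith) hη
  have h2 := hst s₁ s (by linarith) hs (by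
    rw [hs₁, abs_lt]; constructor <;> linarith) (by simpa using hδ) t₀ (by linarith) _
    (δ * d / 16 - δ / 2 * (d / 2)) (Or.inr ⟨_, h1, rfl⟩) one_ne_zero (by
      rw [hs₁]; ring)
  have h3 := hβ.riccatiAt_propagate hu hupos hα' hD hψ hs le_rfl (fun _ _ => one_ne_zero)
    (ε := δ * d / (16 * (T - s + 1))) (by
      have : 0 ≤ T - s := by linarith
      positivity) (t₀ := t₀) (by linarith) (Or.inr ⟨_, h2, rfl⟩)
  rcases h3 with ⟨h4, _⟩ | ⟨κ, h4, h5⟩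
  · exfalso
    linarith
  refine ⟨t₀, by linarith, κ, ?_, h4⟩
  have h6 : (T - s) * (δ * d / (16 * (T - s + 1))) ≤ δ * d / 16 := by
    have h7 : 0 ≤ T - s := by linarith
    rw [← mul_div_assoc, div_le_div_iff₀ (by positivity) (by norm_num)]
    nlinarith
  have h8 : κ = δ * d / 16 - δ / 2 * (d / 2) + (T - s) * (δ * d / (16 * (T - s + 1))) := by
    have := h5
    simp only [one_pow, one_mul] at this
    rw [← this]
    ring
  rw [h8]
  linarith

end MinCurve

end

end Propagation

/-! ### Comparison of the deficit with the curvature hypothesis. -/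

section Deficit

variable {n : ℕ} [NeZero n] {M : Type*} [TopologicalSpace M]
  [ChartedSpace (EuclideanHalfSpace n) M] [IsManifold (𝓡∂ n) ∞ M]
  {g : Metric n M} {u : M → ℝ} {α : ℝ}

/-- The tangent space at x is identified with the model space through the preferred chart at x,
whose derivative at x is therefore the identity. -/
theorem components_eq (x : M) (v : EuclideanSpace ℝ (Fin n)) : components x v = v := by
  have h : fderivWithin ℝ (extChartAt (𝓡∂ n) x ∘ (extChartAt (𝓡∂ n) x).symm)
      (range (𝓡∂ n)) (extChartAt (𝓡∂ n) x x) = ContinuousLinearMap.id ℝ _ := by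
    rw [← fderivWithin_id (uniqueDiffOn_range _ (mem_range_self _))]
    refine Filter.EventuallyEq.fderivWithin_eq ?_ ((extChartAt (𝓡∂ n) x).right_inv (mem_extChartAt_target x))
    filter_upwards [extChartAt_target_mem_nhdsWithin x] with y hy
    exact (extChartAt (𝓡∂ n) x).right_inv hy
  have h2 : MDifferentiableAt (𝓡∂ n) 𝓘(ℝ, EuclideanSpace ℝ (Fin n)) (extChartAt (𝓡∂ n) x) x :=
    mdifferentiableAt_extChartAt (mem_chart_source _ x)
  have h3 : mfderiv (𝓡∂ n) 𝓘(ℝ, EuclideanSpace ℝ (Fin n)) (extChartAt (𝓡∂ n) x) x =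
      ContinuousLinearMap.id ℝ (EuclideanSpace ℝ (Fin n)) := h2.mfderiv.trans h
  exact congrArg (fun f : EuclideanSpace ℝ (Fin n) →L[ℝ] EuclideanSpace ℝ (Fin n) => f v) h3

theorem inner_eq_metricForm (x : M) (v w : EuclideanSpace ℝ (Fin n)) :
    g.inner x v w = metricForm g x (extChartAt (𝓡∂ n) x x) v w := by
  have h : ∀ v : EuclideanSpace ℝ (Fin n),
      (chartInvDeriv x (extChartAt (𝓡∂ n) x x) v : EuclideanSpace ℝ (Fin n)) = v := by
    intro v
    have h1 := mfderiv_extChartAt_comp_mfderivWithin_extChartAt_symm' (mem_extChartAt_source (I := 𝓡∂ n) x)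
    have h2 := congrArg (fun f => f v) h1
    exact (components_eq x _).symm.trans h2
  rw [metricForm_apply, inner_eq_of_eq g (extChartAt_to_inv (I := 𝓡∂ n) x).symm v w]
  exact congrArg₂ (fun a b : EuclideanSpace ℝ (Fin n) => g.inner ((extChartAt (𝓡∂ n) x).symm (extChartAt (𝓡∂ n) x x)) a b) (h v).symm (h w).symm

/-- The infimum is a real `sInf`, so the set must be shown to be bounded below. A frame maps the
Euclidean unit sphere onto the g-unit sphere, which bounds the coordinates of unit vectors by ‖F‖.
-/
theorem ricciMin_le (x : M) {v : EuclideanSpace ℝ (Fin n)}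
    (hv : metricForm g x (extChartAt (𝓡∂ n) x x) v v = 1) :
    ricciMin g x ≤ ∑ j, ∑ k, ricciCoord g x j k (extChartAt (𝓡∂ n) x x) * v j * v k := by
  set y := extChartAt (𝓡∂ n) x x with hy
  have hr : ∀ v : EuclideanSpace ℝ (Fin n), ricci g x v = ∑ j, ∑ k, ricciCoord g x j k y * v j * v k := by
    intro v
    simp only [ricci, components_eq]
    rfl
  obtain ⟨F, hF⟩ := exists_isFrame g x (mem_extChartAt_target (I := 𝓡∂ n) x)
  refine csInf_le ⟨-∑ j, ∑ k, |ricciCoord g x j k y| * ‖F‖ ^ 2, ?_⟩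
    ⟨v, (inner_eq_metricForm x v v).trans hv, (hr v).symm⟩
  rintro r ⟨(w : EuclideanSpace ℝ (Fin n)), hw, rfl⟩
  rw [inner_eq_metricForm x w w] at hw
  rw [hr w]
  obtain ⟨z, hz⟩ := hF.surjective w
  have hz1 : ‖z‖ = 1 := by
    have := hF z z
    rw [hz, hw, real_inner_self_eq_norm_sq] at this
    nlinarith [norm_nonneg z]
  have hn : ‖w‖ ≤ ‖F‖ := by
    rw [← hz]
    exact (F.le_opNorm z).trans (by rw [hz1, mul_one])
  have hc : ∀ j, |w j| ≤ ‖F‖ := fun j =>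
    (PiLp.norm_apply_le w j).trans hn
  rw [← Finset.sum_neg_distrib]
  refine Finset.sum_le_sum fun j _ => ?_
  rw [← Finset.sum_neg_distrib]
  refine Finset.sum_le_sum fun k _ => ?_
  refine neg_le_of_abs_le ?_
  rw [abs_mul, abs_mul, mul_assoc, sq]
  exact mul_le_mul_of_nonneg_left (mul_le_mul (hc j) (hc k) (abs_nonneg _) (norm_nonneg _)) (abs_nonneg _)

theorem fderivWithin_chartWeight (hu : ContMDiff (𝓡∂ n) 𝓘(ℝ, ℝ) 2 u) (hupos : ∀ x, 0 < u x)
    (p : M) {y : EuclideanSpace ℝ (Fin n)} (hy : y ∈ (extChartAt (𝓡∂ n) p).target) :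
    fderivWithin ℝ (chartWeight n u α p) (range (𝓡∂ n)) y =
      (α * coordFun p u y ^ (α - 1)) • fderivWithin ℝ (coordFun p u) (range (𝓡∂ n)) y :=
  (((contDiffWithinAt_coordFun hu p hy).differentiableWithinAt (by norm_num)).hasFDerivWithinAt.rpow_const
    (Or.inl (hupos _).ne')).fderivWithin (uniqueDiffOn_range _ (extChartAt_target_subset_range p hy))

theorem fderivWithin_fderivWithin_chartWeight (hu : ContMDiff (𝓡∂ n) 𝓘(ℝ, ℝ) 2 u)
    (hupos : ∀ x, 0 < u x) (p : M) {y : EuclideanSpace ℝ (Fin n)}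
    (hy : y ∈ (extChartAt (𝓡∂ n) p).target) (a b : EuclideanSpace ℝ (Fin n)) :
    fderivWithin ℝ (fderivWithin ℝ (chartWeight n u α p) (range (𝓡∂ n))) (range (𝓡∂ n)) y a b =
      (α * coordFun p u y ^ (α - 1)) *
        fderivWithin ℝ (fderivWithin ℝ (coordFun p u) (range (𝓡∂ n))) (range (𝓡∂ n)) y a b
      + α * (α - 1) * coordFun p u y ^ (α - 2) *
        (fderivWithin ℝ (coordFun p u) (range (𝓡∂ n)) y a *
          fderivWithin ℝ (coordFun p u) (range (𝓡∂ n)) y b) := by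
  have hy' := extChartAt_target_subset_range p hy
  have h1 : fderivWithin ℝ (chartWeight n u α p) (range (𝓡∂ n)) =ᶠ[𝓝[range (𝓡∂ n)] y]
      fun z => (α * coordFun p u z ^ (α - 1)) • fderivWithin ℝ (coordFun p u) (range (𝓡∂ n)) z := by
    filter_upwards [extChartAt_target_mem_nhdsWithin_of_mem hy] with z hz
    exact fderivWithin_chartWeight hu hupos p hz
  have hf := contDiffWithinAt_coordFun hu p hy
  have h2 := ((hf.differentiableWithinAt (by norm_num)).hasFDerivWithinAt.rpow_const
    (p := α - 1) (Or.inl (hupos _).ne')).const_mul α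
  have h3 := ((hf.fderivWithin_right uniqueDiffOn_range (m := 1) (by norm_num) hy').differentiableWithinAt
    (by norm_num)).hasFDerivWithinAt
  have h4 := h2.smul h3
  rw [h1.fderivWithin_eq (h1.self_of_nhdsWithin hy')]
  refine (congrArg (fun L => L a b) (h4.fderivWithin (uniqueDiffOn_range y hy'))).trans ?_
  simp only [add_apply, smul_apply, ContinuousLinearMap.smulRight_apply, smul_eq_mul]
  rw [show α - 1 - 1 = α - 2 by ring]
  ring

theorem partialDeriv_partialDeriv {f : EuclideanSpace ℝ (Fin n) → ℝ} {y : EuclideanSpace ℝ (Fin n)}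
    (hf : ContDiffWithinAt ℝ 2 f (range (𝓡∂ n)) y) (hy : y ∈ range (𝓡∂ n)) (i j : Fin n) :
    partialDeriv i (partialDeriv j f) y =
      fderivWithin ℝ (fderivWithin ℝ f (range (𝓡∂ n))) (range (𝓡∂ n)) y (EuclideanSpace.single i 1)
        (EuclideanSpace.single j 1) := by
  have h3 := ((hf.fderivWithin_right uniqueDiffOn_range (m := 1) (by norm_num) hy).differentiableWithinAt
    (by norm_num)).hasFDerivWithinAt
  have h4 := h3.clm_apply (hasFDerivWithinAt_const (EuclideanSpace.single j (1 : ℝ)) y _)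
  have h5 : partialDeriv j f =
    fun z => fderivWithin ℝ f (range (𝓡∂ n)) z (EuclideanSpace.single j 1) := rfl
  rw [partialDeriv, h5, h4.fderivWithin (uniqueDiffOn_range y hy)]
  simp

theorem laplacian_eq_gTrace (hu : ContMDiff (𝓡∂ n) 𝓘(ℝ, ℝ) 2 u) (x : M) :
    laplacian g u x = gTrace g x (extChartAt (𝓡∂ n) x x)
      (covHess g x (coordFun x u) (extChartAt (𝓡∂ n) x x)) := by
  have hy := mem_extChartAt_target (I := 𝓡∂ n) x
  have hf := contDiffWithinAt_coordFun hu x hy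
  simp only [laplacian, gTrace, covHess, sub_apply, christoffelForm_apply,
    partialDeriv_partialDeriv hf (mem_range_self _)]
  refine Finset.sum_congr rfl fun i _ => Finset.sum_congr rfl fun j _ => ?_
  congr 2
  rw [eq_sum_single (christoffelMap g x _ (EuclideanSpace.single i 1) (EuclideanSpace.single j 1))]
  simp only [map_sum, map_smul, smul_eq_mul, christoffelMap_single]
  rfl

theorem sq_gradNorm (x : M) : gradNorm g u x ^ 2 =
    fderivWithin ℝ (coordFun x u) (range (𝓡∂ n)) (extChartAt (𝓡∂ n) x x)
      (gradVec g x (extChartAt (𝓡∂ n) x x)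
        (fderivWithin ℝ (coordFun x u) (range (𝓡∂ n)) (extChartAt (𝓡∂ n) x x))) := by
  have hy := mem_extChartAt_target (I := 𝓡∂ n) x
  set d := fderivWithin ℝ (coordFun x u) (range (𝓡∂ n)) (extChartAt (𝓡∂ n) x x) with hd
  have h : ∑ i, ∑ j, gramInv g x (extChartAt (𝓡∂ n) x x) i j *
    partialDeriv i (coordFun x u) (extChartAt (𝓡∂ n) x x) *
    partialDeriv j (coordFun x u) (extChartAt (𝓡∂ n) x x) =
      d (gradVec g x (extChartAt (𝓡∂ n) x x) d) := by
    simp only [gradVec, map_sum, map_smul, smul_eq_mul]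
    refine Finset.sum_congr rfl fun i _ => Finset.sum_congr rfl fun j _ => ?_
    simp only [partialDeriv, ← hd]
    ring
  rw [gradNorm, h, Real.sq_sqrt]
  obtain ⟨F, hF⟩ := exists_isFrame g x hy
  rw [hF.gradVec_eq]
  simp only [map_sum, map_smul, smul_eq_mul]
  exact Finset.sum_nonneg fun a _ => mul_self_nonneg _

/-- Here Δ(u^α)/u^α = αu⁻¹Δu + α(α-1)|∇u|²/u² and |l|² = α²|∇u|²/u², so the gradient terms combine
to (1/α)|l|². Bounding l(v)² by |l|² subtracts ((n-1)/4 + c/2)|l|² with c = 1/α - (n-1)/4, which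
leaves (c/2)|l|². -/
theorem le_deficit (hu : ContMDiff (𝓡∂ n) 𝓘(ℝ, ℝ) 2 u) (hupos : ∀ x, 0 < u x)
    (hα : 0 < α) (hα' : ((n : ℝ) - 1) / 4 < 1 / α) (hn : 2 ≤ n)
    (x : M) {v : EuclideanSpace ℝ (Fin n)} (hv : metricForm g x (extChartAt (𝓡∂ n) x x) v v = 1) :
    ricciMin g x - α * (u x)⁻¹ * laplacian g u x
      + (1 / α - ((n : ℝ) - 1) / 4) / 2 * (α * gradNorm g u x / u x) ^ 2
      ≤ deficit g u α x (extChartAt (𝓡∂ n) x x) v := by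
  have hy := mem_extChartAt_target (I := 𝓡∂ n) x
  set y := extChartAt (𝓡∂ n) x x with hy_def
  have hf : coordFun x u y = u x := congrArg u (extChartAt_to_inv (I := 𝓡∂ n) x)
  have hux := hupos x
  set d := fderivWithin ℝ (coordFun x u) (range (𝓡∂ n)) y with hd
  have hW : chartWeight n u α x y = u x ^ α := by rw [← hf]; rfl
  have hp1 : u x ^ (α - 1) = u x ^ α / u x := by rw [Real.rpow_sub_one hux.ne']
  have hp2 : u x ^ (α - 2) = u x ^ α / u x ^ 2 := by
    rw [Real.rpow_sub hux]; norm_num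
  have hWp : 0 < u x ^ α := Real.rpow_pos_of_pos hux _
  have hDW : fderivWithin ℝ (chartWeight n u α x) (range (𝓡∂ n)) y = (α * (u x ^ α / u x)) • d := by
    rw [fderivWithin_chartWeight hu hupos x hy, hf, hp1]
  have hlog : logDeriv n u α x y = (α / u x) • d := by
    rw [logDeriv, hW, hDW, smul_smul]
    congr 1
    field_simp
  obtain ⟨F, hF⟩ := exists_isFrame g x hy
  have hgn : gradNorm g u x ^ 2 = ∑ a, d (F (EuclideanSpace.single a 1)) ^ 2 := by
    rw [sq_gradNorm, hF.gradVec_eq]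
    simp only [map_sum, map_smul, smul_eq_mul, sq]
    rfl
  have htr : gTrace g x y (covHess g x (chartWeight n u α x) y) =
      (α * (u x ^ α / u x)) * laplacian g u x
        + α * (α - 1) * (u x ^ α / u x ^ 2) * gradNorm g u x ^ 2 := by
    rw [laplacian_eq_gTrace hu, hF.gTrace_eq, hF.gTrace_eq, hgn, Finset.mul_sum, Finset.mul_sum,
      ← Finset.sum_add_distrib]
    refine Finset.sum_congr rfl fun a _ => ?_
    simp only [covHess, sub_apply, christoffelForm_apply]
    rw [fderivWithin_fderivWithin_chartWeight hu hupos x hy, hDW, hf, hp1, hp2]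
    simp only [smul_apply, smul_eq_mul, ← hd]
    ring
  have hlg : logDeriv n u α x y (gradVec g x y (logDeriv n u α x y)) =
      (α / u x) ^ 2 * gradNorm g u x ^ 2 := by
    rw [hlog, hF.gradVec_eq, hgn]
    simp only [map_sum, map_smul, smul_apply, smul_eq_mul, Finset.mul_sum]
    exact Finset.sum_congr rfl fun a _ => by ring
  -- Cauchy-Schwarz for a unit vector v, as nonnegativity of |∇u - du(v)v|².
  have hcs : d v ^ 2 ≤ gradNorm g u x ^ 2 := by
    have h1 : metricForm g x y (gradVec g x y d - d v • v) (gradVec g x y d - d v • v) =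
        gradNorm g u x ^ 2 - d v ^ 2 := by
      simp only [map_sub, map_smul, sub_apply, smul_apply, smul_eq_mul, hv, metricForm_gradVec hy]
      rw [metricForm_symm g x y v, metricForm_gradVec hy, sq_gradNorm]
      ring
    have h2 : 0 ≤ metricForm g x y (gradVec g x y d - d v • v) (gradVec g x y d - d v • v) := by
      by_cases h : gradVec g x y d - d v • v = 0
      · rw [h]; simp
      · exact (metricForm_pos g x hy h).le
    linarith
  have hric := ricciMin_le (g := g) x hv
  rw [deficit, htr, hlg, hlog, hW]
  simp only [smul_apply, smul_eq_mul]
  have e1 : ((α * (u x ^ α / u x)) * laplacian g u x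
      + α * (α - 1) * (u x ^ α / u x ^ 2) * gradNorm g u x ^ 2) / u x ^ α =
      α * (u x)⁻¹ * laplacian g u x + α * (α - 1) / u x ^ 2 * gradNorm g u x ^ 2 := by
    field_simp
  rw [e1]
  have e2 : ∀ c : ℝ, c * (α / u x * d v) ^ 2 = c * (α / u x) ^ 2 * d v ^ 2 := fun c => by ring
  rw [e2]
  set c1 := ((n : ℝ) - 1) / 4 with hc1
  have hc1' : 0 ≤ c1 := by
    have : (2 : ℝ) ≤ n := by exact_mod_cast hn
    rw [hc1]; linarith
  have h3 : (c1 + (1 / α - c1) / 2) * (α / u x) ^ 2 * d v ^ 2 ≤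
      (c1 + (1 / α - c1) / 2) * (α / u x) ^ 2 * gradNorm g u x ^ 2 :=
    mul_le_mul_of_nonneg_left hcs (mul_nonneg (by linarith) (sq_nonneg _))
  have e3 : α * (α - 1) / u x ^ 2 * gradNorm g u x ^ 2 =
      (α / u x) ^ 2 * gradNorm g u x ^ 2 - 1 / α * (α / u x) ^ 2 * gradNorm g u x ^ 2 := by
    field_simp
  have e4 : (α * gradNorm g u x / u x) ^ 2 = (α / u x) ^ 2 * gradNorm g u x ^ 2 := by ring
  rw [e3, e4]
  linarith

end Deficit

/-! ### Contact of a free boundary minimizer with the boundary. -/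

section FreeCurve

variable {n : ℕ} [NeZero n] {M : Type*} [TopologicalSpace M]
  [ChartedSpace (EuclideanHalfSpace n) M] [IsManifold (𝓡∂ n) ∞ M]

/-- Interior points are recognized in any chart containing them, not only in the preferred chart at
the point. -/
theorem mem_interior_iff_coord_pos {p x : M} (hp : x ∈ (extChartAt (𝓡∂ n) p).source) :
    x ∈ (𝓡∂ n).interior M ↔ 0 < extChartAt (𝓡∂ n) p x 0 := by
  have hi : extChartAt (𝓡∂ n) p x ∈ _root_.interior (range (𝓡∂ n)) ↔
      0 < extChartAt (𝓡∂ n) p x 0 := by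
    rw [interior_range_modelWithCornersEuclideanHalfSpace]
    rfl
  rw [← hi]
  constructor
  · intro h
    have h1 := target_mem_nhds_of_interior h hp
    rw [mem_interior_iff_mem_nhds]
    exact mem_of_superset h1 (extChartAt_target_subset_range p)
  · intro h
    have h1 : (extChartAt (𝓡∂ n) p).target ∈ 𝓝 (extChartAt (𝓡∂ n) p x) := by
      have h2 := extChartAt_target_mem_nhdsWithin_of_mem ((extChartAt (𝓡∂ n) p).map_source hp)
      rwa [nhdsWithin_eq_nhds.2 (mem_interior_iff_mem_nhds.1 h)] at h2
    rw [extChartAt_source] at hp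
    exact ((𝓡∂ n).isInteriorPoint_iff_of_mem_atlas (n := 1) (by simp) (chart_mem_atlas _ p) hp).2
      (mem_interior_iff_mem_nhds.2 h1)

theorem mem_boundary_iff_coord_eq_zero {p x : M} (hp : x ∈ (extChartAt (𝓡∂ n) p).source) :
    x ∈ (𝓡∂ n).boundary M ↔ extChartAt (𝓡∂ n) p x 0 = 0 := by
  have h1 : 0 ≤ extChartAt (𝓡∂ n) p x 0 := by
    have : extChartAt (𝓡∂ n) p x ∈ range (𝓡∂ n) := mem_range_self _
    rwa [range_eq_setOf] at this
  rw [← (𝓡∂ n).compl_interior, mem_compl_iff, mem_interior_iff_coord_pos hp, not_lt]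
  exact ⟨fun h => h.antisymm h1, fun h => h.le⟩

theorem symm_mem_boundary {p : M} {y : EuclideanSpace ℝ (Fin n)}
    (hy : y ∈ (extChartAt (𝓡∂ n) p).target) (h0 : y 0 = 0) :
    (extChartAt (𝓡∂ n) p).symm y ∈ (𝓡∂ n).boundary M := by
  rw [mem_boundary_iff_coord_eq_zero ((extChartAt (𝓡∂ n) p).map_target hy),
    (extChartAt (𝓡∂ n) p).right_inv hy, h0]

/-- `β` is a unit speed curve on `(-∞, T]` that minimizes the weighted length in the free boundary
sense. -/
structure FreeCurve (g : Metric n M) (u : M → ℝ) (α : ℝ) (β : ℝ → M) (T : ℝ) : Prop where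
  contMDiffOn : ContMDiffOn 𝓘(ℝ, ℝ) (𝓡∂ n) 1 β (Iic T)
  unit_speed : ∀ s ∈ Iic T, g.inner (β s) (mfderivWithin 𝓘(ℝ, ℝ) (𝓡∂ n) β (Iic T) s (1 : ℝ))
      (mfderivWithin 𝓘(ℝ, ℝ) (𝓡∂ n) β (Iic T) s (1 : ℝ)) = 1
  minimizing : ∀ s₁ s₂, s₁ ≤ s₂ → s₂ ≤ T → ∀ l, Reach g u α (β s₁) (β s₂) l →
    ∫ s in s₁..s₂, u (β s) ^ α ≤ l
  free : ∀ s₁ s₂, s₁ ≤ s₂ → s₂ ≤ T → ∀ x ∈ (𝓡∂ n).boundary M, ∀ y ∈ (𝓡∂ n).boundary M, ∀ l l',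
    Reach g u α (β s₁) x l → Reach g u α (β s₂) y l' → ∫ s in s₁..s₂, u (β s) ^ α ≤ l + l'

variable {g : Metric n M} {u : M → ℝ} {α : ℝ} {β : ℝ → M} {T : ℝ}

/-- Points close to a boundary point can be joined to the boundary at a cost proportional to their
first coordinate. -/
theorem eventually_reach_boundary (hu : ContMDiff (𝓡∂ n) 𝓘(ℝ, ℝ) 2 u) (hupos : ∀ x, 0 < u x)
    {p : M} {y₀ : EuclideanSpace ℝ (Fin n)} (hy₀ : y₀ ∈ (extChartAt (𝓡∂ n) p).target)
    (h0 : y₀ 0 = 0) :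
    ∃ K > 0, ∀ᶠ y in 𝓝[range (𝓡∂ n)] y₀, ∃ x ∈ (𝓡∂ n).boundary M,
      Reach g u α ((extChartAt (𝓡∂ n) p).symm y) x (K * y 0) := by
  set e : EuclideanSpace ℝ (Fin n) := EuclideanSpace.single 0 1 with he
  set f : EuclideanSpace ℝ (Fin n) → ℝ := fun y => chartWeight n u α p y * Real.sqrt (metricForm g p y e e) with hf
  have hfc : ∀ y ∈ (extChartAt (𝓡∂ n) p).target, ContinuousWithinAt f (range (𝓡∂ n)) y := by
    intro y hy
    exact (contDiffWithinAt_chartWeight hu hupos p hy).continuousWithinAt.mul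
      (((contDiffWithinAt_metricForm g p hy).continuousWithinAt.clm_apply
        continuousWithinAt_const).clm_apply continuousWithinAt_const).sqrt
  have hfn : ∀ y, 0 ≤ f y := fun y => mul_nonneg (chartWeight_pos hupos y).le (Real.sqrt_nonneg _)
  set K := f y₀ + 1 with hK
  have hK0 : 0 < K := by have := hfn y₀; linarith
  have hev : ∀ᶠ y in 𝓝[range (𝓡∂ n)] y₀, y ∈ (extChartAt (𝓡∂ n) p).target ∧ f y < K :=
    (Filter.eventually_mem_set.2 (extChartAt_target_mem_nhdsWithin_of_mem hy₀)).and
      ((hfc y₀ hy₀).eventually (gt_mem_nhds (by linarith)))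
  obtain ⟨r, hr, hball⟩ := Metric.mem_nhdsWithin_iff.1 hev
  refine ⟨K, hK0, ?_⟩
  filter_upwards [inter_mem_nhdsWithin (range (𝓡∂ n)) (Metric.ball_mem_nhds y₀ (half_pos hr))]
    with y hy
  have hy0 : 0 ≤ y 0 := by
    have := hy.1
    rwa [range_eq_setOf] at this
  have hyn : y 0 ≤ ‖y - y₀‖ := by
    have := PiLp.norm_apply_le (y - y₀) 0
    rw [PiLp.sub_apply, h0, sub_zero, Real.norm_of_nonneg hy0] at this
    exact this
  have hyd : ‖y - y₀‖ < r / 2 := by rw [← dist_eq_norm]; exact hy.2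
  set ξ : ℝ → EuclideanSpace ℝ (Fin n) := fun t => y - (t * y 0) • e with hξ
  have hξ0 : ∀ t, ξ t 0 = (1 - t) * y 0 := by
    intro t
    simp [hξ, he]
    ring
  have hmem : ∀ t ∈ Icc (0 : ℝ) 1, ξ t ∈ Metric.ball y₀ r ∩ range (𝓡∂ n) := by
    intro t ht
    constructor
    · rw [Metric.mem_ball, dist_eq_norm]
      have e1 : ξ t - y₀ = (y - y₀) - (t * y 0) • e := by simp only [hξ]; abel
      have e2 : ‖(t * y 0) • e‖ ≤ y 0 := by
        rw [norm_smul, he, PiLp.norm_single, norm_one, mul_one,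
          Real.norm_of_nonneg (mul_nonneg ht.1 hy0)]
        exact mul_le_of_le_one_left hy0 ht.2
      rw [e1]
      calc _ ≤ ‖y - y₀‖ + ‖(t * y 0) • e‖ := norm_sub_le _ _
        _ < r := by linarith
    · rw [range_eq_setOf, mem_ofPred_eq, hξ0]
      exact mul_nonneg (by linarith [ht.2]) hy0
  have harc := Reach.arc (g := g) (α := α) hu hupos p (ξ := ξ) (ξ' := fun _ => -(y 0 • e)) zero_le_one
    (fun t _ => by
      have h1 : HasDerivAt ξ (-((1 * y 0) • e)) t :=
        (((hasDerivAt_id t).mul_const (y 0)).smul_const e).const_sub y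
      rw [one_mul] at h1
      exact h1.hasDerivWithinAt) continuousOn_const
    (fun t ht => (hball (hmem t ht)).1)
  have e0 : ξ 0 = y := by simp [hξ]
  rw [e0] at harc
  refine ⟨_, symm_mem_boundary (hball (hmem 1 ⟨zero_le_one, le_rfl⟩)).1 (by rw [hξ0]; ring),
    harc.mono ?_⟩
  have hval : ∀ t, chartWeight n u α p (ξ t) *
      Real.sqrt (metricForm g p (ξ t) (-(y 0 • e)) (-(y 0 • e))) = f (ξ t) * y 0 := by
    intro t
    have e3 : metricForm g p (ξ t) (-(y 0 • e)) (-(y 0 • e)) =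
        y 0 ^ 2 * metricForm g p (ξ t) e e := by
      simp
      ring
    rw [e3, Real.sqrt_mul (sq_nonneg _), Real.sqrt_sq hy0]
    simp only [hf]
    ring
  simp only [hval]
  have hb : ∀ t ∈ uIoc (0 : ℝ) 1, ‖f (ξ t) * y 0‖ ≤ K * y 0 := by
    intro t ht
    rw [uIoc_of_le zero_le_one] at ht
    rw [Real.norm_of_nonneg (mul_nonneg (hfn _) hy0)]
    exact mul_le_mul_of_nonneg_right (hball (hmem t ⟨ht.1.le, ht.2⟩)).2.le hy0
  have := intervalIntegral.norm_integral_le_of_norm_le_const hb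
  rw [sub_zero, abs_one, mul_one] at this
  exact (le_abs_self _).trans this

namespace FreeCurve

section

variable (hβ : FreeCurve g u α β T) (hu : ContMDiff (𝓡∂ n) 𝓘(ℝ, ℝ) 2 u) (hupos : ∀ x, 0 < u x)
include hβ

theorem hasDerivWithinAt_coord {s : ℝ} (hs : s ≤ T) :
    HasDerivWithinAt (coord n β (β s)) (vel n β T (β s) s) (Iic T) s := by
  have h : ContDiffWithinAt ℝ 1 (coord n β (β s)) (Iic T) s :=
    contMDiffWithinAt_iff_contDiffWithinAt.1
      ((contMDiffAt_extChartAt' (mem_chart_source _ (β s))).comp_contMDiffWithinAt s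
        (hβ.contMDiffOn s hs))
  exact (h.differentiableWithinAt (by simp)).hasDerivWithinAt

include hu hupos

/-- If the contact were tangential, the first coordinate of β(t) would be o(s - t), and so would be
the cost of joining β(t) to the boundary. The segment from t to s, however, has weighted length at
least c(s - t). -/
theorem vel_zero_ne_zero {s : ℝ} (hs : s ≤ T) (hb : β s ∈ (𝓡∂ n).boundary M) :
    vel n β T (β s) s 0 ≠ 0 := by
  intro hv
  have h0 : coord n β (β s) s 0 = 0 := (mem_boundary_iff_coord_eq_zero (mem_extChartAt_source _)).1 hb
  obtain ⟨K, hK, hev⟩ := eventually_reach_boundary (g := g) (α := α) hu hupos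
    (mem_extChartAt_target (I := 𝓡∂ n) (β s)) h0
  have hd := (hβ.hasDerivWithinAt_coord hs).mono (Iic_subset_Iic.2 hs)
  have hd0 : HasDerivWithinAt (fun t => coord n β (β s) t 0) 0 (Iic s) s := by
    have := (EuclideanSpace.proj (0 : Fin n) : EuclideanSpace ℝ (Fin n) →L[ℝ] ℝ).hasFDerivAt.comp_hasDerivWithinAt s hd
    simp only [PiLp.proj_apply, hv] at this
    exact this
  set c := u (β s) ^ α / 2 with hc
  have hWp : 0 < u (β s) ^ α := Real.rpow_pos_of_pos (hupos _) _
  have hc0 : 0 < c := by positivity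
  have hcont : ContinuousWithinAt (fun t => u (β t) ^ α) (Iic s) s :=
    ((hu.continuous.continuousAt.comp_continuousWithinAt (hβ.contMDiffOn.continuousOn s hs)).mono
      (Iic_subset_Iic.2 hs)).rpow_const (Or.inl (hupos _).ne')
  have hsrc : ∀ᶠ t in 𝓝[Iic s] s, β t ∈ (extChartAt (𝓡∂ n) (β s)).source :=
    ((hβ.contMDiffOn.continuousOn s hs).mono (Iic_subset_Iic.2 hs)).eventually
      ((isOpen_extChartAt_source _).mem_nhds (mem_extChartAt_source _))
  have hlit := (hasDerivWithinAt_iff_isLittleO.1 hd0).def (show (0 : ℝ) < c / (2 * K) by positivity)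
  have hcoord : Tendsto (coord n β (β s)) (𝓝[Iic s] s) (𝓝[range (𝓡∂ n)] (coord n β (β s) s)) :=
    tendsto_nhdsWithin_iff.2 ⟨hd.continuousWithinAt, Eventually.of_forall fun t => coord_mem_range t⟩
  have hall := (hcont.eventually (lt_mem_nhds (show c < u (β s) ^ α by linarith))).and
    (hsrc.and (hlit.and (hcoord.eventually hev)))
  obtain ⟨δ, hδ, hsub⟩ := Metric.mem_nhdsWithin_iff.1 hall
  set t := s - δ / 2 with ht
  have hts : t < s := by linarith
  have hin : ∀ r ∈ Icc t s, r ∈ Metric.ball s δ ∩ Iic s := fun r hr =>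
    ⟨by rw [Metric.mem_ball, Real.dist_eq, abs_lt]; constructor <;> linarith [hr.1, hr.2], hr.2⟩
  obtain ⟨-, h2, h3, x, hx, hreach⟩ := hsub (hin t ⟨le_rfl, hts.le⟩)
  rw [symm_coord h2] at hreach
  -- The end β(s) already lies on the boundary, so its connecting curve is constant and free of
  -- cost.
  have h4 := hβ.free t s hts.le hs x hx (β s) hb _ 0 hreach (Reach.refl _)
  have h5 : c * (s - t) ≤ ∫ r in t..s, u (β r) ^ α := by
    have e : ∫ _ in t..s, c = c * (s - t) := by simp; ring
    rw [← e]
    refine intervalIntegral.integral_mono_on hts.le (by simp)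
      (ContinuousOn.intervalIntegrable ?_) fun r hr => (hsub (hin r hr)).1.le
    rw [uIcc_of_le hts.le]
    exact ((hu.continuous.comp_continuousOn hβ.contMDiffOn.continuousOn).rpow_const
      fun _ _ => Or.inl (hupos _).ne').mono fun r hr => hr.2.trans hs
  simp only [h0, sub_zero, smul_zero, Real.norm_eq_abs] at h3
  rw [abs_sub_comm t s, abs_of_pos (sub_pos.2 hts)] at h3
  have h6 : K * coord n β (β s) t 0 ≤ c * (s - t) / 2 := by
    calc K * coord n β (β s) t 0 ≤ K * (c / (2 * K) * (s - t)) :=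
          mul_le_mul_of_nonneg_left ((le_abs_self _).trans h3) hK.le
      _ = c * (s - t) / 2 := by field_simp
  have h7 : 0 < c * (s - t) := mul_pos hc0 (sub_pos.2 hts)
  linarith

/-- The first coordinate is nonnegative before s and zero at s, so its left slopes are nonpositive;
transversality excludes zero. -/
theorem vel_zero_neg {s : ℝ} (hs : s ≤ T) (hb : β s ∈ (𝓡∂ n).boundary M) :
    vel n β T (β s) s 0 < 0 := by
  refine lt_of_le_of_ne ?_ (hβ.vel_zero_ne_zero hu hupos hs hb)
  have h0 : coord n β (β s) s 0 = 0 := (mem_boundary_iff_coord_eq_zero (mem_extChartAt_source _)).1 hb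
  have hd := (hβ.hasDerivWithinAt_coord hs).mono (Iic_subset_Iic.2 hs)
  have hd0 : HasDerivWithinAt (fun t => coord n β (β s) t 0) (vel n β T (β s) s 0) (Iic s) s :=
    (EuclideanSpace.proj (0 : Fin n) : EuclideanSpace ℝ (Fin n) →L[ℝ] ℝ).hasFDerivAt.comp_hasDerivWithinAt s hd
  have h1 := (hasDerivWithinAt_iff_tendsto_slope' (self_notMem_Iio (a := s))).1 (hd0.mono Iio_subset_Iic_self)
  refine le_of_tendsto h1 ?_
  filter_upwards [self_mem_nhdsWithin] with t ht
  have h2 : coord n β (β s) t ∈ range (𝓡∂ n) := coord_mem_range t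
  rw [range_eq_setOf] at h2
  rw [slope_def_field, h0, sub_zero]
  exact div_nonpos_of_nonneg_of_nonpos h2 (sub_neg.2 ht).le

/-- A contact before the final time would be a two-sided minimum of the first coordinate, hence
tangential. -/
theorem mem_interior {s : ℝ} (hs : s < T) : β s ∈ (𝓡∂ n).interior M := by
  by_contra h
  rw [← mem_compl_iff, (𝓡∂ n).compl_interior] at h
  refine hβ.vel_zero_ne_zero hu hupos hs.le h ?_
  have h0 : coord n β (β s) s 0 = 0 := (mem_boundary_iff_coord_eq_zero (mem_extChartAt_source _)).1 h
  have hd := (hβ.hasDerivWithinAt_coord hs.le).hasDerivAt (Iic_mem_nhds hs)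
  have hd0 : HasDerivAt (fun t => coord n β (β s) t 0) (vel n β T (β s) s 0) s :=
    (EuclideanSpace.proj (0 : Fin n) : EuclideanSpace ℝ (Fin n) →L[ℝ] ℝ).hasFDerivAt.comp_hasDerivAt s hd
  refine IsLocalMin.hasDerivAt_eq_zero (Eventually.of_forall fun t => ?_) hd0
  have h1 : coord n β (β s) t ∈ range (𝓡∂ n) := coord_mem_range t
  rw [range_eq_setOf] at h1
  exact h0.trans_le h1

theorem minCurve : MinCurve g u α β T where
  contMDiffOn := hβ.contMDiffOn
  unit_speed := hβ.unit_speed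
  minimizing := hβ.minimizing
  interior := fun _ hs => hβ.mem_interior hu hupos hs
  endpoint := by
    rcases (𝓡∂ n).isInteriorPoint_or_isBoundaryPoint (β T) with h | h
    · exact Or.inl h
    · exact Or.inr ⟨(mem_boundary_iff_coord_eq_zero (mem_extChartAt_source _)).1 h,
        hβ.vel_zero_neg hu hupos le_rfl h⟩

end

end FreeCurve

end FreeCurve

/-! ### Reduction of complete minimizing curves to half lines ending at T. -/

section FreeCurveOf

variable {n : ℕ} [NeZero n] {M : Type*} [TopologicalSpace M]
  [ChartedSpace (EuclideanHalfSpace n) M] [IsManifold (𝓡∂ n) ∞ M]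
  {g : Metric n M} {u : M → ℝ} {α : ℝ} {γ : ℝ → M} {J : Set ℝ}

/-- Unit speed is stated with derivatives within J, while the length uses two-sided ones; they agree
on the open interval. -/
theorem IsArclengthCurve.weightedLength_eq (hγ : IsArclengthCurve g γ J) (hJ : J.OrdConnected)
    {a b : ℝ} (ha : a ∈ J) (hb : b ∈ J) (hab : a ≤ b) :
    weightedLength g u α γ a b = ∫ s in a..b, u (γ s) ^ α := by
  refine intervalIntegral.integral_congr_Ioo_of_le hab fun s hs => ?_
  have hJs : J ∈ 𝓝 s := mem_of_superset (Icc_mem_nhds hs.1 hs.2) (hJ.out ha hb)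
  have h := hγ.2 s (mem_of_mem_nhds hJs)
  rw [mfderivWithin_of_mem_nhds hJs] at h
  simp only [h, Real.sqrt_one, mul_one]

theorem IsFreeBoundaryMinimizing.integral_le (hmin : IsFreeBoundaryMinimizing g u α γ J)
    (hγ : IsArclengthCurve g γ J) (hJ : J.OrdConnected) {a b : ℝ} (ha : a ∈ J) (hb : b ∈ J)
    (hab : a ≤ b) {l : ℝ} (h : Reach g u α (γ a) (γ b) l) : ∫ s in a..b, u (γ s) ^ α ≤ l := by
  obtain ⟨c, a', b', hab', h1, h2, h3, -, h5⟩ := h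
  rw [← hγ.weightedLength_eq hJ ha hb hab]
  exact ((hmin a ha b hb hab).1 c a' b' hab' h1 h2 h3).trans h5

theorem IsFreeBoundaryMinimizing.integral_le_add (hmin : IsFreeBoundaryMinimizing g u α γ J)
    (hγ : IsArclengthCurve g γ J) (hJ : J.OrdConnected) {a b : ℝ} (ha : a ∈ J) (hb : b ∈ J)
    (hab : a ≤ b) {x y : M} (hx : x ∈ (𝓡∂ n).boundary M) (hy : y ∈ (𝓡∂ n).boundary M) {l l' : ℝ}
    (h : Reach g u α (γ a) x l) (h' : Reach g u α (γ b) y l') :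
    ∫ s in a..b, u (γ s) ^ α ≤ l + l' := by
  obtain ⟨c, c1, c2, hc, h1, h2, h3, -, h5⟩ := h
  obtain ⟨d, d1, d2, hd, k1, k2, k3, -, k5⟩ := h'
  rw [← hγ.weightedLength_eq hJ ha hb hab]
  exact ((hmin a ha b hb hab).2 c d c1 c2 d1 d2 hc hd h1 k1 h2 (h3 ▸ hx) k2 (k3 ▸ hy)).trans
    (add_le_add h5 k5)

theorem IsArclengthCurve.contMDiffOn_comp_mul (hγ : IsArclengthCurve g γ J) {σ T : ℝ}
    (hJ : ∀ t ≤ T, σ * t ∈ J) : ContMDiffOn 𝓘(ℝ, ℝ) (𝓡∂ n) 1 (fun t => γ (σ * t)) (Iic T) := by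
  have h1 : ContMDiff 𝓘(ℝ, ℝ) 𝓘(ℝ, ℝ) 1 (fun t : ℝ => σ * t) := ContDiff.contMDiff (by fun_prop)
  exact hγ.1.comp h1.contMDiffOn hJ

theorem IsArclengthCurve.unit_speed_comp_mul (hγ : IsArclengthCurve g γ J) {σ T : ℝ}
    {β : ℝ → M} (hβ : ∀ t, β t = γ (σ * t))
    (hσ : σ ^ 2 = 1) (hJ : ∀ t ≤ T, σ * t ∈ J) (hud : UniqueDiffOn ℝ J) (s : ℝ) (hs : s ∈ Iic T) :
    g.inner (β s) (mfderivWithin 𝓘(ℝ, ℝ) (𝓡∂ n) β (Iic T) s (1 : ℝ))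
      (mfderivWithin 𝓘(ℝ, ℝ) (𝓡∂ n) β (Iic T) s (1 : ℝ)) = 1 := by
  obtain rfl : β = fun t => γ (σ * t) := funext hβ
  have hsJ := hJ s hs
  have hsrc := mem_extChartAt_source (I := 𝓡∂ n) (γ (σ * s))
  have h1 := hγ.2 _ hsJ
  rw [inner_mfderivWithin g (γ (σ * s)) ((hγ.1 _ hsJ).mdifferentiableWithinAt (by simp))
    (hud _ hsJ) hsrc] at h1
  have h2 := inner_mfderivWithin g (γ (σ * s)) (c := fun t => γ (σ * t))
    ((hγ.contMDiffOn_comp_mul hJ s hs).mdifferentiableWithinAt (by simp)) (uniqueDiffOn_Iic T s hs)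
    hsrc
  refine h2.trans ?_
  have h3 : ContDiffWithinAt ℝ 1 (fun t => extChartAt (𝓡∂ n) (γ (σ * s)) (γ t)) J (σ * s) :=
    contMDiffWithinAt_iff_contDiffWithinAt.1
      ((contMDiffAt_extChartAt' (mem_chart_source _ (γ (σ * s)))).comp_contMDiffWithinAt (σ * s)
        (hγ.1 _ hsJ))
  have h4 := (h3.differentiableWithinAt (by simp)).hasDerivWithinAt
  have h5 : HasDerivWithinAt (fun t => σ * t) σ (Iic T) s := by
    simpa using ((hasDerivAt_id s).const_mul σ).hasDerivWithinAt
  have h6 := (h4.scomp s h5 hJ).derivWithin (uniqueDiffOn_Iic T s hs)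
  have h7 : derivWithin (fun t => extChartAt (𝓡∂ n) (γ (σ * s)) (γ (σ * t))) (Iic T) s =
      σ • derivWithin (fun t => extChartAt (𝓡∂ n) (γ (σ * s)) (γ t)) J (σ * s) := h6
  rw [h7]
  simp only [map_smul, smul_apply, smul_eq_mul]
  rw [h1, mul_one, ← sq, hσ]

theorem freeCurve_forward (hγ : IsArclengthCurve g γ J) (hJ : J.OrdConnected)
    (hud : UniqueDiffOn ℝ J) (hmin : IsFreeBoundaryMinimizing g u α γ J) {T : ℝ} (hT : Iic T ⊆ J) :
    FreeCurve g u α γ T := by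
  have hJ1 : ∀ t ≤ T, 1 * t ∈ J := fun t ht => by rw [one_mul]; exact hT ht
  exact
  { contMDiffOn := by simpa using hγ.contMDiffOn_comp_mul hJ1
    unit_speed := hγ.unit_speed_comp_mul (σ := 1) (fun t => by rw [one_mul]) (by norm_num) hJ1 hud
    minimizing := fun a b hab hb l h =>
      hmin.integral_le hγ hJ (hT (hab.trans hb)) (hT hb) hab h
    free := fun a b hab hb x hx y hy l l' h h' =>
      hmin.integral_le_add hγ hJ (hT (hab.trans hb)) (hT hb) hab hx hy h h' }

/-- Time reversal treats the backward half of a line and a ray that starts on the boundary by the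
same argument as forward curves. -/
theorem freeCurve_backward (hγ : IsArclengthCurve g γ J) (hJ : J.OrdConnected)
    (hud : UniqueDiffOn ℝ J) (hmin : IsFreeBoundaryMinimizing g u α γ J) {T : ℝ}
    (hT : Ici (-T) ⊆ J) : FreeCurve g u α (fun t => γ (-t)) T := by
  have hJ' : ∀ t ≤ T, -t ∈ J := fun t ht => hT (neg_le_neg ht)
  have hJ1 : ∀ t ≤ T, (-1) * t ∈ J := fun t ht => by rw [neg_one_mul]; exact hJ' t ht
  exact
  { contMDiffOn := by
      have h := hγ.contMDiffOn_comp_mul hJ1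
      simp only [neg_one_mul] at h
      exact h
    unit_speed := hγ.unit_speed_comp_mul (σ := -1) (fun t => by rw [neg_one_mul]) (by norm_num)
      hJ1 hud
    minimizing := fun a b hab hb l h => by
      rw [intervalIntegral.integral_comp_neg (fun t => u (γ t) ^ α)]
      exact hmin.integral_le hγ hJ (hJ' b hb) (hJ' a (hab.trans hb)) (neg_le_neg hab) h.symm
    free := fun a b hab hb x hx y hy l l' h h' => by
      rw [intervalIntegral.integral_comp_neg (fun t => u (γ t) ^ α), add_comm]
      exact hmin.integral_le_add hγ hJ (hJ' b hb) (hJ' a (hab.trans hb)) (neg_le_neg hab) hy hx h' h }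

/-- A minimizing complete curve is not compact. -/
theorem IsFreeBoundaryMinimizing.eq_of_mem_boundary (hmin : IsFreeBoundaryMinimizing g u α γ J)
    (hu : ContMDiff (𝓡∂ n) 𝓘(ℝ, ℝ) 2 u) (hupos : ∀ x, 0 < u x)
    (hγ : IsArclengthCurve g γ J) (hJ : J.OrdConnected) {a b : ℝ} (ha : a ∈ J) (hb : b ∈ J)
    (hab : a ≤ b) (hxa : γ a ∈ (𝓡∂ n).boundary M) (hxb : γ b ∈ (𝓡∂ n).boundary M) : a = b := by
  by_contra hne
  have hlt := lt_of_le_of_ne hab hne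
  -- Both ends lie on the boundary, so two constant curves are admissible competitors of total
  -- length zero.
  have h1 := hmin.integral_le_add hγ hJ ha hb hab hxa hxb (Reach.refl _) (Reach.refl _)
  have h2 : 0 < ∫ s in a..b, u (γ s) ^ α := by
    refine intervalIntegral.intervalIntegral_pos_of_pos_on (ContinuousOn.intervalIntegrable ?_)
      (fun s _ => Real.rpow_pos_of_pos (hupos _) _) hlt
    rw [uIcc_of_le hab]
    exact ((hu.continuous.comp_continuousOn hγ.1.continuousOn).rpow_const
      fun _ _ => Or.inl (hupos _).ne').mono (hJ.out ha hb)
  linarith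

theorem IsCompleteCurve.uniqueDiffOn (h : IsCompleteCurve n γ J) : UniqueDiffOn ℝ J := by
  obtain ⟨a, ha, b, hb, hab⟩ := h.2.1
  refine uniqueDiffOn_convex h.1.convex ?_
  rcases lt_or_gt_of_ne hab with hlt | hlt
  · exact (nonempty_Ioo.2 hlt).mono (interior_maximal (Ioo_subset_Icc_self.trans (h.1.out ha hb)) isOpen_Ioo)
  · exact (nonempty_Ioo.2 hlt).mono (interior_maximal (Ioo_subset_Icc_self.trans (h.1.out hb ha)) isOpen_Ioo)

/-- A complete minimizing curve is a line or a ray. -/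
theorem IsCompleteCurve.eq_univ_or_ray (h : IsCompleteCurve n γ J)
    (hmin : IsFreeBoundaryMinimizing g u α γ J)
    (hu : ContMDiff (𝓡∂ n) 𝓘(ℝ, ℝ) 2 u) (hupos : ∀ x, 0 < u x) (hγ : IsArclengthCurve g γ J) :
    J = univ ∨ (∃ b, J = Iic b ∧ γ b ∈ (𝓡∂ n).boundary M) ∨
      ∃ a, J = Ici a ∧ γ a ∈ (𝓡∂ n).boundary M := by
  obtain ⟨hoc, hnt, hcl, hfr⟩ := h
  have hne := hnt.nonempty
  have hup : ∀ b, IsGreatest J b → γ b ∈ (𝓡∂ n).boundary M := fun b hb => by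
    refine hfr b ⟨subset_closure hb.1, fun hi => ?_⟩
    obtain ⟨ε, hε, hsub⟩ := Metric.mem_nhds_iff.1 (mem_interior_iff_mem_nhds.1 hi)
    have := hb.2 (hsub (show b + ε / 2 ∈ Metric.ball b ε by
      rw [Metric.mem_ball, Real.dist_eq, add_sub_cancel_left, abs_of_pos (half_pos hε)]; linarith))
    linarith
  have hlo : ∀ a, IsLeast J a → γ a ∈ (𝓡∂ n).boundary M := fun a ha => by
    refine hfr a ⟨subset_closure ha.1, fun hi => ?_⟩
    obtain ⟨ε, hε, hsub⟩ := Metric.mem_nhds_iff.1 (mem_interior_iff_mem_nhds.1 hi)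
    have := ha.2 (hsub (show a - ε / 2 ∈ Metric.ball a ε by
      rw [Metric.mem_ball, Real.dist_eq, sub_sub_cancel_left, abs_neg, abs_of_pos (half_pos hε)]
      linarith))
    linarith
  by_cases hA : BddAbove J
  · have hb : IsGreatest J (sSup J) := ⟨hcl.csSup_mem hne hA, fun x hx => le_csSup hA hx⟩
    by_cases hB : BddBelow J
    · have ha : IsLeast J (sInf J) := ⟨hcl.csInf_mem hne hB, fun x hx => csInf_le hB hx⟩
      exfalso
      have heq := hmin.eq_of_mem_boundary hu hupos hγ hoc ha.1 hb.1 (ha.2 hb.1) (hlo _ ha) (hup _ hb)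
      obtain ⟨x, hx, y, hy, hxy⟩ := hnt
      have h1 := ha.2 hx
      have h2 := ha.2 hy
      have h3 := hb.2 hx
      have h4 := hb.2 hy
      exact hxy (by linarith)
    · refine Or.inr (Or.inl ⟨sSup J, Subset.antisymm (fun x hx => hb.2 hx) fun x hx => ?_, hup _ hb⟩)
      obtain ⟨y, hy, hyx⟩ := not_bddBelow_iff.1 hB x
      exact hoc.out hy hb.1 ⟨hyx.le, hx⟩
  · by_cases hB : BddBelow J
    · have ha : IsLeast J (sInf J) := ⟨hcl.csInf_mem hne hB, fun x hx => csInf_le hB hx⟩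
      refine Or.inr (Or.inr ⟨sInf J, Subset.antisymm (fun x hx => ha.2 hx) fun x hx => ?_, hlo _ ha⟩)
      obtain ⟨y, hy, hyx⟩ := not_bddAbove_iff.1 hA x
      exact hoc.out ha.1 hy ⟨hx, hyx.le⟩
    · refine Or.inl (eq_univ_of_forall fun x => ?_)
      obtain ⟨y, hy, hyx⟩ := not_bddAbove_iff.1 hA x
      obtain ⟨z, hz, hzx⟩ := not_bddBelow_iff.1 hB x
      exact hoc.out hz hy ⟨hzx.le, hyx.le⟩

end FreeCurveOf

/-! ### Outward normal and mean curvature through Christoffel symbols. -/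

section BoundaryGeometry

variable {n : ℕ} [NeZero n] {M : Type*} [TopologicalSpace M]
  [ChartedSpace (EuclideanHalfSpace n) M] [IsManifold (𝓡∂ n) ∞ M]
  {g : Metric n M} {p : M} {y : EuclideanSpace ℝ (Fin n)}

/-- The vector with components `outwardNormal`. -/
def normalVec (g : Metric n M) (p : M) (y : EuclideanSpace ℝ (Fin n)) : EuclideanSpace ℝ (Fin n) :=
  ∑ k, outwardNormal g p k y • EuclideanSpace.single k 1

theorem normalVec_apply (k : Fin n) : normalVec g p y k = outwardNormal g p k y := by
  simp [normalVec, Pi.single_apply]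

theorem gradVec_proj_apply (i : Fin n) :
    gradVec g p y (EuclideanSpace.proj (0 : Fin n) : EuclideanSpace ℝ (Fin n) →L[ℝ] ℝ) i =
      gramInv g p y i 0 := by
  simp only [gradVec, PiLp.proj_apply, WithLp.ofLp_sum, WithLp.ofLp_smul, Finset.sum_apply,
    Pi.smul_apply, smul_eq_mul, PiLp.single_apply]
  rw [Finset.sum_eq_single i, Finset.sum_eq_single 0]
  · simp
  · intro b _ hb; simp [hb.symm]
  · simp
  · intro b _ hb
    simp [hb.symm]
  · simp

theorem metricForm_gradVec_proj (hy : y ∈ (extChartAt (𝓡∂ n) p).target)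
    (z : EuclideanSpace ℝ (Fin n)) :
    metricForm g p y (gradVec g p y (EuclideanSpace.proj (0 : Fin n) :
      EuclideanSpace ℝ (Fin n) →L[ℝ] ℝ)) z = z 0 := by
  rw [metricForm_gradVec hy, PiLp.proj_apply]

theorem gramInv_zero_zero_pos (hy : y ∈ (extChartAt (𝓡∂ n) p).target) :
    0 < gramInv g p y 0 0 := by
  rw [← gradVec_proj_apply, ← metricForm_gradVec_proj (g := g) hy]
  refine metricForm_pos g p hy fun h => ?_
  have h1 := metricForm_gradVec_proj (g := g) hy (EuclideanSpace.single 0 1)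
  rw [h] at h1
  simp at h1

theorem normalVec_eq : normalVec g p y = (-(Real.sqrt (gramInv g p y 0 0))⁻¹) •
    gradVec g p y (EuclideanSpace.proj (0 : Fin n) : EuclideanSpace ℝ (Fin n) →L[ℝ] ℝ) := by
  ext k
  rw [normalVec_apply, PiLp.smul_apply, gradVec_proj_apply, outwardNormal, smul_eq_mul]
  ring

theorem metricForm_normalVec (hy : y ∈ (extChartAt (𝓡∂ n) p).target)
    (z : EuclideanSpace ℝ (Fin n)) :
    metricForm g p y z (normalVec g p y) = -(z 0) * (Real.sqrt (gramInv g p y 0 0))⁻¹ := by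
  rw [normalVec_eq, map_smul, metricForm_symm, metricForm_gradVec_proj hy, smul_eq_mul]
  ring

/-- A unit vector orthogonal to the boundary that points outwards is the outward normal. -/
theorem eq_normalVec (hy : y ∈ (extChartAt (𝓡∂ n) p).target) {v : EuclideanSpace ℝ (Fin n)}
    (hv : metricForm g p y v v = 1) (hv0 : v 0 < 0)
    (ho : ∀ z : EuclideanSpace ℝ (Fin n), z 0 = 0 → metricForm g p y v z = 0) :
    v = normalVec g p y := by
  set e : EuclideanSpace ℝ (Fin n) := EuclideanSpace.single 0 1 with he
  set c := metricForm g p y v e with hc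
  set w := gradVec g p y (EuclideanSpace.proj (0 : Fin n) : EuclideanSpace ℝ (Fin n) →L[ℝ] ℝ) with hw
  have h1 : ∀ z : EuclideanSpace ℝ (Fin n), metricForm g p y v z = c * z 0 := by
    intro z
    have h2 := ho (z - z 0 • e) (by simp [he])
    rw [map_sub, map_smul, smul_eq_mul] at h2
    linarith
  have h3 : v = c • w := by
    by_contra hne
    have h4 := metricForm_pos g p hy (sub_ne_zero.2 hne)
    have h5 : ∀ z, metricForm g p y (v - c • w) z = 0 := by
      intro z
      simp only [map_sub, map_smul, sub_apply, smul_apply, smul_eq_mul, h1 z]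
      rw [metricForm_gradVec_proj hy, sub_self]
    rw [h5] at h4
    exact lt_irrefl _ h4
  have hg := gramInv_zero_zero_pos (g := g) hy
  have h6 : v 0 = c * gramInv g p y 0 0 := by
    conv_lhs => rw [h3]
    rw [PiLp.smul_apply, gradVec_proj_apply, smul_eq_mul]
  have h7 : c ^ 2 * gramInv g p y 0 0 = 1 := by
    rw [← hv, h1 v, h6]; ring
  have hc0 : c < 0 := by
    rw [h6] at hv0
    by_contra hcc
    push Not at hcc
    linarith [mul_nonneg hcc hg.le]
  have hs := Real.sqrt_pos.2 hg
  have hs2 := Real.sq_sqrt hg.le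
  have h8 : -c = (Real.sqrt (gramInv g p y 0 0))⁻¹ := by
    refine eq_inv_of_mul_eq_one_left ?_
    have h9 : (-c * Real.sqrt (gramInv g p y 0 0)) ^ 2 = 1 := by
      rw [mul_pow, hs2, neg_sq, h7]
    have h10 : 0 < -c * Real.sqrt (gramInv g p y 0 0) := mul_pos (neg_pos.2 hc0) hs
    nlinarith
  rw [normalVec_eq, ← h8, neg_neg]
  exact h3

theorem differentiableWithinAt_gramInv (hy : y ∈ (extChartAt (𝓡∂ n) p).target) (i j : Fin n) :
    DifferentiableWithinAt ℝ (fun z => gramInv g p z i j) (range (𝓡∂ n)) y :=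
  (contDiffWithinAt_gramInv g p hy i j).differentiableWithinAt (by simp)

theorem differentiableWithinAt_outwardNormal (hy : y ∈ (extChartAt (𝓡∂ n) p).target) (k : Fin n) :
    DifferentiableWithinAt ℝ (outwardNormal g p k) (range (𝓡∂ n)) y := by
  have hg := gramInv_zero_zero_pos (g := g) hy
  have h1 : DifferentiableWithinAt ℝ (fun z => -gramInv g p z k 0) (range (𝓡∂ n)) y :=
    (differentiableWithinAt_gramInv hy k 0).fun_neg
  have h2 : DifferentiableWithinAt ℝ (fun z => Real.sqrt (gramInv g p z 0 0)) (range (𝓡∂ n)) y :=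
    (differentiableWithinAt_gramInv hy 0 0).sqrt hg.ne'
  have h3 := h1.fun_mul (h2.inv (Real.sqrt_pos.2 hg).ne')
  refine h3.congr (fun z _ => ?_) ?_ <;> exact div_eq_mul_inv _ _

/-- Since the normal is a multiple of ∇y₀, its product with ∂ⱼ vanishes for j ≠ 0. Differentiating
that product and using metric compatibility leaves -g(Γ(∂ᵢ, ∂ⱼ), η) plus a term that survives only
for j = 0. -/
theorem normalShape_eq (hy : y ∈ (extChartAt (𝓡∂ n) p).target) (i j : Fin n) :
    normalShape g p i j y =
      -((EuclideanSpace.single j (1 : ℝ) : EuclideanSpace ℝ (Fin n)) 0) *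
        partialDeriv i (fun z => (Real.sqrt (gramInv g p z 0 0))⁻¹) y
      - metricForm g p y (christoffelMap g p y (EuclideanSpace.single i 1)
          (EuclideanSpace.single j 1)) (normalVec g p y) := by
  have hyS := extChartAt_target_subset_range p hy
  have hud := uniqueDiffOn_range y hyS
  set ei : EuclideanSpace ℝ (Fin n) := EuclideanSpace.single i 1 with hei
  set ej : EuclideanSpace ℝ (Fin n) := EuclideanSpace.single j 1 with hej
  set ρ : EuclideanSpace ℝ (Fin n) → ℝ := fun z => (Real.sqrt (gramInv g p z 0 0))⁻¹ with hρ
  have hg := gramInv_zero_zero_pos (g := g) hy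
  have hρd : DifferentiableWithinAt ℝ ρ (range (𝓡∂ n)) y :=
    ((differentiableWithinAt_gramInv hy 0 0).sqrt hg.ne').inv (Real.sqrt_pos.2 hg).ne'
  have hgram : ∀ k, DifferentiableWithinAt ℝ (fun z => gramMatrix g p z j k) (range (𝓡∂ n)) y :=
    fun k => (contDiffWithinAt_gramMatrix g p hy j k).differentiableWithinAt (by simp)
  have h1 : HasFDerivWithinAt (fun z => ∑ k, gramMatrix g p z j k * outwardNormal g p k z) _
      (range (𝓡∂ n)) y :=
    HasFDerivWithinAt.fun_sum fun k (_ : k ∈ Finset.univ) => (hgram k).hasFDerivWithinAt.mul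
      (differentiableWithinAt_outwardNormal (g := g) hy k).hasFDerivWithinAt
  have hsum : ∀ z, ∑ k, gramMatrix g p z j k * outwardNormal g p k z =
      metricForm g p z ej (normalVec g p z) := by
    intro z
    simp only [normalVec, map_sum, map_smul, smul_eq_mul, gramMatrix_apply]
    exact Finset.sum_congr rfl fun k _ => mul_comm _ _
  have h2 : (fun z => ∑ k, gramMatrix g p z j k * outwardNormal g p k z) =ᶠ[𝓝[range (𝓡∂ n)] y]
      fun z => -(ej 0) * ρ z := by
    filter_upwards [extChartAt_target_mem_nhdsWithin_of_mem hy] with z hz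
    rw [hsum, metricForm_normalVec hz]
  have h3 := (hρd.hasFDerivWithinAt.const_mul (-(ej 0))).congr_of_eventuallyEq h2
    (h2.self_of_nhdsWithin hyS)
  have h4 := congrArg (fun L => L ei) (hud.eq h1 h3)
  simp only [sum_apply, add_apply, smul_apply, smul_eq_mul] at h4
  have h5 : ∑ k, outwardNormal g p k y *
      fderivWithin ℝ (fun z => gramMatrix g p z j k) (range (𝓡∂ n)) y ei =
      fderivWithin ℝ (metricForm g p) (range (𝓡∂ n)) y ei ej (normalVec g p y) := by
    simp only [normalVec, map_sum, map_smul, smul_eq_mul]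
    refine Finset.sum_congr rfl fun k _ => ?_
    congr 1
    exact partialDeriv_gramMatrix g p hy i j k
  rw [Finset.sum_add_distrib, h5, fderivWithin_metricForm_eq g p hy] at h4
  have h6 : ∑ k, gramMatrix g p y j k * ∑ l, christoffel g p k i l y * outwardNormal g p l y =
      metricForm g p y ej (christoffelMap g p y ei (normalVec g p y)) := by
    rw [eq_sum_single (christoffelMap g p y ei (normalVec g p y))]
    simp only [map_sum, map_smul, smul_eq_mul]
    refine Finset.sum_congr rfl fun k _ => ?_
    rw [mul_comm, gramMatrix_apply]
    congr 1
    simp only [normalVec, map_sum, map_smul, WithLp.ofLp_sum, WithLp.ofLp_smul, Finset.sum_apply,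
      Pi.smul_apply, smul_eq_mul]
    refine Finset.sum_congr rfl fun l _ => ?_
    rw [christoffelMap_single, mul_comm]
  rw [normalShape]
  simp only [mul_add, Finset.sum_add_distrib]
  rw [h6]
  simp only [partialDeriv, ← hei]
  linarith

/-- In the chart the boundary is flat, so its mean curvature is carried entirely by the Christoffel
symbols. -/
theorem meanCurvature_eq (x : M) :
    meanCurvature g x = -∑ i, ∑ j, (gramInv g x (extChartAt (𝓡∂ n) x x) i j
      - outwardNormal g x i (extChartAt (𝓡∂ n) x x) * outwardNormal g x j (extChartAt (𝓡∂ n) x x)) *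
        metricForm g x (extChartAt (𝓡∂ n) x x)
          (christoffelMap g x (extChartAt (𝓡∂ n) x x) (EuclideanSpace.single i 1)
          (EuclideanSpace.single j 1)) (normalVec g x (extChartAt (𝓡∂ n) x x)) := by
  have hy := mem_extChartAt_target (I := 𝓡∂ n) x
  have hg := gramInv_zero_zero_pos (g := g) hy
  rw [meanCurvature, ← Finset.sum_neg_distrib]
  refine Finset.sum_congr rfl fun i _ => ?_
  -- The tangential inverse metric annihilates dy₀, which removes the j = 0 term of
  -- `normalShape_eq`.
  have h0 : gramInv g x (extChartAt (𝓡∂ n) x x) i 0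
      - outwardNormal g x i (extChartAt (𝓡∂ n) x x) * outwardNormal g x 0 (extChartAt (𝓡∂ n) x x)
      = 0 := by
    have h1 := Real.mul_self_sqrt hg.le
    have h2 := (Real.sqrt_pos.2 hg).ne'
    rw [outwardNormal, outwardNormal, div_mul_div_comm, h1]
    field_simp
    ring
  simp only [normalShape_eq hy, mul_sub, Finset.sum_sub_distrib]
  rw [Finset.sum_eq_single (0 : Fin n)]
  · rw [h0]; ring
  · intro j _ hj
    simp [hj]
  · simp

/-- The trace over the complement of v, computed by projecting a whole frame; no adapted frame has
to be chosen. -/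
theorem IsFrame.sum_project {G : EuclideanSpace ℝ (Fin n) →L[ℝ] EuclideanSpace ℝ (Fin n) →L[ℝ] ℝ}
    {F : EuclideanSpace ℝ (Fin n) →L[ℝ] EuclideanSpace ℝ (Fin n)} (hF : IsFrame G F)
    {v : EuclideanSpace ℝ (Fin n)} (hv : G v v = 1)
    (Q : EuclideanSpace ℝ (Fin n) →L[ℝ] EuclideanSpace ℝ (Fin n) →L[ℝ] ℝ) :
    ∑ a, Q (F (EuclideanSpace.single a 1) - G (F (EuclideanSpace.single a 1)) v • v)
        (F (EuclideanSpace.single a 1) - G (F (EuclideanSpace.single a 1)) v • v) =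
      ∑ a, Q (F (EuclideanSpace.single a 1)) (F (EuclideanSpace.single a 1)) - Q v v := by
  set f : Fin n → EuclideanSpace ℝ (Fin n) := fun a => F (EuclideanSpace.single a 1) with hf
  have h1 : ∑ a, G (f a) v * Q v (f a) = Q v v := hF.sum_mul_apply (Q v) v
  have h2 : ∑ a, G (f a) v * Q (f a) v = Q v v := hF.sum_mul_apply (Q.flip v) v
  have h3 : ∑ a, G (f a) v * G (f a) v = 1 := by
    rw [← hv]
    exact hF.sum_mul_apply (G.flip v) v
  have h4 : ∀ a, Q (f a - G (f a) v • v) (f a - G (f a) v • v) =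
      Q (f a) (f a) - G (f a) v * Q v (f a) - G (f a) v * Q (f a) v +
        (G (f a) v * G (f a) v) * Q v v := by
    intro a
    simp only [map_sub, map_smul, sub_apply, smul_apply, smul_eq_mul]
    ring
  rw [Finset.sum_congr rfl fun a _ => h4 a, Finset.sum_add_distrib, Finset.sum_sub_distrib,
    Finset.sum_sub_distrib, ← Finset.sum_mul, h1, h2, h3]
  ring

end BoundaryGeometry

/-! ### Second order conditions at the end of a barrier. -/

section Ends

/-- Necessary conditions for a one-sided minimum from an expansion known only up to εt². Applied to
z and -z it also gives a = 0. -/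
theorem nonneg_of_expansion {a q N : ℝ}
    (h : ∀ ε > 0, ∀ᶠ t in 𝓝[>] (0 : ℝ), 0 ≤ t * a + (1 / 2) * (t ^ 2 * q) + ε * (t ^ 2 * N)) :
    0 ≤ a ∧ (a = 0 → 0 ≤ q) := by
  constructor
  · have h1 : Tendsto (fun t : ℝ => a + ((1 / 2) * (t * q) + 1 * (t * N))) (𝓝[>] 0) (𝓝 a) := by
      have h2 : Continuous (fun t : ℝ => a + ((1 / 2) * (t * q) + 1 * (t * N))) := by fun_prop
      have h3 := h2.tendsto 0
      simp only [zero_mul, mul_zero, add_zero] at h3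
      exact h3.mono_left nhdsWithin_le_nhds
    refine ge_of_tendsto h1 ?_
    filter_upwards [h 1 one_pos, self_mem_nhdsWithin] with t ht ht0
    have ht0' : 0 < t := ht0
    by_contra hneg
    push Not at hneg
    have := mul_neg_of_pos_of_neg ht0' hneg
    nlinarith
  · rintro rfl
    have h1 : ∀ ε > 0, 0 ≤ (1 / 2) * q + ε * N := by
      intro ε hε
      obtain ⟨t, ht, ht0⟩ := ((h ε hε).and self_mem_nhdsWithin).exists
      have ht0' : 0 < t := ht0
      by_contra hneg
      push Not at hneg
      have := mul_neg_of_pos_of_neg (pow_pos ht0' 2) hneg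
      nlinarith
    by_contra hq
    push Not at hq
    have hN : 0 < |N| + 1 := by positivity
    have h2 := h1 (-q / (4 * (|N| + 1))) (div_pos (by linarith) (by positivity))
    have h3 : -q / (4 * (|N| + 1)) * N ≤ -q / 4 := by
      rw [div_mul_eq_mul_div, div_le_div_iff₀ (by positivity) (by norm_num)]
      nlinarith [le_abs_self N]
    linarith

theorem tendsto_clm_apply {ι E F : Type*} [NormedAddCommGroup E] [NormedSpace ℝ E]
    [NormedAddCommGroup F] [NormedSpace ℝ F] {l : Filter ι} {L : ι → E →L[ℝ] F} {L₀ : E →L[ℝ] F}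
    {v : ι → E} {v₀ : E} (hL : Tendsto L l (𝓝 L₀)) (hv : Tendsto v l (𝓝 v₀)) :
    Tendsto (fun t => L t (v t)) l (𝓝 (L₀ v₀)) :=
  ((isBoundedBilinearMap_apply (𝕜 := ℝ) (E := E) (F := F)).continuous.tendsto (L₀, v₀)).comp
    (hL.prodMk_nhds hv)

variable {n : ℕ} [NeZero n] {M : Type*} [TopologicalSpace M]
  [ChartedSpace (EuclideanHalfSpace n) M] [IsManifold (𝓡∂ n) ∞ M]
  {g : Metric n M} {u : M → ℝ} {α : ℝ} {β : ℝ → M} {T : ℝ} {p : M}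

theorem gTrace_nonneg {y : EuclideanSpace ℝ (Fin n)} (hy : y ∈ (extChartAt (𝓡∂ n) p).target)
    {B : EuclideanSpace ℝ (Fin n) →L[ℝ] EuclideanSpace ℝ (Fin n) →L[ℝ] ℝ} (hB : ∀ z, 0 ≤ B z z) :
    0 ≤ gTrace g p y B := by
  obtain ⟨F, hF⟩ := exists_isFrame g p hy
  rw [hF.gTrace_eq]
  exact Finset.sum_nonneg fun a _ => hB _

theorem gTrace_add (y : EuclideanSpace ℝ (Fin n))
    (B B' : EuclideanSpace ℝ (Fin n) →L[ℝ] EuclideanSpace ℝ (Fin n) →L[ℝ] ℝ) :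
    gTrace g p y (B + B') = gTrace g p y B + gTrace g p y B' := by
  simp only [gTrace, add_apply, mul_add, Finset.sum_add_distrib]

theorem tendsto_add_smul (y z : EuclideanSpace ℝ (Fin n)) :
    Tendsto (fun t : ℝ => y + t • z) (𝓝[>] 0) (𝓝 y) := by
  have h2 : Continuous (fun t : ℝ => y + t • z) := by fun_prop
  have h3 := h2.tendsto 0
  simp only [zero_smul, add_zero] at h3
  exact h3.mono_left nhdsWithin_le_nhds

/-- Two halves of a minimizing line. -/
theorem AdmIn.add_nonneg (hupos : ∀ x, 0 < u x) {β' : ℝ → M} {T' t₀ t₀' κ κ' : ℝ}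
    (hp : β T ∈ (extChartAt (𝓡∂ n) p).source)
    (hint : β T ∈ (𝓡∂ n).interior M) (hend : β' T' = β T)
    (hvel : vel n β' T' p T' = -vel n β T p T)
    (hmin : ∀ l, Reach g u α (β t₀) (β' t₀') l →
      (∫ t in t₀..T, u (β t) ^ α) + (∫ t in t₀'..T', u (β' t) ^ α) ≤ l)
    (h : AdmIn g u α β T p t₀ T κ) (h' : AdmIn g u α β' T' p t₀' T' κ') : 0 ≤ κ + κ' := by
  obtain ⟨Q, hQ, htr⟩ := h
  obtain ⟨Q', hQ', htr'⟩ := h'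
  have hc : coord n β' p T' = coord n β p T := by rw [coord, coord, hend]
  have hP : momentum g u α β' T' p T' = -momentum g u α β T p T := by
    -- Opposite velocities give opposite momenta; the linear terms of the two barriers cancel and
    -- only Q + Q' remains.
    rw [momentum, momentum, hc, hvel, map_neg, smul_neg]
  rw [hc, hP] at hQ' htr'
  rw [hend] at htr'
  set x := coord n β p T with hx
  set P := momentum g u α β T p T with hPdef
  have hnhds : 𝓝[range (𝓡∂ n)] x = 𝓝 x := nhdsWithin_eq_nhds.2
    (mem_of_superset (target_mem_nhds_of_interior hint hp) (extChartAt_target_subset_range p))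
  have hQQ : ∀ z, 0 ≤ (Q + Q') z z := by
    intro z
    refine (nonneg_of_expansion (a := 0) (N := ‖z‖ ^ 2) fun ε hε => ?_).2 rfl
    have h1 := (hQ _ (half_pos hε)).and (hQ' _ (half_pos hε))
    rw [hnhds] at h1
    filter_upwards [(tendsto_add_smul x z).eventually h1] with t ht
    have h2 := hmin _ (ht.1.trans ht.2.symm)
    simp only [add_sub_cancel_left, map_smul, smul_apply, neg_apply, smul_eq_mul, norm_smul,
      mul_pow, Real.norm_eq_abs, sq_abs] at h2
    rw [add_apply, add_apply]
    nlinarith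
  have h3 := gTrace_nonneg (g := g) (coord_mem_target hp) hQQ
  have e : Q + Q' = (Q - christoffelForm g p x P) + (Q' - christoffelForm g p x (-P)) := by
    have : christoffelForm g p x (-P) = -christoffelForm g p x P := by
      ext a b
      simp [christoffelForm_apply]
    rw [this]
    abel
  rw [← hx, e, gTrace_add] at h3
  have hW : 0 < u (β T) ^ α := Real.rpow_pos_of_pos (hupos _) _
  by_contra hneg
  push Not at hneg
  nlinarith [mul_neg_of_neg_of_pos hneg hW]

section

variable (hβ : MinCurve g u α β T) (hu : ContMDiff (𝓡∂ n) 𝓘(ℝ, ℝ) 2 u) (hupos : ∀ x, 0 < u x)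
include hβ hu hupos

theorem MinCurve.momentum_vel {s : ℝ} (hs : s ≤ T) (hp : β s ∈ (extChartAt (𝓡∂ n) p).source) :
    momentum g u α β T p s (vel n β T p s) = u (β s) ^ α := by
  rw [momentum, smul_apply, hβ.metricForm_vel hs hp, smul_eq_mul, mul_one, chartWeight,
    symm_coord hp]

/-- The second derivative in the direction of the curve of an upper bound for the distance. -/
theorem MinCurve.force_vel_le (hp : β T ∈ (extChartAt (𝓡∂ n) p).source) {t₀ : ℝ} (ht₀ : t₀ < T)
    {Q : EuclideanSpace ℝ (Fin n) →L[ℝ] EuclideanSpace ℝ (Fin n) →L[ℝ] ℝ}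
    (hQ : ∀ ε > 0, ∀ᶠ y in 𝓝[range (𝓡∂ n)] (coord n β p T),
      Reach g u α (β t₀) ((extChartAt (𝓡∂ n) p).symm y)
        ((∫ t in t₀..T, u (β t) ^ α) + (momentum g u α β T p T (y - coord n β p T)
          + (1 / 2) * Q (y - coord n β p T) (y - coord n β p T) + ε * ‖y - coord n β p T‖ ^ 2))) :
    force g u α β T p T (vel n β T p T) ≤ Q (vel n β T p T) (vel n β T p T) := by
  set x := coord n β p T with hx
  set P := momentum g u α β T p with hP
  set v := vel n β T p T with hv
  set W : ℝ → ℝ := fun t => u (β t) ^ α with hW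
  have hWc : ContinuousOn W (Iic T) := hβ.continuousOn_rpow hu hupos
  have hWi : ∀ a ≤ T, ∀ b ≤ T, IntervalIntegrable W volume a b := fun a ha b hb =>
    hβ.intervalIntegrable_rpow hu hupos ha hb
  have hslope : Tendsto (fun t => (t - T)⁻¹ • (coord n β p t - x)) (𝓝[<] T) (𝓝 v) := by
    have h1 := (hasDerivWithinAt_iff_tendsto_slope' (self_notMem_Iio (a := T))).1
      ((hβ.hasDerivWithinAt_coord le_rfl hp).mono Iio_subset_Iic_self)
    exact h1
  have hvc : Tendsto (vel n β T p) (𝓝[<] T) (𝓝 v) :=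
    (hβ.continuousWithinAt_vel le_rfl hp).tendsto.mono_left (nhdsWithin_mono _ Iio_subset_Iic_self)
  have hPs : Tendsto (fun t => (t - T)⁻¹ • (P t - P T)) (𝓝[<] T) (𝓝 (force g u α β T p T)) :=
    (hasDerivWithinAt_iff_tendsto_slope' (self_notMem_Iio (a := T))).1
      ((hβ.hasDerivWithinAt_momentum hu hupos le_rfl hp).mono Iio_subset_Iic_self)
  have hcoord : Tendsto (coord n β p) (𝓝[<] T) (𝓝[range (𝓡∂ n)] x) :=
    tendsto_nhdsWithin_iff.2 ⟨(hβ.continuousWithinAt_coord le_rfl hp).tendsto.mono_left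
      (nhdsWithin_mono _ Iio_subset_Iic_self), Eventually.of_forall fun t => coord_mem_range t⟩
  have hsrc : ∀ᶠ t in 𝓝[<] T, β t ∈ (extChartAt (𝓡∂ n) p).source :=
    (hβ.eventually_mem_source le_rfl hp).filter_mono (nhdsWithin_mono _ Iio_subset_Iic_self)
  set Fv := force g u α β T p T v with hF
  -- the first order remainder along the curve
  have hlow : ∀ η > 0, ∀ᶠ t in 𝓝[<] T, (Fv - η) * ((t - T) ^ 2 / 2) ≤
      P T (x - coord n β p t) - ∫ r in t..T, W r := by
    intro η hη
    have h1 : Tendsto (fun t => ((t - T)⁻¹ • (P t - P T)) (vel n β T p t)) (𝓝[<] T) (𝓝 Fv) :=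
      tendsto_clm_apply hPs hvc
    have h2 := (h1.eventually (lt_mem_nhds (show Fv - η < Fv by linarith))).and hsrc
    obtain ⟨a, haT, hsub⟩ := (mem_nhdsLT_iff_exists_Ioo_subset' (show T - 1 < T by linarith)).1 h2
    have haT' : a < T := haT
    filter_upwards [Ioo_mem_nhdsLT haT'] with t ht
    set f : ℝ → ℝ := fun r => P T (x - coord n β p r) - (∫ q in r..T, W q)
      - (Fv - η) * ((r - T) ^ 2 / 2) with hf
    have hsrcT : ∀ r ∈ Icc t T, β r ∈ (extChartAt (𝓡∂ n) p).source := by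
      intro r hr
      rcases hr.2.lt_or_eq with h | h
      · exact (hsub ⟨ht.1.trans_le hr.1, h⟩).2
      · rw [h]; exact hp
    have hdint : ∀ r < T, HasDerivAt (fun r => ∫ q in r..T, W q) (-W r) r := by
      intro r hr
      have hc : ContinuousAt W r := (hWc r hr.le).continuousAt (Iic_mem_nhds hr)
      exact intervalIntegral.integral_hasDerivAt_left (hWi r hr.le T le_rfl)
        (hWc.stronglyMeasurableAtFilter_nhdsWithin measurableSet_Iic r |>.filter_mono (by
          rw [nhdsWithin_eq_nhds.2 (Iic_mem_nhds hr)])) hc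
    have hder : ∀ r ∈ Ioo t T, HasDerivAt f (-(P T (vel n β T p r)) + W r - (Fv - η) * (r - T)) r := by
      intro r hr
      have k1 := (hβ.hasDerivWithinAt_coord hr.2.le (hsrcT r ⟨hr.1.le, hr.2.le⟩)).hasDerivAt
        (Iic_mem_nhds hr.2)
      have k2 := (P T).hasFDerivAt.comp_hasDerivAt r (k1.const_sub x)
      have k3 := ((hasDerivAt_id r).sub_const T).fun_pow 2
      have k4 := (k3.div_const 2).const_mul (Fv - η)
      have k5 := (k2.fun_sub (hdint r hr.2)).fun_sub k4
      refine k5.congr_deriv ?_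
      simp
    have hcont : ContinuousOn f (Icc t T) := by
      have k1 : ContinuousOn (coord n β p) (Icc t T) := fun r hr =>
        (hβ.continuousWithinAt_coord hr.2 (hsrcT r hr)).mono fun q hq => hq.2
      have k2 : ContinuousOn (fun r => ∫ q in r..T, W q) (Icc t T) := by
        have k3 := intervalIntegral.continuousOn_primitive_interval_left (f := W) (μ := volume)
          (a := t) (b := T) (by
            rw [uIcc_of_le ht.2.le]
            exact (hWc.mono fun q hq => hq.2).integrableOn_Icc)
        rwa [uIcc_of_le ht.2.le] at k3
      exact (((P T).continuous.comp_continuousOn (continuousOn_const.sub k1)).sub k2).sub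
        (by fun_prop)
    have hanti : AntitoneOn f (Icc t T) := by
      refine antitoneOn_of_deriv_nonpos (convex_Icc t T) hcont (fun r hr => ?_) fun r hr => ?_
      · rw [interior_Icc] at hr
        exact (hder r hr).differentiableAt.differentiableWithinAt
      · rw [interior_Icc] at hr
        rw [(hder r hr).deriv]
        have k1 := (hsub ⟨ht.1.trans hr.1, hr.2⟩).1
        rw [smul_apply, smul_eq_mul, sub_apply, hβ.momentum_vel hu hupos hr.2.le
          (hsrcT r ⟨hr.1.le, hr.2.le⟩)] at k1
        have hrT : r - T < 0 := sub_neg.2 hr.2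
        have k2 := mul_lt_mul_of_neg_left k1 hrT
        rw [mul_inv_cancel_left₀ hrT.ne] at k2
        simp only [hW]
        linarith
    have h5 := hanti ⟨le_rfl, ht.2.le⟩ ⟨ht.2.le, le_rfl⟩ ht.2.le
    have h6 : f T = 0 := by simp [hf, hx]
    rw [h6] at h5
    simp only [hf] at h5
    linarith
  -- At the points β(t) of the curve the barrier cannot lie below the minimal length ∫ W from t₀ to
  -- t. Division by (t - T)² turns this into a bound for Q(v, v).
  have hmain : ∀ η > 0, ∀ ε > 0, Fv - η ≤ Q v v + 2 * ε * ‖v‖ ^ 2 := by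
    intro η hη ε hε
    have h1 : Tendsto (fun t => Q ((t - T)⁻¹ • (coord n β p t - x)) ((t - T)⁻¹ • (coord n β p t - x))
        + 2 * ε * ‖(t - T)⁻¹ • (coord n β p t - x)‖ ^ 2) (𝓝[<] T) (𝓝 (Q v v + 2 * ε * ‖v‖ ^ 2)) := by
      have hcQ : Continuous fun z : EuclideanSpace ℝ (Fin n) => Q z z + 2 * ε * ‖z‖ ^ 2 := by fun_prop
      exact (hcQ.tendsto v).comp hslope
    refine ge_of_tendsto h1 ?_
    filter_upwards [hlow η hη, hcoord.eventually (hQ ε hε), hsrc, self_mem_nhdsWithin,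
      Ioo_mem_nhdsLT ht₀] with t ht1 ht2 ht3 ht4 ht5
    rw [symm_coord ht3] at ht2
    have h2 := hβ.minimizing t₀ t ht5.1.le ht5.2.le _ ht2
    have h3 := intervalIntegral.integral_add_adjacent_intervals (hWi t₀ ht₀.le t ht5.2.le)
      (hWi t ht5.2.le T le_rfl)
    have h4 : P T (x - coord n β p t) = -P T (coord n β p t - x) := by
      rw [← map_neg, neg_sub]
    have hne : t - T ≠ 0 := (sub_neg.2 ht5.2).ne
    have hpos : 0 < (t - T) ^ 2 := by positivity
    have h5 : (Fv - η) * (t - T) ^ 2 ≤ Q (coord n β p t - x) (coord n β p t - x)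
        + 2 * ε * ‖coord n β p t - x‖ ^ 2 := by
      simp only [hW] at h3 ht1
      rw [h4] at ht1
      linarith
    simp only [map_smul, smul_apply, smul_eq_mul, norm_smul, mul_pow, Real.norm_eq_abs, sq_abs]
    have h6 : (t - T)⁻¹ * ((t - T)⁻¹ * Q (coord n β p t - x) (coord n β p t - x)) +
        2 * ε * ((t - T)⁻¹ ^ 2 * ‖coord n β p t - x‖ ^ 2) =
        (Q (coord n β p t - x) (coord n β p t - x) + 2 * ε * ‖coord n β p t - x‖ ^ 2) / (t - T) ^ 2 := by
      field_simp
    rw [h6, le_div_iff₀ hpos]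
    exact h5
  by_contra hneg
  push Not at hneg
  have hN : 0 < ‖v‖ ^ 2 + 1 := by positivity
  have h7 := hmain ((Fv - Q v v) / 4) (by linarith) ((Fv - Q v v) / (8 * (‖v‖ ^ 2 + 1)))
    (div_pos (by linarith) (by positivity))
  have h8 : 2 * ((Fv - Q v v) / (8 * (‖v‖ ^ 2 + 1))) * ‖v‖ ^ 2 ≤ (Fv - Q v v) / 4 := by
    rw [← mul_div_assoc, div_mul_eq_mul_div, div_le_div_iff₀ (by positivity) (by norm_num)]
    nlinarith [sq_nonneg ‖v‖]
  linarith

end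

end Ends

/-! ### Contradiction at the ends and rigidity. -/

section Conclusion

variable {n : ℕ} [NeZero n] {M : Type*} [TopologicalSpace M]
  [ChartedSpace (EuclideanHalfSpace n) M] [IsManifold (𝓡∂ n) ∞ M]
  {g : Metric n M} {u : M → ℝ} {α : ℝ} {β : ℝ → M} {T : ℝ}

theorem fderivWithin_coordFun_normalVec (x : M) :
    fderivWithin ℝ (coordFun x u) (range (𝓡∂ n)) (extChartAt (𝓡∂ n) x x)
      (normalVec g x (extChartAt (𝓡∂ n) x x)) = -inwardNormalDeriv g u x := by
  rw [inwardNormalDeriv, neg_neg, normalVec]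
  simp only [map_sum, map_smul, smul_eq_mul]
  rfl

section

variable (hβ : MinCurve g u α β T) (hu : ContMDiff (𝓡∂ n) 𝓘(ℝ, ℝ) 2 u) (hupos : ∀ x, 0 < u x)
include hβ hu hupos

/-- At a free boundary point the Riccati quantity is nonnegative. -/
theorem MinCurve.nonneg_of_boundary (hb : β T ∈ (𝓡∂ n).boundary M)
    (hv0 : vel n β T (β T) T 0 < 0)
    (hfree : ∀ t₀ ≤ T, ∀ y ∈ (𝓡∂ n).boundary M, ∀ l, Reach g u α (β t₀) y l →
      ∫ t in t₀..T, u (β t) ^ α ≤ l)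
    (hH : 0 ≤ meanCurvature g (β T) - α * (u (β T))⁻¹ * inwardNormalDeriv g u (β T))
    {t₀ κ : ℝ} (ht₀ : t₀ < T) (h : AdmIn g u α β T (β T) t₀ T κ) : 0 ≤ κ := by
  obtain ⟨Q, hQ, htr⟩ := h
  have hp := mem_extChartAt_source (I := 𝓡∂ n) (β T)
  have hF := hβ.force_vel_le hu hupos hp ht₀ hQ
  have hy := coord_mem_target hp
  have hunit := hβ.metricForm_vel le_rfl hp
  have hPv : ∀ z, momentum g u α β T (β T) T z =
      u (β T) ^ α * metricForm g (β T) (coord n β (β T) T) (vel n β T (β T) T) z := by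
    intro z
    rw [momentum, smul_apply, smul_eq_mul, chartWeight, symm_coord hp]
  have hforce := force_apply g u α β T (β T) T (vel n β T (β T) T)
  have hx0 : coord n β (β T) T 0 = 0 := (mem_boundary_iff_coord_eq_zero hp).1 hb
  set p := β T with hpdef
  set x := coord n β p T with hx
  set v := vel n β T p T with hv
  set P := momentum g u α β T p T with hP
  have hWp : 0 < u p ^ α := Real.rpow_pos_of_pos (hupos _) _
  -- The points x + tz stay on the boundary, so each is an admissible free endpoint and the barrier
  -- there is at least the length of the curve.
  have htan : ∀ z : EuclideanSpace ℝ (Fin n), z 0 = 0 → 0 ≤ P z ∧ (P z = 0 → 0 ≤ Q z z) := by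
    intro z hz
    refine nonneg_of_expansion (N := ‖z‖ ^ 2) fun ε hε => ?_
    have hmem : ∀ t : ℝ, x + t • z ∈ range (𝓡∂ n) := by
      intro t
      rw [range_eq_setOf, mem_ofPred_eq, PiLp.add_apply, PiLp.smul_apply, hx0, hz, smul_zero,
        add_zero]
    have hten : Tendsto (fun t : ℝ => x + t • z) (𝓝[>] 0) (𝓝[range (𝓡∂ n)] x) :=
      tendsto_nhdsWithin_iff.2 ⟨tendsto_add_smul x z, Eventually.of_forall hmem⟩
    filter_upwards [hten.eventually (hQ ε hε),
      hten.eventually (Filter.eventually_mem_set.2 (extChartAt_target_mem_nhdsWithin_of_mem hy))]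
      with t ht ht2
    have h2 := hfree t₀ ht₀.le _ (symm_mem_boundary ht2 (by
      rw [PiLp.add_apply, PiLp.smul_apply, hx0, hz, smul_zero, add_zero])) _ ht
    simp only [add_sub_cancel_left, map_smul, smul_apply, smul_eq_mul, norm_smul,
      mul_pow, Real.norm_eq_abs, sq_abs] at h2
    linarith
  have hP0 : ∀ z : EuclideanSpace ℝ (Fin n), z 0 = 0 → P z = 0 := by
    intro z hz
    have h1 := (htan z hz).1
    have h2 := (htan (-z) (by rw [PiLp.neg_apply, hz, neg_zero])).1
    rw [map_neg] at h2
    linarith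
  have hη : v = normalVec g p x := eq_normalVec hy hunit hv0 fun z hz => by
    have h1 := hP0 z hz
    rw [hPv] at h1
    exact (mul_eq_zero.1 h1).resolve_left hWp.ne'
  obtain ⟨F, hFr⟩ := exists_isFrame g p hy
  have hQt : 0 ≤ gTrace g p x Q - Q v v := by
    rw [hFr.gTrace_eq, ← hFr.sum_project hunit Q]
    refine Finset.sum_nonneg fun a _ => ?_
    set fa := F (EuclideanSpace.single a 1) with hfa
    have hw : (fa - metricForm g p x fa v • v) 0 = 0 := by
      have h1 : metricForm g p x (fa - metricForm g p x fa v • v) v = 0 := by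
        simp only [map_sub, map_smul, sub_apply, smul_apply, smul_eq_mul, hunit]
        ring
      have h2 := metricForm_normalVec (g := g) hy (fa - metricForm g p x fa v • v)
      rw [← hη, h1] at h2
      have h3 := inv_pos.2 (Real.sqrt_pos.2 (gramInv_zero_zero_pos (g := g) hy))
      have h4 := (mul_eq_zero.1 h2.symm).resolve_right h3.ne'
      linarith
    exact (htan _ hw).2 (hP0 _ hw)
  set C := christoffelForm g p x P with hC
  have htrC : gTrace g p x C - C v v = -(u p ^ α * meanCurvature g p) := by
    have h1 : meanCurvature g p = -∑ i, ∑ j, (gramInv g p x i j - v i * v j) *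
        metricForm g p x (christoffelMap g p x (EuclideanSpace.single i 1)
          (EuclideanSpace.single j 1)) v := by
      rw [hη]
      simp only [normalVec_apply]
      exact meanCurvature_eq p
    have h2 : C v v = ∑ i, ∑ j, C (EuclideanSpace.single i 1) (EuclideanSpace.single j 1) * v i * v j :=
      bilin_eq_sum C.toLinearMap₁₂ v v
    rw [h1, mul_neg, neg_neg, h2, gTrace, ← Finset.sum_sub_distrib, Finset.mul_sum]
    refine Finset.sum_congr rfl fun i _ => ?_
    rw [← Finset.sum_sub_distrib, Finset.mul_sum]
    refine Finset.sum_congr rfl fun j _ => ?_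
    rw [hC, christoffelForm_apply, hPv, metricForm_symm g p x v]
    ring
  -- The normal part Q(v, v) - C(v, v) is at least this force minus C(v, v), which is dW(v); since v
  -- is the outward normal, this is where u_s appears.
  have hCv : force g u α β T p T v = fderivWithin ℝ (chartWeight n u α p) (range (𝓡∂ n)) x v
      + C v v := by
    rw [hforce, fderivWithin_metricForm_eq g p hy, hC, christoffelForm_apply, hPv,
      metricForm_symm g p x _ v, chartWeight, symm_coord hp]
    ring
  have hDW : fderivWithin ℝ (chartWeight n u α p) (range (𝓡∂ n)) x v =
      -(u p ^ α * (α * (u p)⁻¹ * inwardNormalDeriv g u p)) := by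
    have hf : coordFun p u x = u p := congrArg u (symm_coord hp)
    have h1 : fderivWithin ℝ (coordFun p u) (range (𝓡∂ n)) x v = -inwardNormalDeriv g u p := by
      rw [hη]
      exact fderivWithin_coordFun_normalVec p
    rw [fderivWithin_chartWeight hu hupos p hy, smul_apply, h1, hf, smul_eq_mul,
      Real.rpow_sub_one (hupos p).ne']
    have := (hupos p).ne'
    field_simp
  have hsub : gTrace g p x (Q - C) = gTrace g p x Q - gTrace g p x C := by
    simp only [gTrace, sub_apply, mul_sub, Finset.sum_sub_distrib]
  rw [hsub] at htr
  have h9 : 0 ≤ u p ^ α * (meanCurvature g p - α * (u p)⁻¹ * inwardNormalDeriv g u p) :=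
    mul_nonneg hWp.le hH
  have h10 : 0 ≤ κ * u p ^ α := by
    rw [mul_sub] at h9
    linarith
  exact nonneg_of_mul_nonneg_left h10 hWp

theorem MinCurve.curveDeficit_nonneg (hα : 0 < α) (hα' : ((n : ℝ) - 1) / 4 < 1 / α) (hn : 2 ≤ n)
    (hRic : ∀ x, 0 ≤ ricciMin g x - α * (u x)⁻¹ * laplacian g u x) (s : ℝ) (hs : s ≤ T) :
    0 ≤ curveDeficit g u α β T s := by
  have h := le_deficit hu hupos hα hα' hn (β s) (hβ.metricForm_vel hs (mem_extChartAt_source _))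
  have h1 : 0 ≤ (1 / α - ((n : ℝ) - 1) / 4) / 2 * (α * gradNorm g u (β s) / u (β s)) ^ 2 :=
    mul_nonneg (by linarith) (sq_nonneg _)
  exact (add_nonneg (hRic (β s)) h1).trans h

/-- The lower bound in `le_deficit` is a sum of two nonnegative terms, the second with a strictly
positive coefficient; a nonpositive deficit kills both. -/
theorem MinCurve.rigidity (hα : 0 < α) (hα' : ((n : ℝ) - 1) / 4 < 1 / α) (hn : 2 ≤ n)
    (hRic : ∀ x, 0 ≤ ricciMin g x - α * (u x)⁻¹ * laplacian g u x) {s : ℝ} (hs : s ≤ T)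
    (h0 : curveDeficit g u α β T s ≤ 0) :
    gradNorm g u (β s) = 0 ∧ ricciMin g (β s) - α * (u (β s))⁻¹ * laplacian g u (β s) = 0 := by
  have h := (le_deficit hu hupos hα hα' hn (β s)
    (hβ.metricForm_vel hs (mem_extChartAt_source _))).trans h0
  have hc : 0 < (1 / α - ((n : ℝ) - 1) / 4) / 2 := by linarith
  have h1 := hRic (β s)
  have h2 := mul_nonneg hc.le (sq_nonneg (α * gradNorm g u (β s) / u (β s)))
  refine ⟨?_, by linarith⟩
  have h3 : (1 / α - ((n : ℝ) - 1) / 4) / 2 * (α * gradNorm g u (β s) / u (β s)) ^ 2 = 0 := by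
    linarith
  have h4 := pow_eq_zero_iff (two_ne_zero) |>.1 ((mul_eq_zero.1 h3).resolve_left hc.ne')
  have h5 := (div_eq_zero_iff.1 h4).resolve_right (hupos _).ne'
  exact (mul_eq_zero.1 h5).resolve_left hα.ne'

end

section

variable (hu : ContMDiff (𝓡∂ n) 𝓘(ℝ, ℝ) 2 u) (hupos : ∀ x, 0 < u x)
include hu hupos

theorem FreeCurve.curveDeficit_nonpos (hβ : FreeCurve g u α β T) (hα : 0 < α)
    (hα' : ((n : ℝ) - 1) / 4 < 1 / α) (hn : 2 ≤ n)
    (hRic : ∀ x, 0 ≤ ricciMin g x - α * (u x)⁻¹ * laplacian g u x)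
    (hH : ∀ x ∈ (𝓡∂ n).boundary M, 0 ≤ meanCurvature g x
      - α * (u x)⁻¹ * inwardNormalDeriv g u x)
    (hb : β T ∈ (𝓡∂ n).boundary M) {s : ℝ} (hs : s ≤ T) : curveDeficit g u α β T s ≤ 0 := by
  have hm := hβ.minCurve hu hupos
  by_contra hpos
  push Not at hpos
  obtain ⟨t₀, ht₀, κ, hκ, hadm⟩ := hm.exists_admIn_neg hu hupos hα'
    (hm.curveDeficit_nonneg hu hupos hα hα' hn hRic) hs hpos
  refine hκ.not_ge (hm.nonneg_of_boundary hu hupos hb (hβ.vel_zero_neg hu hupos le_rfl hb) ?_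
    (hH _ hb) ht₀ hadm)
  intro t ht y hy l hl
  have := hβ.free t T ht le_rfl y hy (β T) hb l 0 hl (Reach.refl _)
  rwa [add_zero] at this

/-- A positive deficit at s would give a barrier with κ < 0 at γ(s) from the forward half. The
reversed half supplies one with -κ/2, and the sum κ/2 is negative, contrary to minimality of the
line. -/
theorem curveDeficit_nonpos_of_line {γ : ℝ → M} (hγ : IsArclengthCurve g γ univ)
    (hmin : IsFreeBoundaryMinimizing g u α γ univ) (hα : 0 < α)
    (hα' : ((n : ℝ) - 1) / 4 < 1 / α) (hn : 2 ≤ n)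
    (hRic : ∀ x, 0 ≤ ricciMin g x - α * (u x)⁻¹ * laplacian g u x) (s : ℝ) :
    curveDeficit g u α γ s s ≤ 0 := by
  have hforw : ∀ T, FreeCurve g u α γ T := fun T =>
    freeCurve_forward hγ ordConnected_univ uniqueDiffOn_univ hmin (subset_univ _)
  have hback : FreeCurve g u α (fun t => γ (-t)) (-s) :=
    freeCurve_backward hγ ordConnected_univ uniqueDiffOn_univ hmin (subset_univ _)
  have hm := (hforw s).minCurve hu hupos
  have hm' := hback.minCurve hu hupos
  have hend : γ (- -s) = γ s := by rw [neg_neg]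
  by_contra hpos
  push Not at hpos
  obtain ⟨t₀, ht₀, κ, hκ, hadm⟩ := hm.exists_admIn_neg hu hupos hα'
    (hm.curveDeficit_nonneg hu hupos hα hα' hn hRic) le_rfl hpos
  obtain ⟨t₁, ht₁, hadm'⟩ := hm'.exists_admIn_le hu hupos hα'
    (hm'.curveDeficit_nonneg hu hupos hα hα' hn hRic) le_rfl (η := -κ / 2) (by linarith)
  simp only [hend] at hadm'
  have hsrc := mem_extChartAt_source (I := 𝓡∂ n) (γ s)
  have hd : HasDerivAt (coord n γ (γ s)) (vel n γ s (γ s) s) s := by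
    have h1 : ContDiffAt ℝ 1 (coord n γ (γ s)) s :=
      contMDiffAt_iff_contDiffAt.1 ((contMDiffAt_extChartAt' (mem_chart_source _ (γ s))).comp s
        (hγ.1.contMDiffAt univ_mem))
    have h2 := (h1.differentiableAt (by simp)).hasDerivAt
    rwa [vel, h2.hasDerivWithinAt.derivWithin (uniqueDiffOn_Iic s s self_mem_Iic)]
  have hvel : vel n (fun t => γ (-t)) (-s) (γ s) (-s) = -vel n γ s (γ s) s := by
    have h1 : HasDerivAt (fun t : ℝ => -t) (-1) (-s) := hasDerivAt_neg (-s)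
    have h2 : HasDerivAt (coord n (fun t => γ (-t)) (γ s)) ((-1 : ℝ) • vel n γ s (γ s) s) (-s) :=
      HasDerivAt.scomp (g₁ := coord n γ (γ s)) (-s) (by rw [neg_neg]; exact hd) h1
    rw [vel, h2.hasDerivWithinAt.derivWithin (uniqueDiffOn_Iic (-s) (-s) self_mem_Iic), neg_one_smul]
  have hcont : Continuous fun t => u (γ t) ^ α :=
    (hu.continuous.comp (continuousOn_univ.1 hγ.1.continuousOn)).rpow_const
      fun _ => Or.inl (hupos _).ne'
  have h := AdmIn.add_nonneg (β' := fun t => γ (-t)) (T' := -s) (t₀' := t₁) hupos hsrc ((hforw (s + 1)).mem_interior hu hupos (by linarith)) hend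
    hvel (fun l hl => by
      rw [intervalIntegral.integral_comp_neg (fun t => u (γ t) ^ α), neg_neg,
        intervalIntegral.integral_add_adjacent_intervals (hcont.intervalIntegrable _ _)
          (hcont.intervalIntegrable _ _)]
      exact hmin.integral_le hγ ordConnected_univ (mem_univ _) (mem_univ _) (by linarith) hl)
    hadm hadm'
  linarith

end

end Conclusion

end WeightedCurves

end

/-! ### The three cases: a line, a ray ending on the boundary, a ray starting there. -/

theorem mainTheorem6 {n : ℕ} [NeZero n] (hn : 2 ≤ n)
    {M : Type*} [TopologicalSpace M] [T2Space M] [SecondCountableTopology M]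
    [ChartedSpace (EuclideanHalfSpace n) M] [IsManifold (𝓡∂ n) ∞ M]
    (g : WeightedCurves.Metric n M)
    (u : M → ℝ) (hu : ContMDiff (𝓡∂ n) 𝓘(ℝ, ℝ) 2 u) (hupos : ∀ x, 0 < u x)
    (α : ℝ) (hα : 0 < α) (hα' : α < 4 / ((n : ℝ) - 1))
    (γ : ℝ → M) (J : Set ℝ)
    (hγ : WeightedCurves.IsArclengthCurve g γ J)
    (hcomplete : WeightedCurves.IsCompleteCurve n γ J)
    (hmin : WeightedCurves.IsFreeBoundaryMinimizing g u α γ J)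
    (hRic : ∀ x, 0 ≤ WeightedCurves.ricciMin g x
      - α * (u x)⁻¹ * WeightedCurves.laplacian g u x)
    (hH : ∀ x ∈ (𝓡∂ n).boundary M, 0 ≤ WeightedCurves.meanCurvature g x
      - α * (u x)⁻¹ * WeightedCurves.inwardNormalDeriv g u x) :
    ∀ s ∈ J, WeightedCurves.gradNorm g u (γ s) = 0 ∧
      WeightedCurves.ricciMin g (γ s)
        - α * (u (γ s))⁻¹ * WeightedCurves.laplacian g u (γ s) = 0 := by
  have hn' : (0 : ℝ) < (n : ℝ) - 1 := by
    have : (2 : ℝ) ≤ n := by exact_mod_cast hn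
    linarith
  -- The bound on α in the form in which it makes the coefficient of the squared gradient positive.
  have hα'' : ((n : ℝ) - 1) / 4 < 1 / α := by
    rw [lt_div_iff₀ hn'] at hα'
    rw [div_lt_div_iff₀ (by norm_num) hα]
    linarith
  have hoc := hcomplete.1
  have hud := hcomplete.uniqueDiffOn
  intro s hs
  rcases hcomplete.eq_univ_or_ray hmin hu hupos hγ with rfl | ⟨b, rfl, hb⟩ | ⟨a, rfl, ha⟩
  · exact ((WeightedCurves.freeCurve_forward hγ hoc hud hmin
      (subset_univ (Iic s))).minCurve hu hupos).rigidity hu hupos hα hα'' hn hRic le_rfl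
      (WeightedCurves.curveDeficit_nonpos_of_line hu hupos hγ hmin hα hα'' hn hRic s)
  · have hf := WeightedCurves.freeCurve_forward hγ hoc hud hmin subset_rfl
    exact (hf.minCurve hu hupos).rigidity hu hupos hα hα'' hn hRic hs
      (hf.curveDeficit_nonpos hu hupos hα hα'' hn hRic hH hb hs)
  · have hf := WeightedCurves.freeCurve_backward (T := -a) hγ hoc hud hmin (by rw [neg_neg])
    have hs' : -s ≤ -a := neg_le_neg hs
    have h := (hf.minCurve hu hupos).rigidity hu hupos hα hα'' hn hRic hs'
      (hf.curveDeficit_nonpos hu hupos hα hα'' hn hRic hH (by rwa [neg_neg]) hs')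
    simp only [neg_neg] at h
    exact h
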